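/- A source without storage receives update packets $0,1,2,\dots$ according to a Poisson process of rate $\lambda>0$ on $[0,\infty)$, with inter-arrival times $\xi_0,\xi_1,\dots$ and arrival times $A_n=\xi_0+\dots+\xi_n$. The transfer time of packet $n$ to the destination is $T_n$, where $T_0,T_1,\dots$ are i.i.d. copies of a random variable $T\ge 0$ with $E[T^2]<\infty$, independent of the arrivals. A packet is generated when it arrives. The age of information at time $t$ is $G(t)=t-r_t$, where $r_t$ is the generation time of the last packet received by time $t$ (initially $r_0=-g_0$ with an arbitrary fixed $g_0\ge 0$). The decision epochs are time $0$ and the times of successful delivery. At each decision epoch the source is idle, and DNP or DOP is chosen for the whole cycle until the next delivery. Under DNP (drop the new packets), the first packet that arrives is transferred completely and all packets that arrive meanwhile are dropped. Under DOP (drop the old packets), every packet that arrives replaces the one in transfer, and the cycle ends when a transfer is completed before the next arrival. For $\theta\in[0,\infty]$ the threshold policy $\theta$ chooses DOP if the current age is less than $\theta$, and DNP otherwise; thus $\theta=\infty$ always chooses DOP. Let $\gamma=P(T_0\le\xi_1)$. Let $d_n=E[\xi_0+T_0]$ be the mean length of a DNP cycle, and let $d_o=E[\xi_0+\Gamma]$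 be the mean length of a DOP cycle, where $\Gamma=\sum_{i=1}^{N-1}\xi_i+T_{N-1}$ with $N=\inf\{i\ge 1:T_{i-1}\le\xi_i\}$. Then $\gamma=E[e^{-\lambda T}]$, and both means are finite with $$d_n=\frac1\lambda+E[T],\qquad d_o=\frac1{\lambda\gamma}.$$ For every $\theta\in[0,\infty]$ the limit $\bar a(\theta)=\lim_{t\to\infty}\frac1t\int_0^tG(u)\,du$ under the threshold policy $\theta$ exists almost surely, and it is a finite constant that does not depend on $g_0$; likewise for the policy that always chooses DOP, with limit $\bar a_{DOP}$. If $d_n\ge d_o$, then always dropping the old packets is optimal among all threshold policies: $$\min_{\theta\in[0,\infty]}\bar a(\theta)=\bar a(\infty)=\inf_{0\le\theta<\infty}\bar a(\theta)=\lim_{\theta\to\infty}\bar a(\theta)=\bar a_{DOP}=\frac1{\lambda\gamma}.$$ -/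

import Mathlib

open MeasureTheory ProbabilityTheory Filter Topology
open scoped ENNReal NNReal

noncomputable section

/-! Sample-path description of a source without storage. `x n` is the time between the arrivals
of packets `n - 1` and `n` (for `n = 0`: the time from `0` to the first arrival), `s n` is the
time needed to transfer packet `n`. -/

/-- The arrival (and generation) time of packet `n`. -/
def arrival (x : ℕ → ℝ) (n : ℕ) : ℝ := ∑ i ∈ Finset.range (n + 1), x i

/-- The first packet that arrives after time `r`. -/
def nextPacket (x : ℕ → ℝ) (r : ℝ) : ℕ := sInf {n | r < arrival x n}

/-- Under DOP, every arrival during a transfer replaces the packet in transfer. If the transfer of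
packet `m` starts on its arrival, the packet delivered is the first `j ≥ m` whose transfer is
completed no later than the arrival of packet `j + 1`. -/
def firstUninterrupted (x s : ℕ → ℝ) (m : ℕ) : ℕ := sInf {j | m ≤ j ∧ s j ≤ x (j + 1)}

/-- The packet delivered at the end of a cycle that starts idle at time `r`; `dop` says whether
DOP (otherwise DNP) is used in this cycle. Under DNP the first packet that arrives is transferred
completely, and all packets that arrive meanwhile are dropped. -/
def deliveredPacket (x s : ℕ → ℝ) (dop : Prop) [Decidable dop] (r : ℝ) : ℕ :=
  if dop then firstUninterrupted x s (nextPacket x r) else nextPacket x r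

/-- A decision epoch: its time, and the generation time of the freshest packet received so far. -/
structure Epoch where
  time : ℝ
  generated : ℝ

/-- The age of information at a decision epoch. -/
def Epoch.age (e : Epoch) : ℝ := e.time - e.generated

open Classical in
/-- The decision epochs under the stationary policy that uses DOP in the cycle that starts with
age `g` if `g ∈ D`, and DNP otherwise. Epoch `0` is time `0`, with age `g₀`; epoch `k + 1` is the
time of the `(k + 1)`-st delivery. -/
def epoch (D : Set ℝ) (g₀ : ℝ) (x s : ℕ → ℝ) : ℕ → Epoch
  | 0 => ⟨0, -g₀⟩
  | k + 1 =>
      let e := epoch D g₀ x s k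
      let j := deliveredPacket x s (e.age ∈ D) e.time
      ⟨arrival x j + s j, arrival x j⟩

/-- The number of deliveries up to time `t`. -/
def deliveries (D : Set ℝ) (g₀ : ℝ) (x s : ℕ → ℝ) (t : ℝ) : ℕ :=
  sSup {k | (epoch D g₀ x s k).time ≤ t}

/-- The age of information at time `t`: `t` minus the generation time of the packet that was
received last. -/
def age (D : Set ℝ) (g₀ : ℝ) (x s : ℕ → ℝ) (t : ℝ) : ℝ :=
  t - (epoch D g₀ x s (deliveries D g₀ x s t)).generated

/-- The time average of the age over `[0, t]`. -/
def avgAge (D : Set ℝ) (g₀ : ℝ) (x s : ℕ → ℝ) (t : ℝ) : ℝ :=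
  (∫ u in (0 : ℝ)..t, age D g₀ x s u) / t

/-- The threshold policy `θ ∈ [0, ∞]`: DOP if the age is below `θ`, otherwise DNP. -/
def thresholdPolicy (θ : ℝ≥0∞) : Set ℝ := {g | ENNReal.ofReal g < θ}

/-- The static policy that always drops old packets. -/
def alwaysDOP : Set ℝ := Set.univ

/-- Length of a cycle under DNP: waiting time for a packet, plus its transfer time. -/
def dnpCycle (x s : ℕ → ℝ) : ℝ := x 0 + s 0

/-- Length of a cycle under DOP: waiting time for the first packet, plus the time until a packet
has been transferred completely, in the midst of interruptions by new arrivals. -/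
def dopCycle (x s : ℕ → ℝ) : ℝ :=
  arrival x (firstUninterrupted x s 0) + s (firstUninterrupted x s 0)

end

/-!
Only the length of a cycle and the age at its end (the transfer time of the delivered packet) matter
for the average age: in a cycle of length `L` that starts with age `g`, the area under the age is
`g * L + L ^ 2 / 2` (`integral_age_cycle`). At a delivery the time to the next arrival is again
exponential, and it is independent of the cycle that has ended, so that the input left for the
following cycles is a copy of the original one (`isRegenerative_cycle`). The pairs (length, final age)
therefore form a chain with two laws, `cycleLaw lam τ true` for DOP and `cycleLaw lam τ false` for
DNP, in which the final age of a cycle selects the law of the next pair.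

The law of such a chain does not change if the pairs are read from two independent i.i.d. streams, one
for each action (`IsRegenerative.map_run_eq`). The strong law for the streams, together with the
balance between the number of cycles that use DOP and the number of cycles that are followed by one
that uses DOP, gives the law of large numbers for the chain
(`IsRegenerative.ae_tendsto_average`); two successive cycles, regarded as one, give that for functions
of two successive pairs. Since the final age under DOP is absolutely continuous with respect to that
under DNP, no policy alternates deterministically between the actions
(`abs_sub_policyAction_lt_one`), as the balance argument for pairs requires. Hence the average age
exists and equals the ratio `averageAge` of a mean area to a mean length (`ae_tendsto_avgAge`).

For the comparison, let `p` be the stationary probability of DOP, `d_o` and `d_n` the mean lengths,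
`m_o` and `m_n` half the second moments of the lengths, `e_o` and `e_n` the mean final ages, and `u`
the stationary mean of the final age on the event that DNP comes next. By `averageAge_eq` the average
age is
`((p e_o + (1 - p) e_n) d_o + u (d_n - d_o) + p m_o + (1 - p) m_n) / (p d_o + (1 - p) d_n)`.
Conditioning a DOP cycle on the outcome of its first transfer yields `d_o = 1 / (λ γ)` and
`e_o d_o + m_o = d_o ^ 2` (`cycleLaw_true_moments`). If `d_o ≤ d_n`, then
`e_n d_o + m_n ≥ d_o d_n` (`mul_le_cycleLaw_false`): indeed `m_n = d_n / λ + E[T ^ 2] / 2`, while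
`d_n = 1 / λ + e_n`, so that the difference of the two sides is `(d_n - d_o) / λ + E[T ^ 2] / 2`. So
the numerator is at least `d_o` times the denominator, with equality if DOP is always used
(`le_averageAge`, `averageAge_alwaysDOP`). As the threshold tends to infinity, `p → 1` and `u → 0`, and
the average age tends to `d_o` (`tendsto_averageAge_thresholdPolicy`).
-/

noncomputable section

/-! ### Splicing independent sequences -/

section Splice

variable {ι X : Type*} [MeasurableSpace X]

/-- The family that takes the coordinates in `p` from the first family, and coordinate `i ∉ p` from
coordinate `σ i` of the second one. -/
def splice (p : ι → Prop) [DecidablePred p] (σ : ι → ι) (z : (ι → X) × (ι → X)) : ι → X :=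
  fun i => if p i then z.1 i else z.2 (σ i)

lemma measurable_splice (p : ι → Prop) [DecidablePred p] (σ : ι → ι) :
    Measurable (splice p σ : (ι → X) × (ι → X) → ι → X) := by
  refine measurable_pi_lambda _ fun i => ?_
  unfold splice
  split_ifs <;> fun_prop

/-- Splicing two independent copies of a family of independent variables gives a further copy, if
every coordinate of the second copy is used at most once and in a place with the same law. -/
lemma map_splice (ν : ι → Measure X) [∀ i, IsProbabilityMeasure (ν i)] (p : ι → Prop)
    [DecidablePred p] (σ : ι → ι) (hσ : Set.InjOn σ {i | ¬ p i}) (hν : ∀ i, ¬ p i → ν (σ i) = ν i) :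
    ((Measure.infinitePi ν).prod (Measure.infinitePi ν)).map (splice p σ)
      = Measure.infinitePi ν := by
  classical
  refine Measure.eq_infinitePi _ fun s t ht => ?_
  rw [Measure.map_apply (measurable_splice p σ)
    (MeasurableSet.pi s.countable_toSet fun i _ => ht i)]
  rcases isEmpty_or_nonempty ι with hι | hι
  · have : s = ∅ := Finset.eq_empty_of_isEmpty s
    subst this
    simp
  set t' : ι → Set X := fun k => t (Function.invFunOn σ {i | ¬ p i} k) with ht'
  have hinv : ∀ i, ¬ p i → Function.invFunOn σ {i | ¬ p i} (σ i) = i := fun i hi =>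
    hσ.leftInvOn_invFunOn hi
  have hpre : splice p σ ⁻¹' (s : Set ι).pi t
      = ((s.filter p : Finset ι) : Set ι).pi t ×ˢ
        (((s.filter fun i => ¬ p i).image σ : Finset ι) : Set ι).pi t' := by
    ext ⟨z, z'⟩
    simp only [Set.mem_preimage, Set.mem_pi, splice, Set.mem_prod, Finset.coe_image,
      Set.forall_mem_image, Finset.mem_coe, Finset.mem_filter]
    constructor
    · intro h
      refine ⟨fun i hi => by simpa [hi.2] using h i hi.1, fun i hi => ?_⟩
      have := h i hi.1
      simp only [hi.2, if_false] at this
      simpa only [ht', hinv i hi.2] using this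
    · rintro ⟨h1, h2⟩ i hi
      by_cases hp : p i
      · simpa [hp] using h1 i ⟨hi, hp⟩
      · have := h2 ⟨hi, hp⟩
        simp only [ht', hinv i hp] at this
        simpa [hp] using this
  rw [hpre, Measure.prod_prod, Measure.infinitePi_pi _ fun i _ => ht i,
    Measure.infinitePi_pi _ fun i _ => ht _, Finset.prod_image, ← Finset.prod_filter_mul_prod_filter_not s p]
  · congr 1
    refine Finset.prod_congr rfl fun i hi => ?_
    rw [Finset.mem_filter] at hi
    rw [hν i hi.2, hinv i hi.2]
  · intro i hi j hj h
    simp only [Finset.coe_filter, Set.mem_ofPred_eq] at hi hj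
    exact hσ hi.2 hj.2 h

end Splice

/-! ### Cycles that regenerate -/

section Chain

variable {C Z Z' : Type*} [MeasurableSpace C] [MeasurableSpace Z] [MeasurableSpace Z']

/-- The data of cycle `k` when the first cycle is run with action `b`, and a cycle with data `c` is
followed by one with action `lab c`; `Φ b z` consists of the data of a cycle that is run on the
input `z` with action `b`, and of the input that is left for the cycles that follow. -/
def run (Φ : Bool → Z → C × Z) (lab : C → Bool) : ℕ → Bool → Z → C
  | 0, b, z => (Φ b z).1
  | k + 1, b, z => run Φ lab k (lab (Φ b z).1) (Φ b z).2

/-- Under both actions, the input left after a cycle is distributed as the original one, and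
independent of the data of the cycle, which have law `Q b`. -/
structure IsRegenerative (P : Measure Z) (Q : Bool → Measure C) (Φ : Bool → Z → C × Z) : Prop where
  measurable : ∀ b, Measurable (Φ b)
  map_eq : ∀ b, P.map (Φ b) = (Q b).prod P

variable {P : Measure Z} {P' : Measure Z'} {Q : Bool → Measure C} {Φ : Bool → Z → C × Z}
  {Φ' : Bool → Z' → C × Z'} {lab : C → Bool}

lemma IsRegenerative.measurable_run (h : IsRegenerative P Q Φ) (hlab : Measurable lab) (k : ℕ)
    (b : Bool) : Measurable (run Φ lab k b) := by
  induction k generalizing b with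
  | zero => exact (h.measurable b).fst
  | succ k ih =>
    have : Measurable fun y : Bool × Z => run Φ lab k y.1 y.2 :=
      measurable_from_prod_countable_right fun b => ih b
    exact this.comp ((hlab.comp (h.measurable b).fst).prodMk (h.measurable b).snd)

lemma IsRegenerative.measurableSet_run_mem (h : IsRegenerative P Q Φ) (hlab : Measurable lab)
    (n : ℕ) (t : ℕ → Set C) (ht : ∀ i, MeasurableSet (t i)) :
    MeasurableSet {y : C × Z | y.1 ∈ t 0 ∧ ∀ i < n, run Φ lab i (lab y.1) y.2 ∈ t (i + 1)} := by
  have hm : ∀ i, Measurable fun y : C × Z => run Φ lab i (lab y.1) y.2 := fun i => by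
    have : Measurable fun y : Bool × Z => run Φ lab i y.1 y.2 :=
      measurable_from_prod_countable_right fun b => h.measurable_run hlab i b
    exact this.comp ((hlab.comp measurable_fst).prodMk measurable_snd)
  have h1 : MeasurableSet {y : C × Z | ∀ i < n, run Φ lab i (lab y.1) y.2 ∈ t (i + 1)} := by
    have : {y : C × Z | ∀ i < n, run Φ lab i (lab y.1) y.2 ∈ t (i + 1)}
        = ⋂ i, ⋂ (_ : i < n), (fun y : C × Z => run Φ lab i (lab y.1) y.2) ⁻¹' t (i + 1) := by
      ext; simp
    rw [this]
    exact MeasurableSet.iInter fun i => MeasurableSet.iInter fun _ => hm i (ht _)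
  exact (measurable_fst (ht 0)).inter h1

lemma IsRegenerative.measure_run_mem_succ [IsProbabilityMeasure P] (h : IsRegenerative P Q Φ)
    (hlab : Measurable lab) (n : ℕ) (b : Bool) (t : ℕ → Set C) (ht : ∀ i, MeasurableSet (t i)) :
    P {z | ∀ i < n + 1, run Φ lab i b z ∈ t i} = ∫⁻ c, (t 0).indicator
      (fun c => P {z | ∀ i < n, run Φ lab i (lab c) z ∈ t (i + 1)}) c ∂(Q b) := by
  have hS := h.measurableSet_run_mem hlab n t ht
  have : {z | ∀ i < n + 1, run Φ lab i b z ∈ t i} = Φ b ⁻¹'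
      {y : C × Z | y.1 ∈ t 0 ∧ ∀ i < n, run Φ lab i (lab y.1) y.2 ∈ t (i + 1)} := by
    ext z
    simp only [Set.mem_preimage, Set.mem_ofPred_eq]
    constructor
    · intro hz
      exact ⟨hz 0 (by omega), fun i hi => hz (i + 1) (by omega)⟩
    · rintro ⟨h0, hz⟩ (_ | i) hi
      · exact h0
      · exact hz i (by omega)
  rw [this, ← Measure.map_apply (h.measurable b) hS, h.map_eq b, Measure.prod_apply hS]
  refine lintegral_congr fun c => ?_
  by_cases hc : c ∈ t 0 <;> simp [hc]

lemma IsRegenerative.measure_run_mem_eq [IsProbabilityMeasure P] [IsProbabilityMeasure P']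
    [∀ b, IsProbabilityMeasure (Q b)] (h : IsRegenerative P Q Φ) (h' : IsRegenerative P' Q Φ')
    (hlab : Measurable lab) (n : ℕ) (b : Bool) (t : ℕ → Set C) (ht : ∀ i, MeasurableSet (t i)) :
    P {z | ∀ i < n, run Φ lab i b z ∈ t i} = P' {z | ∀ i < n, run Φ' lab i b z ∈ t i} := by
  induction n generalizing b t with
  | zero => simp
  | succ n ih =>
    rw [h.measure_run_mem_succ hlab n b t ht, h'.measure_run_mem_succ hlab n b t ht]
    refine lintegral_congr fun c => ?_
    by_cases hc : c ∈ t 0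
    · simp only [hc, Set.indicator_of_mem]
      exact ih (lab c) (fun i => t (i + 1)) fun i => ht _
    · simp [hc]

/-- The law of the sequence of cycle data depends only on the laws `Q` of the data of one cycle. -/
lemma IsRegenerative.map_run_eq [IsProbabilityMeasure P] [IsProbabilityMeasure P']
    [∀ b, IsProbabilityMeasure (Q b)] (h : IsRegenerative P Q Φ) (h' : IsRegenerative P' Q Φ')
    (hlab : Measurable lab) (b : Bool) :
    P.map (fun z k => run Φ lab k b z) = P'.map (fun z k => run Φ' lab k b z) := by
  have m1 : Measurable fun z k => run Φ lab k b z :=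
    measurable_pi_lambda _ fun k => h.measurable_run hlab k b
  have m2 : Measurable fun z k => run Φ' lab k b z :=
    measurable_pi_lambda _ fun k => h'.measurable_run hlab k b
  have : IsProbabilityMeasure (P.map fun z k => run Φ lab k b z) :=
    Measure.isProbabilityMeasure_map m1.aemeasurable
  have : IsProbabilityMeasure (P'.map fun z k => run Φ' lab k b z) :=
    Measure.isProbabilityMeasure_map m2.aemeasurable
  refine ext_of_generate_finite _ (generateFrom_squareCylinders (α := fun _ : ℕ => C)).symm
    (isPiSystem_squareCylinders (fun _ => MeasurableSpace.isPiSystem_measurableSet) (by simp))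
    ?_ (by simp)
  rintro _ ⟨s, t, ht, rfl⟩
  have ht' : ∀ i, MeasurableSet (t i) := by simpa [Set.mem_pi] using ht
  have hs : MeasurableSet ((s : Set ℕ).pi t) :=
    MeasurableSet.pi s.countable_toSet fun i _ => ht' i
  rw [Measure.map_apply m1 hs, Measure.map_apply m2 hs]
  classical
  have key := h.measure_run_mem_eq h' hlab (s.sup id + 1) b (fun i => if i ∈ s then t i else Set.univ)
    fun i => by split_ifs; exacts [ht' i, MeasurableSet.univ]
  have aux : ∀ w : ℕ → C, w ∈ (s : Set ℕ).pi t ↔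
      ∀ i < s.sup id + 1, w i ∈ if i ∈ s then t i else Set.univ := by
    intro w
    constructor
    · intro hw i _
      split_ifs with his
      exacts [hw i his, trivial]
    · intro hw i hi
      have := hw i (Nat.lt_succ_of_le (Finset.le_sup (f := id) hi))
      rwa [if_pos (by exact hi)] at this
  convert key using 2
  · ext z; exact aux _
  · ext z; exact aux _

/-! ### Cycles read off from one independent stream per action -/

/-- The cycle that reads its data from stream `b` of a family of two streams. -/
def streamCycle (b : Bool) (u : Bool × ℕ → C) : C × (Bool × ℕ → C) :=
  (u (b, 0), fun i => if i.1 = b then u (b, i.2 + 1) else u i)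

lemma isRegenerative_streamCycle (Q : Bool → Measure C) [∀ b, IsProbabilityMeasure (Q b)] :
    IsRegenerative (Measure.infinitePi fun i : Bool × ℕ => Q i.1) Q streamCycle := by
  have hm : ∀ b, Measurable (streamCycle b : (Bool × ℕ → C) → _) := fun b => by
    refine Measurable.prodMk (measurable_pi_apply _) (measurable_pi_lambda _ fun i => ?_)
    split_ifs <;> fun_prop
  refine ⟨hm, fun b => ?_⟩
  set ρ := Measure.infinitePi fun i : Bool × ℕ => Q i.1
  let σ : Bool × ℕ → Bool × ℕ := fun i => if i.1 = b then (b, i.2 - 1) else i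
  have hsp : (ρ.prod ρ).map (splice (fun i => i = (b, 0)) σ) = ρ := by
    refine map_splice _ _ _ ?_ ?_
    · rintro ⟨b₁, i⟩ hi ⟨b₂, j⟩ hj hij
      simp only [Set.mem_ofPred_eq, Prod.mk.injEq, not_and] at hi hj
      simp only [σ] at hij
      split_ifs at hij with h1 h2 h2
      · have := hi h1
        have := hj h2
        simp only [Prod.mk.injEq, true_and] at hij
        ext
        · exact h1.trans h2.symm
        · simp only; omega
      · simp only [Prod.mk.injEq] at hij; exact absurd hij.1.symm h2
      · simp only [Prod.mk.injEq] at hij; exact absurd hij.1 h1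
      · exact hij
    · rintro ⟨b₁, i⟩ _
      simp only [σ]
      split_ifs with h1
      · simp [h1]
      · rfl
  have hcomp : streamCycle b ∘ splice (fun i => i = (b, 0)) σ
      = Prod.map (fun u : Bool × ℕ → C => u (b, 0)) id := by
    funext ⟨u, v⟩
    simp only [Function.comp, streamCycle, splice, Prod.map, id, if_true, Prod.mk.injEq, true_and]
    funext ⟨b₁, i⟩
    by_cases h1 : b₁ = b
    · simp [h1, σ]
    · simp [h1, σ]
  conv_lhs => rw [← hsp]
  rw [Measure.map_map (hm b) (measurable_splice _ _), hcomp,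
    ← Measure.map_prod_map _ _ (measurable_pi_apply _) measurable_id, Measure.map_id,
    Measure.infinitePi_map_eval]

/-- The law of large numbers for one of the streams. -/
lemma ae_tendsto_stream_average (Q : Bool → Measure C) [∀ b, IsProbabilityMeasure (Q b)] (b : Bool)
    {ψ : C → ℝ} (hψ : Measurable ψ) (hint : Integrable ψ (Q b)) :
    ∀ᵐ u ∂(Measure.infinitePi fun i : Bool × ℕ => Q i.1),
      Tendsto (fun n : ℕ => (∑ i ∈ Finset.range n, ψ (u (b, i))) / n) atTop
        (𝓝 (∫ c, ψ c ∂(Q b))) := by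
  set ρ := Measure.infinitePi fun i : Bool × ℕ => Q i.1
  have hmap : ∀ i, ρ.map (fun u : Bool × ℕ → C => u (b, i)) = Q b := fun i =>
    Measure.infinitePi_map_eval (fun i : Bool × ℕ => Q i.1) (b, i)
  have hind : iIndepFun (fun (i : Bool × ℕ) (u : Bool × ℕ → C) => ψ (u i)) ρ :=
    iIndepFun_infinitePi (P := fun i : Bool × ℕ => Q i.1) (X := fun _ => ψ) (fun _ => hψ)
  have hmeas : ∀ i, AEMeasurable (fun u : Bool × ℕ → C => u (b, i)) ρ := fun i =>
    (measurable_pi_apply _).aemeasurable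
  have := strong_law_ae_real (μ := ρ) (fun i u => ψ (u (b, i)))
    (Integrable.comp_aemeasurable (by rw [hmap]; exact hint) (hmeas 0))
    (fun i j hij => hind.indepFun (by simpa using hij))
    (fun i => (IdentDistrib.mk (hmeas i) (hmeas 0) (by rw [hmap, hmap])).comp hψ)
  have hval : ∫ u, ψ (u (b, 0)) ∂ρ = ∫ c, ψ c ∂(Q b) := by
    rw [← hmap 0, integral_map (hmeas 0) hψ.aestronglyMeasurable]
  rwa [hval] at this

/-- In the first `K` cycles, `N b` cycles use action `b` and consume the first `N b` entries of
stream `b`; the number of cycles after which the action `true` follows differs from `N true` by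
the contributions of the first and the last action only. -/
lemma exists_stream_counts {C : Type*} (lab : C → Bool) (K : ℕ) (b : Bool) (u : Bool × ℕ → C) :
    ∃ N : Bool → ℕ, N true + N false = K ∧
      (∀ ψ : C → ℝ, ∑ k ∈ Finset.range K, ψ (run streamCycle lab k b u)
        = ∑ i ∈ Finset.range (N true), ψ (u (true, i))
          + ∑ i ∈ Finset.range (N false), ψ (u (false, i))) ∧
      ∃ b' : Bool, ∑ k ∈ Finset.range K, ((lab (run streamCycle lab k b u)).toNat : ℝ)
        = N true - b.toNat + b'.toNat := by
  induction K generalizing b u with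
  | zero => exact ⟨fun _ => 0, rfl, by simp, b, by simp⟩
  | succ K ih =>
    obtain ⟨N, hN, hψ, b', hb'⟩ := ih (lab (streamCycle b u).1) (streamCycle b u).2
    refine ⟨fun a => if a = b then N a + 1 else N a, ?_, fun ψ => ?_, b', ?_⟩
    · cases b <;> simp <;> omega
    · rw [Finset.sum_range_succ']
      simp only [run]
      rw [hψ ψ]
      cases b
      · simp only [streamCycle, Bool.true_eq_false, if_false, if_true]
        rw [Finset.sum_range_succ']
        ring
      · simp only [streamCycle, Bool.false_eq_true, if_false, if_true]
        rw [Finset.sum_range_succ']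
        ring
    · rw [Finset.sum_range_succ']
      simp only [run]
      rw [hb']
      cases b <;> simp <;> ring

/-! ### The law of large numbers for cycles -/

/-- Averages over the first `N K ≤ K` terms, with `N K` not necessarily unbounded, are negligibly far
from `N K * e` on the scale of `K`. -/
lemma tendsto_sub_div_of_le {w : ℕ → ℝ} {e : ℝ} (hw : Tendsto (fun n => w n / n) atTop (𝓝 e))
    {N : ℕ → ℕ} (hN : ∀ K, N K ≤ K) :
    Tendsto (fun K : ℕ => (w (N K) - N K * e) / K) atTop (𝓝 0) := by
  rw [Metric.tendsto_atTop]
  intro ε hε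
  obtain ⟨n₀, hn₀⟩ := Metric.tendsto_atTop.1 hw (ε / 2) (by positivity)
  obtain ⟨B, hB⟩ : ∃ B : ℝ, ∀ n < n₀ + 1, |w n - n * e| ≤ B := by
    refine ⟨∑ n ∈ Finset.range (n₀ + 1), |w n - n * e|, fun n hn => ?_⟩
    exact Finset.single_le_sum (f := fun n : ℕ => |w n - n * e|) (fun _ _ => abs_nonneg _)
      (Finset.mem_range.2 hn)
  obtain ⟨K₀, hK₀⟩ := exists_nat_gt (B / (ε / 2))
  refine ⟨K₀ + 1, fun K hK => ?_⟩
  have hKpos : (0 : ℝ) < K := by exact_mod_cast (by omega : 0 < K)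
  rw [Real.dist_eq, sub_zero, abs_div, abs_of_pos hKpos, div_lt_iff₀ hKpos]
  by_cases h : N K < n₀ + 1
  · have h1 := hB _ h
    have h2 : (K₀ : ℝ) ≤ K := by exact_mod_cast (by omega : K₀ ≤ K)
    rw [div_lt_iff₀ (by positivity)] at hK₀
    nlinarith
  · have h1 := hn₀ (N K) (by omega)
    have hNpos : (0 : ℝ) < N K := by exact_mod_cast (by omega : 0 < N K)
    rw [Real.dist_eq] at h1
    have h2 : w (N K) - N K * e = (w (N K) / N K - e) * N K := by field_simp
    have h3 : (N K : ℝ) ≤ K := by exact_mod_cast hN K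
    rw [h2, abs_mul, abs_of_pos hNpos]
    nlinarith [abs_nonneg (w (N K) / N K - e)]

/-- The stationary probability of the action `true`, if `q b` is the probability that a cycle with
action `b` is followed by one with action `true`. -/
def stationaryProb (q : Bool → ℝ) : ℝ := q false / (1 - (q true - q false))

/-- The mean of `ψ` over a cycle whose action is stationary. -/
def stationaryMean (Q : Bool → Measure C) (lab : C → Bool) (ψ : C → ℝ) : ℝ :=
  stationaryProb (fun b => (Q b).real (lab ⁻¹' {true})) * ∫ c, ψ c ∂(Q true)
    + (1 - stationaryProb fun b => (Q b).real (lab ⁻¹' {true})) * ∫ c, ψ c ∂(Q false)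

lemma integrable_toNat_lab (ρ : Measure C) [IsProbabilityMeasure ρ] (hlab : Measurable lab) :
    Integrable (fun c => ((lab c).toNat : ℝ)) ρ := by
  refine Integrable.of_bound (C := 1) ?_ (Eventually.of_forall fun c => ?_)
  · exact ((measurable_of_countable fun b : Bool => (b.toNat : ℝ)).comp hlab).aestronglyMeasurable
  · cases lab c <;> simp

lemma integral_toNat_lab (ρ : Measure C) (hlab : Measurable lab) :
    ∫ c, ((lab c).toNat : ℝ) ∂ρ = ρ.real (lab ⁻¹' {true}) := by
  have : (fun c => ((lab c).toNat : ℝ)) = (lab ⁻¹' {true}).indicator 1 := by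
    funext c
    by_cases h : lab c = true <;> simp [h]
  rw [this, integral_indicator_one (hlab (measurableSet_singleton _))]

lemma ae_tendsto_run_streamCycle_average (Q : Bool → Measure C) [∀ b, IsProbabilityMeasure (Q b)]
    (hlab : Measurable lab) (hq : (Q true).real (lab ⁻¹' {true}) - (Q false).real (lab ⁻¹' {true}) < 1)
    {ψ : C → ℝ} (hψ : Measurable ψ) (hint : ∀ b, Integrable ψ (Q b)) (b : Bool) :
    ∀ᵐ u ∂(Measure.infinitePi fun i : Bool × ℕ => Q i.1),
      Tendsto (fun K : ℕ => (∑ k ∈ Finset.range K, ψ (run streamCycle lab k b u)) / K) atTop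
        (𝓝 (stationaryMean Q lab ψ)) := by
  have hchi : Measurable fun c => ((lab c).toNat : ℝ) :=
    (measurable_of_countable fun b : Bool => (b.toNat : ℝ)).comp hlab
  filter_upwards [ae_tendsto_stream_average Q true hψ (hint true),
    ae_tendsto_stream_average Q false hψ (hint false),
    ae_tendsto_stream_average Q true hchi (integrable_toNat_lab _ hlab),
    ae_tendsto_stream_average Q false hchi (integrable_toNat_lab _ hlab)] with u h1 h2 h3 h4
  rw [integral_toNat_lab _ hlab] at h3 h4
  choose N hN hsum b' hb' using fun K => exists_stream_counts lab K b u
  have hNt : ∀ K, N K true ≤ K := fun K => by have := hN K; omega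
  have hNf : ∀ K, N K false ≤ K := fun K => by have := hN K; omega
  have g1 := tendsto_sub_div_of_le h1 hNt
  have g2 := tendsto_sub_div_of_le h2 hNf
  have g3 := tendsto_sub_div_of_le h3 hNt
  have g4 := tendsto_sub_div_of_le h4 hNf
  unfold stationaryMean stationaryProb
  set qt := (Q true).real (lab ⁻¹' {true})
  set qf := (Q false).real (lab ⁻¹' {true})
  set et := ∫ c, ψ c ∂(Q true)
  set ef := ∫ c, ψ c ∂(Q false)
  have hne : 1 - (qt - qf) ≠ 0 := by linarith
  have hNf' : ∀ K, (N K false : ℝ) = K - N K true := fun K => by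
    rw [eq_sub_iff_add_eq]; exact_mod_cast (by have := hN K; omega : N K false + N K true = K)
  have hbdd : Tendsto (fun K : ℕ => ((b' K).toNat - b.toNat : ℝ) / K) atTop (𝓝 0) := by
    refine squeeze_zero_norm (a := fun K : ℕ => (1 : ℝ) / K) (fun K => ?_)
      tendsto_one_div_atTop_nhds_zero_nat
    rw [norm_div, Real.norm_natCast]
    refine div_le_div_of_nonneg_right ?_ (Nat.cast_nonneg K)
    cases b' K <;> cases b <;> simp
  -- balance of the transitions into and out of the action `true`
  have hfrac : Tendsto (fun K : ℕ => (N K true : ℝ) / K) atTop (𝓝 (qf / (1 - (qt - qf)))) := by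
    have := ((tendsto_const_nhds (x := qf)).add ((g3.add g4).sub hbdd)).div_const (1 - (qt - qf))
    simp only [add_zero, sub_zero] at this
    refine this.congr' ?_
    filter_upwards [eventually_gt_atTop 0] with K hK
    have hK' : (K : ℝ) ≠ 0 := by exact_mod_cast hK.ne'
    have e1 := hsum K (fun c => ((lab c).toNat : ℝ))
    rw [hb' K] at e1
    have e2 : ∑ i ∈ Finset.range (N K true), ((lab (u (true, i))).toNat : ℝ)
      = N K true - b.toNat + (b' K).toNat
        - ∑ i ∈ Finset.range (N K false), ((lab (u (false, i))).toNat : ℝ) := by linarith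
    rw [e2, hNf' K]
    field_simp
    ring
  have hlim := (g1.add g2).add ((hfrac.mul_const et).add ((hfrac.const_sub 1).mul_const ef))
  simp only [zero_add] at hlim
  refine hlim.congr' ?_
  filter_upwards [eventually_gt_atTop 0] with K hK
  have hK' : (K : ℝ) ≠ 0 := by exact_mod_cast hK.ne'
  rw [hsum K ψ, hNf' K]
  field_simp
  ring

/-- The law of large numbers for functions of the data of one cycle. -/
theorem IsRegenerative.ae_tendsto_average [IsProbabilityMeasure P]
    [∀ b, IsProbabilityMeasure (Q b)] (h : IsRegenerative P Q Φ) (hlab : Measurable lab)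
    (hq : (Q true).real (lab ⁻¹' {true}) - (Q false).real (lab ⁻¹' {true}) < 1)
    {ψ : C → ℝ} (hψ : Measurable ψ) (hint : ∀ b, Integrable ψ (Q b)) (b : Bool) :
    ∀ᵐ z ∂P, Tendsto (fun K : ℕ => (∑ k ∈ Finset.range K, ψ (run Φ lab k b z)) / K) atTop
      (𝓝 (stationaryMean Q lab ψ)) := by
  have hst := isRegenerative_streamCycle Q
  have m1 : Measurable fun z k => run Φ lab k b z :=
    measurable_pi_lambda _ fun k => h.measurable_run hlab k b
  have m2 : Measurable fun u k => run streamCycle lab k b u :=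
    measurable_pi_lambda _ fun k => hst.measurable_run hlab k b
  have hE : MeasurableSet {w : ℕ → C | Tendsto (fun K : ℕ => (∑ k ∈ Finset.range K, ψ (w k)) / K)
      atTop (𝓝 (stationaryMean Q lab ψ))} := by
    refine measurableSet_tendsto _ fun K => ?_
    fun_prop
  have := ae_tendsto_run_streamCycle_average Q hlab hq hψ hint b
  rw [← ae_map_iff m2.aemeasurable hE, ← h.map_run_eq hst hlab b, ae_map_iff m1.aemeasurable hE]
    at this
  exact this

end Chain

/-! ### Pairs of successive cycles -/

section Pair

variable {C Z : Type*} [MeasurableSpace C] [MeasurableSpace Z]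
  {P : Measure Z} {Q : Bool → Measure C} {Φ : Bool → Z → C × Z} {lab : C → Bool}

/-- Two successive cycles, regarded as one. -/
def doubleCycle (Φ : Bool → Z → C × Z) (lab : C → Bool) (b : Bool) (z : Z) : (C × C) × Z :=
  (((Φ b z).1, (Φ (lab (Φ b z).1) (Φ b z).2).1), (Φ (lab (Φ b z).1) (Φ b z).2).2)

/-- The joint law of the data of two successive cycles, of which the first has action `b`. -/
def pairLaw (Q : Bool → Measure C) (lab : C → Bool) (b : Bool) : Measure (C × C) :=
  ((Q b).restrict (lab ⁻¹' {true})).prod (Q true)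
    + ((Q b).restrict (lab ⁻¹' {false})).prod (Q false)

lemma restrict_lab_add (ρ : Measure C) (hlab : Measurable lab) :
    ρ.restrict (lab ⁻¹' {true}) + ρ.restrict (lab ⁻¹' {false}) = ρ := by
  have : lab ⁻¹' {false} = (lab ⁻¹' {true})ᶜ := by ext c; simp
  rw [this]
  exact Measure.restrict_add_restrict_compl (hlab (measurableSet_singleton _))

lemma isProbabilityMeasure_pairLaw [∀ b, IsProbabilityMeasure (Q b)] (hlab : Measurable lab)
    (b : Bool) : IsProbabilityMeasure (pairLaw Q lab b) := by
  constructor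
  have := congrArg (fun ρ => ρ Set.univ) (restrict_lab_add (Q b) hlab)
  simp only [Measure.coe_add, Pi.add_apply, measure_univ] at this
  simp only [pairLaw, Measure.coe_add, Pi.add_apply]
  rw [← Set.univ_prod_univ, Measure.prod_prod, Measure.prod_prod,
    measure_univ (μ := Q true), measure_univ (μ := Q false), mul_one, mul_one]
  exact this

lemma IsRegenerative.doubleCycle [IsProbabilityMeasure P] [∀ b, IsProbabilityMeasure (Q b)]
    (h : IsRegenerative P Q Φ) (hlab : Measurable lab) :
    IsRegenerative P (pairLaw Q lab) (doubleCycle Φ lab) := by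
  have hjoint : Measurable fun y : C × Z => Φ (lab y.1) y.2 := by
    have : Measurable fun y : Bool × Z => Φ y.1 y.2 :=
      measurable_from_prod_countable_right fun b => h.measurable b
    exact this.comp ((hlab.comp measurable_fst).prodMk measurable_snd)
  let G : C × Z → (C × C) × Z := fun y => ((y.1, (Φ (lab y.1) y.2).1), (Φ (lab y.1) y.2).2)
  have hG : Measurable G := (measurable_fst.prodMk hjoint.fst).prodMk hjoint.snd
  refine ⟨fun b => hG.comp (h.measurable b), fun b => ?_⟩
  have part : ∀ a : Bool, (((Q b).restrict (lab ⁻¹' {a})).prod P).map G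
      = (((Q b).restrict (lab ⁻¹' {a})).prod (Q a)).prod P := by
    intro a
    have hae : ∀ᵐ y ∂((Q b).restrict (lab ⁻¹' {a})).prod P, lab y.1 = a := by
      refine Measure.quasiMeasurePreserving_fst.ae (p := fun c => lab c = a) ?_
      exact ae_restrict_mem (hlab (measurableSet_singleton a))
    have : G =ᵐ[((Q b).restrict (lab ⁻¹' {a})).prod P]
        MeasurableEquiv.prodAssoc.symm ∘ Prod.map id (Φ a) := by
      filter_upwards [hae] with y hy
      simp [G, hy, MeasurableEquiv.prodAssoc]
    rw [Measure.map_congr this,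
      ← Measure.map_map MeasurableEquiv.prodAssoc.symm.measurable
        (measurable_id.prodMap (h.measurable a)),
      ← Measure.map_prod_map _ _ measurable_id (h.measurable a), Measure.map_id, h.map_eq a,
      ← Measure.prodAssoc_prod, MeasurableEquiv.map_symm_map]
  have : P.map (_root_.doubleCycle Φ lab b) = (P.map (Φ b)).map G := by
    rw [Measure.map_map hG (h.measurable b)]; rfl
  rw [this, h.map_eq b]
  conv_lhs => rw [← restrict_lab_add (Q b) hlab]
  rw [Measure.add_prod, Measure.map_add _ _ hG, part, part, pairLaw, Measure.add_prod]

lemma run_doubleCycle {C Z : Type*} {Φ : Bool → Z → C × Z} {lab : C → Bool} (m : ℕ) (b : Bool) (z : Z) :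
    run (doubleCycle Φ lab) (fun c => lab c.2) m b z
      = (run Φ lab (2 * m) b z, run Φ lab (2 * m + 1) b z) := by
  induction m generalizing b z with
  | zero => rfl
  | succ m ih =>
    change run (doubleCycle Φ lab) (fun c => lab c.2) m _ _ = _
    rw [ih]
    rfl

lemma pairLaw_real_lab [∀ b, IsProbabilityMeasure (Q b)] (hlab : Measurable lab) (b : Bool) :
    (pairLaw Q lab b).real ((fun c : C × C => lab c.2) ⁻¹' {true})
      = (Q b).real (lab ⁻¹' {true}) * (Q true).real (lab ⁻¹' {true})
        + (1 - (Q b).real (lab ⁻¹' {true})) * (Q false).real (lab ⁻¹' {true}) := by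
  have hpre : (fun c : C × C => lab c.2) ⁻¹' {true} = Set.univ ×ˢ (lab ⁻¹' {true}) := by
    ext; simp
  have hf : (Q b).real (lab ⁻¹' {false}) = 1 - (Q b).real (lab ⁻¹' {true}) := by
    have : lab ⁻¹' {false} = (lab ⁻¹' {true})ᶜ := by ext c; simp
    rw [this, probReal_compl_eq_one_sub (hlab (measurableSet_singleton _))]
  rw [← hf, pairLaw, measureReal_add_apply, hpre, measureReal_prod_prod, measureReal_prod_prod]
  simp [measureReal_def]

lemma stationaryProb_pairLaw [∀ b, IsProbabilityMeasure (Q b)] (hlab : Measurable lab)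
    (hq : -1 < (Q true).real (lab ⁻¹' {true}) - (Q false).real (lab ⁻¹' {true})) :
    stationaryProb (fun b => (pairLaw Q lab b).real ((fun c : C × C => lab c.2) ⁻¹' {true}))
      = stationaryProb fun b => (Q b).real (lab ⁻¹' {true}) := by
  simp only [stationaryProb, pairLaw_real_lab hlab]
  set p := (Q true).real (lab ⁻¹' {true})
  set r := (Q false).real (lab ⁻¹' {true})
  have h1 : (1 + (p - r)) ≠ 0 := by linarith
  rw [show r * p + (1 - r) * r = r * (1 + (p - r)) by ring,
    show 1 - (p * p + (1 - p) * r - r * (1 + (p - r))) = (1 - (p - r)) * (1 + (p - r)) by ring,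
    mul_div_mul_right _ _ h1]

lemma tendsto_average_of_even_odd {g : ℕ → ℝ} {v : ℝ}
    (he : Tendsto (fun n : ℕ => (∑ m ∈ Finset.range n, g (2 * m)) / n) atTop (𝓝 v))
    (ho : Tendsto (fun n : ℕ => (∑ m ∈ Finset.range n, g (2 * m + 1)) / n) atTop (𝓝 v)) :
    Tendsto (fun n : ℕ => (∑ k ∈ Finset.range n, g k) / n) atTop (𝓝 v) := by
  have hsum : ∀ K, ∑ k ∈ Finset.range K, g k = ∑ m ∈ Finset.range ((K + 1) / 2), g (2 * m)
      + ∑ m ∈ Finset.range (K / 2), g (2 * m + 1) := by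
    intro K
    induction K with
    | zero => simp
    | succ K ih =>
      rw [Finset.sum_range_succ, ih]
      rcases Nat.even_or_odd' K with ⟨j, rfl | rfl⟩
      · rw [show (2 * j + 1 + 1) / 2 = j + 1 by omega, show (2 * j + 1) / 2 = j by omega,
          show 2 * j / 2 = j by omega, Finset.sum_range_succ _ j]
        ring
      · rw [show (2 * j + 1 + 1 + 1) / 2 = j + 1 by omega, show (2 * j + 1 + 1) / 2 = j + 1 by omega,
          show (2 * j + 1) / 2 = j by omega, Finset.sum_range_succ (fun m => g (2 * m + 1)) j]
        ring
  have h1 := tendsto_sub_div_of_le he (N := fun K => (K + 1) / 2) fun K => by omega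
  have h2 := tendsto_sub_div_of_le ho (N := fun K => K / 2) fun K => by omega
  have := (h1.add h2).add_const v
  simp only [zero_add] at this
  refine this.congr' ?_
  filter_upwards [eventually_gt_atTop 0] with K hK
  have hK' : (K : ℝ) ≠ 0 := by exact_mod_cast hK.ne'
  have hc : (((K + 1) / 2 : ℕ) : ℝ) = K - ((K / 2 : ℕ) : ℝ) := by
    rw [eq_sub_iff_add_eq]; exact_mod_cast (by omega : (K + 1) / 2 + K / 2 = K)
  rw [hsum K, hc]
  field_simp
  ring

/-- The law of large numbers for functions of the data of two successive cycles. The pairs that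
start at an even time are the data of the cycles of `doubleCycle`, and so are those that start at
an odd time, for the input that is left after the first cycle. -/
theorem IsRegenerative.ae_tendsto_pair_average [IsProbabilityMeasure P]
    [∀ b, IsProbabilityMeasure (Q b)] (h : IsRegenerative P Q Φ) (hlab : Measurable lab)
    (hq : |(Q true).real (lab ⁻¹' {true}) - (Q false).real (lab ⁻¹' {true})| < 1)
    {f : C × C → ℝ} (hf : Measurable f) (hint : ∀ b, Integrable f (pairLaw Q lab b)) (b : Bool) :
    ∀ᵐ z ∂P, Tendsto (fun K : ℕ => (∑ k ∈ Finset.range K,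
        f (run Φ lab k b z, run Φ lab (k + 1) b z)) / K) atTop
      (𝓝 (stationaryMean (pairLaw Q lab) (fun c => lab c.2) f)) := by
  have : ∀ b, IsProbabilityMeasure (pairLaw Q lab b) := isProbabilityMeasure_pairLaw hlab
  have hq2 : (pairLaw Q lab true).real ((fun c : C × C => lab c.2) ⁻¹' {true})
      - (pairLaw Q lab false).real ((fun c : C × C => lab c.2) ⁻¹' {true}) < 1 := by
    rw [pairLaw_real_lab hlab, pairLaw_real_lab hlab]
    have := (sq_lt_one_iff_abs_lt_one _).2 hq
    nlinarith
  have heven := fun b => (h.doubleCycle hlab).ae_tendsto_average (hlab.comp measurable_snd) hq2 hf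
    hint b
  have hodd : ∀ᵐ z ∂P, ∀ b', Tendsto (fun K : ℕ => (∑ k ∈ Finset.range K,
        f (run (_root_.doubleCycle Φ lab) (fun c => lab c.2) k b' (Φ b z).2)) / K) atTop
      (𝓝 (stationaryMean (pairLaw Q lab) (fun c => lab c.2) f)) := by
    have hmap : P.map (fun z => (Φ b z).2) = P := by
      have := Measure.map_map (μ := P) measurable_snd (h.measurable b)
      rw [h.map_eq b, Measure.map_snd_prod, measure_univ, one_smul] at this
      exact this.symm
    have := ae_all_iff.2 heven
    rw [← hmap] at this
    exact ae_of_ae_map (h.measurable b).snd.aemeasurable this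
  filter_upwards [heven b, hodd] with z h1 h2
  refine tendsto_average_of_even_odd (g := fun k => f (run Φ lab k b z, run Φ lab (k + 1) b z)) ?_ ?_
  · simpa only [run_doubleCycle, Function.comp_def] using h1
  · have := h2 (lab (Φ b z).1)
    simp only [run_doubleCycle] at this
    exact this

end Pair

/-! ### The input of the source -/

section Input

/-- The inter-arrival times `z (Sum.inl n)` and the transfer times `z (Sum.inr n)`. -/
abbrev Input := ℕ ⊕ ℕ → ℝ

/-- The time between the arrivals of packets `n - 1` and `n`; for `n = 0`, the time until the first
arrival. -/
def gap (z : Input) (n : ℕ) : ℝ := z (Sum.inl n)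

/-- The transfer time of packet `n`. -/
def transfer (z : Input) (n : ℕ) : ℝ := z (Sum.inr n)

lemma measurable_gap (n : ℕ) : Measurable fun z : Input => gap z n := measurable_pi_apply _

lemma measurable_transfer (n : ℕ) : Measurable fun z : Input => transfer z n :=
  measurable_pi_apply _

lemma measurable_arrival (n : ℕ) : Measurable fun z : Input => arrival (gap z) n :=
  Finset.measurable_sum _ fun i _ => measurable_gap i

lemma arrival_eq (x : ℕ → ℝ) (n : ℕ) : arrival x n = ∑ i ∈ Finset.range n, x i + x n :=
  Finset.sum_range_succ _ _

lemma arrival_succ (x : ℕ → ℝ) (n : ℕ) : arrival x (n + 1) = arrival x n + x (n + 1) :=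
  Finset.sum_range_succ _ _

lemma arrival_mono {x : ℕ → ℝ} (hx : ∀ n, 0 < x n) : Monotone (arrival x) :=
  monotone_nat_of_le_succ fun n => by rw [arrival_succ]; linarith [hx (n + 1)]

/-- The input that is left when packets `0, …, n - 1` have been used and the time `h` of the
inter-arrival time of packet `n` has passed. -/
def shiftInput (n : ℕ) (h : ℝ) (z : Input) : Input :=
  Sum.elim (fun i => if i = 0 then gap z n - h else gap z (n + i)) fun i => transfer z (n + i)

lemma measurable_shiftInput (n : ℕ) {Y : Type*} [MeasurableSpace Y] {h : Y → ℝ} {z : Y → Input}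
    (hh : Measurable h) (hz : Measurable z) : Measurable fun y => shiftInput n (h y) (z y) := by
  refine measurable_pi_lambda _ ?_
  rintro (i | i)
  · simp only [shiftInput, Sum.elim_inl]
    split_ifs
    · exact ((measurable_gap n).comp hz).sub hh
    · exact (measurable_gap _).comp hz
  · exact (measurable_transfer (n + i)).comp hz

/-- The law of the input: independent inter-arrival times with law `ε`, independent of the
independent transfer times with law `τ`. -/
def inputLaw (ε τ : Measure ℝ) : Measure Input :=
  Measure.infinitePi (Sum.elim (fun _ => ε) fun _ => τ)

variable {ε τ : Measure ℝ} [IsProbabilityMeasure ε] [IsProbabilityMeasure τ]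

instance (i : ℕ ⊕ ℕ) : IsProbabilityMeasure
    ((Sum.elim (fun _ => ε) fun _ => τ : ℕ ⊕ ℕ → Measure ℝ) i) := by
  cases i <;> simpa

instance : IsProbabilityMeasure (inputLaw ε τ) := by unfold inputLaw; infer_instance

lemma measurePreserving_gap (n : ℕ) :
    MeasurePreserving (fun z => gap z n) (inputLaw ε τ) ε :=
  measurePreserving_eval_infinitePi (Sum.elim (fun _ => ε) fun _ => τ : ℕ ⊕ ℕ → Measure ℝ)
    (Sum.inl n)

lemma measurePreserving_transfer (n : ℕ) :
    MeasurePreserving (fun z => transfer z n) (inputLaw ε τ) τ :=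
  measurePreserving_eval_infinitePi (Sum.elim (fun _ => ε) fun _ => τ : ℕ ⊕ ℕ → Measure ℝ)
    (Sum.inr n)

lemma measurePreserving_transfer_gap (m n : ℕ) :
    MeasurePreserving (fun z => (transfer z m, gap z n)) (inputLaw ε τ) (τ.prod ε) :=
  ⟨(measurable_transfer m).prodMk (measurable_gap n),
    Measure.infinitePi_map_eval_prod
      (P := (Sum.elim (fun _ => ε) fun _ => τ : ℕ ⊕ ℕ → Measure ℝ))
      (i := Sum.inr m) (j := Sum.inl n) (by simp)⟩

lemma measurePreserving_gap_transfer (m n : ℕ) :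
    MeasurePreserving (fun z => (gap z m, transfer z n)) (inputLaw ε τ) (ε.prod τ) :=
  ⟨(measurable_gap m).prodMk (measurable_transfer n),
    Measure.infinitePi_map_eval_prod
      (P := (Sum.elim (fun _ => ε) fun _ => τ : ℕ ⊕ ℕ → Measure ℝ))
      (i := Sum.inl m) (j := Sum.inr n) (by simp)⟩

/-- The input that follows `z` for the first `a` inter-arrival times and the first `k` transfer
times, and a second input from there on; the first `a - k` inter-arrival times of the latter are
not used. -/
def graft (a k : ℕ) : Input × Input → Input :=
  splice (fun i => Sum.elim (fun i => decide (i < a)) (fun i => decide (i < k)) i = true)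
    (Sum.map (· - k) (· - k))

lemma gap_graft (a k : ℕ) (z z' : Input) (n : ℕ) :
    gap (graft a k (z, z')) n = if n < a then gap z n else gap z' (n - k) := by
  simp [gap, graft, splice]

lemma transfer_graft (a k : ℕ) (z z' : Input) (n : ℕ) :
    transfer (graft a k (z, z')) n = if n < k then transfer z n else transfer z' (n - k) := by
  simp [transfer, graft, splice]

lemma measurePreserving_graft {a k : ℕ} (hak : k ≤ a) :
    MeasurePreserving (graft a k) ((inputLaw ε τ).prod (inputLaw ε τ)) (inputLaw ε τ) := by
  refine ⟨measurable_splice _ _, map_splice _ _ _ ?_ ?_⟩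
  · rintro (i | i) hi (j | j) hj hij <;>
      simp at hi hj hij ⊢ <;> omega
  · rintro (i | i) _ <;> rfl

/-- The law of the input is that of an independent choice of the first inter-arrival time and of
all other variables. -/
lemma measurePreserving_update_gap :
    MeasurePreserving (fun y : Input × Input => Function.update y.1 (Sum.inl 0) (gap y.2 0))
      ((inputLaw ε τ).prod (inputLaw ε τ)) (inputLaw ε τ) := by
  have h : (fun y : Input × Input => Function.update y.1 (Sum.inl 0) (gap y.2 0))
      = splice (fun i => i ≠ Sum.inl 0) id := by
    funext y i
    by_cases hi : i = Sum.inl 0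
    · subst hi; simp [splice, gap]
    · simp [splice, hi]
  rw [h]
  exact ⟨measurable_splice _ _, map_splice _ _ _ (fun _ _ _ _ h => h) fun _ _ => rfl⟩

/-- An event that concerns a single packet and the gap after it, and has positive probability,
happens for infinitely many packets. -/
lemma ae_frequently_transfer_gap {R : Set (ℝ × ℝ)} (hR : MeasurableSet R)
    (hpos : (τ.prod ε) R ≠ 0) :
    ∀ᵐ z ∂(inputLaw ε τ), ∀ m, ∃ j, m ≤ j ∧ (transfer z j, gap z (j + 1)) ∈ R := by
  set P := inputLaw ε τ
  let E : ℕ → Set Input := fun m => {z | ∀ j, m ≤ j → (transfer z j, gap z (j + 1)) ∉ R}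
  have hE : ∀ m, MeasurableSet (E m) := fun m => by
    have : E m = ⋂ j, ⋂ (_ : m ≤ j), (fun z => (transfer z j, gap z (j + 1))) ⁻¹' Rᶜ := by
      ext; simp [E]
    rw [this]
    exact MeasurableSet.iInter fun j => MeasurableSet.iInter fun _ =>
      ((measurable_transfer j).prodMk (measurable_gap _)) hR.compl
  -- the event that it never happens survives the deletion of the first packet
  have h0 : P (E 0) = (τ.prod ε) Rᶜ * P (E 0) := by
    have hpre : graft 2 1 ⁻¹' E 0
        = ((fun z => (transfer z 0, gap z 1)) ⁻¹' Rᶜ) ×ˢ E 0 := by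
      ext ⟨z, z'⟩
      simp only [E, Set.mem_preimage, Set.mem_ofPred_eq, Set.mem_prod, gap_graft, transfer_graft,
        Set.mem_compl_iff]
      constructor
      · intro h
        refine ⟨by simpa using h 0 le_rfl, fun j _ => by simpa using h (j + 1) (Nat.zero_le _)⟩
      · rintro ⟨h, h'⟩ (_ | j) _
        · simpa using h
        · simpa using h' j (Nat.zero_le _)
    conv_lhs => rw [← (measurePreserving_graft (ε := ε) (τ := τ) (one_le_two)).measure_preimage
      (hE 0).nullMeasurableSet, hpre, Measure.prod_prod,
      (measurePreserving_transfer_gap 0 1).measure_preimage hR.compl.nullMeasurableSet]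
  have hlt : (τ.prod ε) Rᶜ < 1 := by
    rw [prob_compl_eq_one_sub hR]
    exact ENNReal.sub_lt_self ENNReal.one_ne_top one_ne_zero hpos
  have hz : P (E 0) = 0 := by
    by_contra hne
    have := ENNReal.mul_lt_mul_left hne (measure_ne_top P (E 0)) hlt
    rw [one_mul, ← h0] at this
    exact lt_irrefl _ this
  have hm : ∀ m, P (E m) = 0 := fun m => by
    have hpre : graft m m ⁻¹' E m ⊆ Set.univ ×ˢ E 0 := by
      rintro ⟨z, z'⟩ h
      refine ⟨trivial, fun j _ => ?_⟩
      have := h (m + j) (Nat.le_add_right _ _)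
      simpa [gap_graft, transfer_graft, add_assoc] using this
    rw [← (measurePreserving_graft (ε := ε) (τ := τ) (le_refl m)).measure_preimage
      (hE m).nullMeasurableSet]
    refine measure_mono_null hpre ?_
    rw [Measure.prod_prod, hz, mul_zero]
  rw [ae_all_iff]
  intro m
  have : {z | ¬ ∃ j, m ≤ j ∧ (transfer z j, gap z (j + 1)) ∈ R} = E m := by
    ext z; simp [E]
  rw [ae_iff, this, hm]

end Input

/-! ### The exponential distribution -/

section Exponential

variable {lam : ℝ}

/-- The exponential distribution is memoryless. -/
lemma expMeasure_lt_sub_mem {h : ℝ} (hh : 0 ≤ h) {B : Set ℝ}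
    (hB : MeasurableSet B) :
    expMeasure lam {y | h < y ∧ y - h ∈ B}
      = ENNReal.ofReal (Real.exp (-lam * h)) * expMeasure lam B := by
  have hdef : ∀ A : Set ℝ, MeasurableSet A →
      expMeasure lam A = ∫⁻ y, A.indicator (exponentialPDF lam) y := fun A hA => by
    rw [lintegral_indicator hA]
    exact withDensity_apply _ hA
  have hA : MeasurableSet {y | h < y ∧ y - h ∈ B} :=
    measurableSet_Ioi.inter ((measurable_id.sub_const h) hB)
  rw [hdef _ hA, hdef _ hB, ← lintegral_add_right_eq_self _ h, ← lintegral_const_mul']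
  · have h0 : ∀ᵐ y : ℝ, y ≠ 0 := Measure.ae_ne volume 0
    refine lintegral_congr_ae ?_
    filter_upwards [h0] with y hy
    rcases lt_or_gt_of_ne hy with hneg | hpos
    · rw [Set.indicator_of_notMem (fun hmem => by
        have := hmem.1; linarith)]
      by_cases hyB : y ∈ B
      · rw [Set.indicator_of_mem hyB, exponentialPDF_of_neg hneg, mul_zero]
      · rw [Set.indicator_of_notMem hyB, mul_zero]
    · by_cases hyB : y ∈ B
      · have hmem : y + h ∈ {y | h < y ∧ y - h ∈ B} := ⟨by linarith, by simpa using hyB⟩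
        rw [Set.indicator_of_mem hyB, Set.indicator_of_mem hmem,
          exponentialPDF_of_nonneg hpos.le, exponentialPDF_of_nonneg (by linarith),
          ← ENNReal.ofReal_mul (Real.exp_pos _).le, mul_left_comm, ← Real.exp_add]
        congr 3
        ring
      · rw [Set.indicator_of_notMem hyB, mul_zero, Set.indicator_of_notMem]
        rintro ⟨_, hmem⟩
        exact hyB (by simpa using hmem)
  · exact ENNReal.ofReal_ne_top

lemma expMeasure_Ioi (hlam : 0 < lam) {h : ℝ} (hh : 0 ≤ h) :
    expMeasure lam (Set.Ioi h) = ENNReal.ofReal (Real.exp (-lam * h)) := by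
  have := isProbabilityMeasure_expMeasure hlam
  have hs : {y | h < y ∧ y - h ∈ Set.univ} = Set.Ioi h := by ext; simp
  rw [← hs, expMeasure_lt_sub_mem hh MeasurableSet.univ, measure_univ, mul_one]

lemma expMeasure_singleton (y : ℝ) : expMeasure lam {y} = 0 :=
  withDensity_absolutelyContinuous _ _ Real.volume_singleton

lemma ae_expMeasure_pos : ∀ᵐ y ∂(expMeasure lam), 0 < y := by
  rw [ae_iff]
  have : {y : ℝ | ¬ 0 < y} = Set.Iio 0 ∪ {0} := by ext y; simp [le_iff_lt_or_eq]
  rw [this, measure_union_null_iff]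
  refine ⟨?_, expMeasure_singleton 0⟩
  have : expMeasure lam (Set.Iio 0) = ∫⁻ y in Set.Iio 0, exponentialPDF lam y :=
    withDensity_apply _ measurableSet_Iio
  rw [this, lintegral_exponentialPDF_of_nonpos le_rfl]

end Exponential

/-! ### One cycle of the source -/

section Cycle

/-- The packet that is delivered in a cycle that starts at time `0`; `b` says whether DOP is used. -/
def cyclePacket (b : Bool) (z : Input) : ℕ :=
  if b then firstUninterrupted (gap z) (transfer z) 0 else 0

/-- The length of a cycle that starts at time `0`. -/
def cycleLength (b : Bool) (z : Input) : ℝ :=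
  arrival (gap z) (cyclePacket b z) + transfer z (cyclePacket b z)

/-- The length of a cycle that starts at time `0`, and the age at its end. -/
def cycleData (b : Bool) (z : Input) : ℝ × ℝ := (cycleLength b z, transfer z (cyclePacket b z))

/-- The first packet that arrives after the cycle. -/
def cycleNext (b : Bool) (z : Input) : ℕ := nextPacket (gap z) (cycleLength b z)

/-- A cycle that starts at time `0`, and the input that is left after it, with time counted from the
end of the cycle. -/
def cycle (b : Bool) (z : Input) : (ℝ × ℝ) × Input :=
  (cycleData b z, shiftInput (cycleNext b z)
    (cycleLength b z - ∑ i ∈ Finset.range (cycleNext b z), gap z i) z)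

lemma measurable_sInf_nat {Y : Type*} [MeasurableSpace Y] {p : ℕ → Y → Prop}
    (hp : ∀ n, MeasurableSet {y | p n y}) : Measurable fun y => sInf {n | p n y} := by
  refine measurable_to_countable' fun k => ?_
  have : (fun y => sInf {n | p n y}) ⁻¹' {k}
      = ({y | p k y} ∩ ⋂ m, ⋂ (_ : m < k), {y | p m y}ᶜ)
        ∪ ({_y | k = 0} ∩ ⋂ m, {y | p m y}ᶜ) := by
    ext y
    simp only [Set.mem_preimage, Set.mem_singleton_iff, Set.mem_union, Set.mem_inter_iff,
      Set.mem_iInter, Set.mem_compl_iff, Set.mem_ofPred_eq]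
    constructor
    · intro hk
      by_cases hne : {n | p n y}.Nonempty
      · left
        subst hk
        exact ⟨Nat.sInf_mem hne, fun m hm => Nat.notMem_of_lt_sInf hm⟩
      · right
        rw [Set.not_nonempty_iff_eq_empty] at hne
        rw [hne, Nat.sInf_empty] at hk
        refine ⟨hk.symm, fun m hm => ?_⟩
        have : m ∈ {n | p n y} := hm
        rw [hne] at this
        exact this
    · rintro (⟨hk, hlt⟩ | ⟨rfl, hall⟩)
      · refine le_antisymm (Nat.sInf_le hk) ?_
        by_contra! hcon
        have hne : {n | p n y}.Nonempty := ⟨k, hk⟩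
        exact hlt _ hcon (Nat.sInf_mem hne)
      · have : {n | p n y} = ∅ := Set.eq_empty_of_forall_notMem hall
        rw [this, Nat.sInf_empty]
  rw [this]
  refine ((hp k).inter ?_).union (MeasurableSet.inter (MeasurableSet.const _) ?_)
  · exact MeasurableSet.iInter fun m => MeasurableSet.iInter fun _ => (hp m).compl
  · exact MeasurableSet.iInter fun m => (hp m).compl

lemma measurable_nat_eval {Y W : Type*} [MeasurableSpace Y] [MeasurableSpace W] {f : ℕ → Y → W}
    {n : Y → ℕ} (hf : ∀ k, Measurable (f k)) (hn : Measurable n) : Measurable fun y => f (n y) y := by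
  have : Measurable fun q : ℕ × Y => f q.1 q.2 := measurable_from_prod_countable_right hf
  exact this.comp (hn.prodMk measurable_id)

lemma measurable_cyclePacket (b : Bool) : Measurable (cyclePacket b) := by
  cases b
  · exact measurable_const
  · refine measurable_sInf_nat fun n => ?_
    exact (MeasurableSet.const _).inter
      (measurableSet_le (measurable_transfer n) (measurable_gap (n + 1)))

lemma measurable_cycleAge (b : Bool) : Measurable fun z => transfer z (cyclePacket b z) :=
  measurable_nat_eval measurable_transfer (measurable_cyclePacket b)

lemma measurable_cycleLength (b : Bool) : Measurable (cycleLength b) :=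
  (measurable_nat_eval measurable_arrival (measurable_cyclePacket b)).add (measurable_cycleAge b)

lemma measurable_cycleData (b : Bool) : Measurable (cycleData b) :=
  (measurable_cycleLength b).prodMk (measurable_cycleAge b)

lemma measurable_cycleNext (b : Bool) : Measurable (cycleNext b) :=
  measurable_sInf_nat fun n => measurableSet_lt (measurable_cycleLength b) (measurable_arrival n)

lemma measurable_cycle (b : Bool) : Measurable (cycle b) := by
  refine (measurable_cycleData b).prodMk ?_
  refine measurable_nat_eval (f := fun n z => shiftInput n
    (cycleLength b z - ∑ i ∈ Finset.range n, gap z i) z) (fun n => ?_) (measurable_cycleNext b)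
  exact measurable_shiftInput n ((measurable_cycleLength b).sub
    (Finset.measurable_sum _ fun i _ => measurable_gap i)) measurable_id

/-- The inputs for which the sample paths of the source are as they should be: packets arrive one at
a time and without end, and under DOP every cycle ends. -/
structure IsGood (z : Input) : Prop where
  gap_pos : ∀ n, 0 < gap z n
  transfer_nonneg : ∀ n, 0 ≤ transfer z n
  exists_arrival : ∀ r, ∃ n, r < arrival (gap z) n
  exists_success : ∀ m, ∃ j, m ≤ j ∧ transfer z j ≤ gap z (j + 1)

variable {lam : ℝ} {τ : Measure ℝ} [IsProbabilityMeasure τ]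

lemma ae_isGood (hlam : 0 < lam) (hτ : ∀ᵐ t ∂τ, 0 ≤ t) :
    ∀ᵐ z ∂(inputLaw (expMeasure lam) τ), IsGood z := by
  have := isProbabilityMeasure_expMeasure hlam
  have h1 : ∀ᵐ z ∂(inputLaw (expMeasure lam) τ), ∀ n, 0 < gap z n := by
    rw [ae_all_iff]
    exact fun n => (measurePreserving_gap n).quasiMeasurePreserving.ae ae_expMeasure_pos
  have h2 : ∀ᵐ z ∂(inputLaw (expMeasure lam) τ), ∀ n, 0 ≤ transfer z n := by
    rw [ae_all_iff]
    exact fun n => (measurePreserving_transfer n).quasiMeasurePreserving.ae hτ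
  have h3 : ∀ᵐ z ∂(inputLaw (expMeasure lam) τ), ∀ m, ∃ j, m ≤ j ∧
      (transfer z j, gap z (j + 1)) ∈ {y : ℝ × ℝ | 1 < y.2} := by
    refine ae_frequently_transfer_gap (measurableSet_lt measurable_const measurable_snd) ?_
    have : {y : ℝ × ℝ | 1 < y.2} = Set.univ ×ˢ Set.Ioi 1 := by ext; simp
    rw [this, Measure.prod_prod, measure_univ, one_mul, expMeasure_Ioi hlam zero_le_one]
    simp [Real.exp_pos]
  have h4 : ∀ᵐ z ∂(inputLaw (expMeasure lam) τ), ∀ m, ∃ j, m ≤ j ∧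
      (transfer z j, gap z (j + 1)) ∈ {y : ℝ × ℝ | y.1 ≤ y.2} := by
    refine ae_frequently_transfer_gap (measurableSet_le measurable_fst measurable_snd) fun h0 => ?_
    rw [Measure.measure_prod_null (measurableSet_le measurable_fst measurable_snd)] at h0
    obtain ⟨s, hs⟩ := h0.exists
    refine absurd hs (ne_of_gt (lt_of_lt_of_le ?_ (measure_mono (s := Set.Ioi (max s 0)) ?_)))
    · rw [expMeasure_Ioi hlam (le_max_right _ _)]
      simp [Real.exp_pos]
    · intro y hy
      exact (le_max_left s 0).trans (le_of_lt hy)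
  filter_upwards [h1, h2, h3, h4] with z g1 g2 g3 g4
  refine ⟨g1, g2, fun r => ?_, g4⟩
  -- infinitely many gaps exceed `1`
  have hk : ∀ k : ℕ, ∃ n, (k : ℝ) < arrival (gap z) n := by
    intro k
    induction k with
    | zero => exact ⟨0, by simpa [arrival] using g1 0⟩
    | succ k ih =>
      obtain ⟨n, hn⟩ := ih
      obtain ⟨j, hj, hj1⟩ := g3 n
      refine ⟨j + 1, ?_⟩
      rw [arrival_succ]
      have := arrival_mono g1 hj
      have hj1' : 1 < gap z (j + 1) := hj1
      push_cast
      linarith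
  obtain ⟨k, hk'⟩ := exists_nat_gt r
  obtain ⟨n, hn⟩ := hk k
  exact ⟨n, hk'.trans hn⟩

lemma ae_transfer_ne_gap (hlam : 0 < lam) :
    ∀ᵐ z ∂(inputLaw (expMeasure lam) τ), ∀ j, transfer z j ≠ gap z (j + 1) := by
  have := isProbabilityMeasure_expMeasure hlam
  rw [ae_all_iff]
  intro j
  have hm : MeasurableSet {y : ℝ × ℝ | y.1 = y.2} := measurableSet_eq_fun measurable_fst measurable_snd
  refine (measurePreserving_transfer_gap j (j + 1)).quasiMeasurePreserving.ae
    (p := fun y : ℝ × ℝ => y.1 ≠ y.2) ?_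
  rw [ae_iff]
  simp only [ne_eq, not_not]
  rw [Measure.measure_prod_null hm]
  refine Eventually.of_forall fun s => ?_
  have : Prod.mk s ⁻¹' {y : ℝ × ℝ | y.1 = y.2} = {s} := by ext y; simp [eq_comm]
  change expMeasure lam (Prod.mk s ⁻¹' {y : ℝ × ℝ | y.1 = y.2}) = 0
  rw [this, expMeasure_singleton]

/-! ### Regeneration at the end of a cycle -/

/-- Given that the first packet arrives after `h`, the input that is left at time `h` is distributed
as the original one. -/
lemma inputLaw_shiftInput_zero (hlam : 0 < lam) {h : ℝ} (hh : 0 ≤ h) {B : Set Input}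
    (hB : MeasurableSet B) :
    inputLaw (expMeasure lam) τ {z | h < gap z 0 ∧ shiftInput 0 h z ∈ B}
      = expMeasure lam (Set.Ioi h) * inputLaw (expMeasure lam) τ B := by
  have := isProbabilityMeasure_expMeasure hlam
  set P := inputLaw (expMeasure lam) τ
  have hup : Measurable fun y : Input × Input => Function.update y.1 (Sum.inl 0) (gap y.2 0) :=
    measurePreserving_update_gap (ε := expMeasure lam) (τ := τ) |>.measurable
  have hsh : ∀ (z : Input) (y : ℝ), shiftInput 0 h (Function.update z (Sum.inl 0) y)
      = Function.update z (Sum.inl 0) (y - h) := by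
    intro z y
    funext i
    rcases i with (_ | i) | i <;> simp [shiftInput, gap, transfer]
  have hupd : ∀ z : Input, Measurable fun y : ℝ => Function.update z (Sum.inl 0) y := fun z =>
    measurable_update z
  have hE : MeasurableSet {z | h < gap z 0 ∧ shiftInput 0 h z ∈ B} :=
    (measurableSet_lt measurable_const (measurable_gap 0)).inter
      (measurable_shiftInput 0 measurable_const measurable_id hB)
  have main : ∀ {E : Set Input}, MeasurableSet E →
      P E = ∫⁻ z, expMeasure lam {y | Function.update z (Sum.inl 0) y ∈ E} ∂P := by
    intro E hE
    rw [← (measurePreserving_update_gap (ε := expMeasure lam) (τ := τ)).measure_preimage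
      hE.nullMeasurableSet, Measure.prod_apply (hup hE)]
    refine lintegral_congr fun z => ?_
    exact (measurePreserving_gap (ε := expMeasure lam) (τ := τ) 0).measure_preimage
      (hupd z hE).nullMeasurableSet
  rw [main hE, main hB, ← lintegral_const_mul' _ _ (measure_ne_top _ _)]
  refine lintegral_congr fun z => ?_
  rw [expMeasure_Ioi hlam hh]
  refine Eq.trans ?_ (expMeasure_lt_sub_mem hh (hupd z hB))
  congr 1
  ext y
  simp only [Set.mem_ofPred_eq, hsh, gap, Function.update_self]

/-- If packet `n` is the first to arrive after a cycle whose course is determined by the packets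
before, then the input that is left is independent of this course and distributed as the original
one. -/
lemma inputLaw_shiftInput (hlam : 0 < lam) (n : ℕ) {S : Set Input} (hS : MeasurableSet S)
    {h : Input → ℝ} (hh : Measurable h) (hSg : ∀ z z', graft n n (z, z') ∈ S ↔ z ∈ S)
    (hhg : ∀ z z', h (graft n n (z, z')) = h z) (hpos : ∀ z ∈ S, 0 ≤ h z) {B : Set Input}
    (hB : MeasurableSet B) :
    inputLaw (expMeasure lam) τ {z | z ∈ S ∧ h z < gap z n ∧ shiftInput n (h z) z ∈ B}
      = inputLaw (expMeasure lam) τ {z | z ∈ S ∧ h z < gap z n}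
        * inputLaw (expMeasure lam) τ B := by
  have := isProbabilityMeasure_expMeasure hlam
  set P := inputLaw (expMeasure lam) τ
  have hsh : ∀ z z' (r : ℝ), shiftInput n r (graft n n (z, z')) = shiftInput 0 r z' := by
    intro z z' r
    funext i
    rcases i with i | i <;> simp [shiftInput, gap_graft, transfer_graft]
  have main : ∀ {A : Set Input}, MeasurableSet A →
      P {z | z ∈ S ∧ h z < gap z n ∧ shiftInput n (h z) z ∈ A}
        = (∫⁻ z, S.indicator (fun z => expMeasure lam (Set.Ioi (h z))) z ∂P) * P A := by
    intro A hA
    have hE : MeasurableSet {z | z ∈ S ∧ h z < gap z n ∧ shiftInput n (h z) z ∈ A} :=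
      hS.inter ((measurableSet_lt hh (measurable_gap n)).inter
        (measurable_shiftInput n hh measurable_id hA))
    rw [← (measurePreserving_graft (ε := expMeasure lam) (τ := τ) (le_refl n)).measure_preimage
      hE.nullMeasurableSet, Measure.prod_apply
      ((measurePreserving_graft (ε := expMeasure lam) (τ := τ) (le_refl n)).measurable hE),
      ← lintegral_mul_const' _ _ (measure_ne_top _ _)]
    refine lintegral_congr fun z => ?_
    by_cases hz : z ∈ S
    · rw [Set.indicator_of_mem hz, ← inputLaw_shiftInput_zero hlam (hpos z hz) hA]
      congr 1
      ext z'
      simp [hSg, hhg, hsh, hz, gap_graft]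
    · rw [Set.indicator_of_notMem hz, zero_mul]
      convert measure_empty (μ := P)
      ext z'
      simp [hSg, hz]
  have h1 := main hB
  have h2 := main MeasurableSet.univ
  simp only [Set.mem_univ, and_true, measure_univ, mul_one] at h2
  rw [h1, h2]

end Cycle

section Regeneration

lemma IsGood.nextPacket_eq_iff {z : Input} (hz : IsGood z) {r : ℝ} {n : ℕ} :
    nextPacket (gap z) r = n ↔ r < arrival (gap z) n ∧ ∀ m < n, arrival (gap z) m ≤ r := by
  have hne : {n | r < arrival (gap z) n}.Nonempty := hz.exists_arrival r
  constructor
  · rintro rfl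
    exact ⟨Nat.sInf_mem hne, fun m hm => not_lt.1 (Nat.notMem_of_lt_sInf hm)⟩
  · rintro ⟨h1, h2⟩
    refine le_antisymm (Nat.sInf_le h1) ?_
    by_contra! hcon
    exact absurd (Nat.sInf_mem hne) (not_lt.2 (h2 _ hcon))

lemma IsGood.cyclePacket_true_eq_iff {z : Input} (hz : IsGood z) {j : ℕ} :
    cyclePacket true z = j ↔ transfer z j ≤ gap z (j + 1) ∧ ∀ i < j, gap z (i + 1) < transfer z i := by
  have hne : {j | 0 ≤ j ∧ transfer z j ≤ gap z (j + 1)}.Nonempty := hz.exists_success 0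
  have hdef : cyclePacket true z = sInf {j | 0 ≤ j ∧ transfer z j ≤ gap z (j + 1)} := rfl
  rw [hdef]
  constructor
  · rintro rfl
    refine ⟨(Nat.sInf_mem hne).2, fun i hi => ?_⟩
    by_contra! hcon
    exact Nat.notMem_of_lt_sInf hi ⟨Nat.zero_le _, hcon⟩
  · rintro ⟨h1, h2⟩
    refine le_antisymm (Nat.sInf_le ⟨Nat.zero_le _, h1⟩) ?_
    by_contra! hcon
    exact absurd (Nat.sInf_mem hne).2 (not_le.2 (h2 _ hcon))

lemma IsGood.cycleLength_pos {z : Input} (hz : IsGood z) (b : Bool) : 0 < cycleLength b z := by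
  have h1 := arrival_mono hz.gap_pos (Nat.zero_le (cyclePacket b z))
  have h2 : arrival (gap z) 0 = gap z 0 := by simp [arrival]
  have := hz.gap_pos 0
  have := hz.transfer_nonneg (cyclePacket b z)
  unfold cycleLength
  linarith

lemma IsGood.cycleNext_ne_zero {z : Input} (hz : IsGood z) (b : Bool) : cycleNext b z ≠ 0 := by
  intro h
  have h1 := (hz.nextPacket_eq_iff.1 h).1
  have h2 := arrival_mono hz.gap_pos (Nat.zero_le (cyclePacket b z))
  have := hz.transfer_nonneg (cyclePacket b z)
  unfold cycleLength at h1
  linarith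

/-- Whether packet `j + 1` is the first to arrive after a cycle with data in `A` is decided by the
packets `0, …, j`, up to the condition that the gap after packet `j` is long enough. -/
lemma exists_cycle_decomposition (b : Bool) (j : ℕ) {A : Set (ℝ × ℝ)} (hA : MeasurableSet A) :
    ∃ (S : Set Input) (h : Input → ℝ), MeasurableSet S ∧ Measurable h ∧
      (∀ z z', graft (j + 1) (j + 1) (z, z') ∈ S ↔ z ∈ S) ∧
      (∀ z z', h (graft (j + 1) (j + 1) (z, z')) = h z) ∧ (∀ z ∈ S, 0 ≤ h z) ∧
      ∀ z, IsGood z → (∀ j, transfer z j ≠ gap z (j + 1)) →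
        ((cycleData b z ∈ A ∧ cycleNext b z = j + 1) ↔ (z ∈ S ∧ h z < gap z (j + 1))) ∧
        (cycleNext b z = j + 1 →
          cycleLength b z - ∑ i ∈ Finset.range (j + 1), gap z i = h z) := by
  have harr : ∀ m ≤ j, ∀ z z', arrival (gap (graft (j + 1) (j + 1) (z, z'))) m
      = arrival (gap z) m := by
    intro m hm z z'
    refine Finset.sum_congr rfl fun i hi => ?_
    rw [Finset.mem_range] at hi
    rw [gap_graft, if_pos (by omega)]
  cases b
  · have hL : ∀ z, cycleLength false z = arrival (gap z) 0 + transfer z 0 := fun z => rfl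
    have hLg : ∀ z z', cycleLength false (graft (j + 1) (j + 1) (z, z')) = cycleLength false z := by
      intro z z'
      rw [hL, hL, harr 0 (Nat.zero_le j), transfer_graft, if_pos (Nat.succ_pos j)]
    have hDg : ∀ z z', cycleData false (graft (j + 1) (j + 1) (z, z')) = cycleData false z := by
      intro z z'
      refine Prod.ext (hLg z z') ?_
      change transfer (graft (j + 1) (j + 1) (z, z')) 0 = transfer z 0
      rw [transfer_graft, if_pos (Nat.succ_pos j)]
    refine ⟨{z | cycleData false z ∈ A ∧ ∀ m ≤ j, arrival (gap z) m ≤ cycleLength false z},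
      fun z => cycleLength false z - arrival (gap z) j, ?_, ?_, ?_, ?_, ?_, ?_⟩
    · have : MeasurableSet {z | ∀ m ≤ j, arrival (gap z) m ≤ cycleLength false z} := by
        have : {z | ∀ m ≤ j, arrival (gap z) m ≤ cycleLength false z}
            = ⋂ m, ⋂ (_ : m ≤ j), {z | arrival (gap z) m ≤ cycleLength false z} := by
          ext; simp
        rw [this]
        exact MeasurableSet.iInter fun m => MeasurableSet.iInter fun _ =>
          measurableSet_le (measurable_arrival m) (measurable_cycleLength false)
      exact (measurable_cycleData false hA).inter this
    · exact (measurable_cycleLength false).sub (measurable_arrival j)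
    · intro z z'
      simp only [Set.mem_ofPred_eq, hDg, hLg]
      refine and_congr_right fun _ => forall₂_congr fun m hm => ?_
      rw [harr m hm]
    · intro z z'
      simp only
      rw [hLg, harr j le_rfl]
    · rintro z ⟨_, hz⟩
      exact sub_nonneg.2 (hz j le_rfl)
    · intro z hz _
      refine ⟨?_, fun _ => rfl⟩
      rw [cycleNext, hz.nextPacket_eq_iff, arrival_succ]
      simp only [Set.mem_ofPred_eq, Nat.lt_succ_iff, sub_lt_iff_lt_add']
      tauto
  · refine ⟨{z | (arrival (gap z) j + transfer z j, transfer z j) ∈ A ∧ 0 ≤ transfer z j ∧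
      ∀ i < j, gap z (i + 1) < transfer z i}, fun z => transfer z j, ?_, measurable_transfer j,
      ?_, ?_, ?_, ?_⟩
    · have h1 : MeasurableSet {z : Input | ∀ i < j, gap z (i + 1) < transfer z i} := by
        have : {z : Input | ∀ i < j, gap z (i + 1) < transfer z i}
            = ⋂ i, ⋂ (_ : i < j), {z | gap z (i + 1) < transfer z i} := by
          ext; simp
        rw [this]
        exact MeasurableSet.iInter fun i => MeasurableSet.iInter fun _ =>
          measurableSet_lt (measurable_gap _) (measurable_transfer i)
      exact ((((measurable_arrival j).add (measurable_transfer j)).prodMk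
        (measurable_transfer j)) hA).inter
        ((measurableSet_le measurable_const (measurable_transfer j)).inter h1)
    · intro z z'
      have ht : transfer (graft (j + 1) (j + 1) (z, z')) j = transfer z j := by
        rw [transfer_graft, if_pos (Nat.lt_succ_self j)]
      simp only [Set.mem_ofPred_eq, harr j le_rfl, ht]
      refine and_congr_right fun _ => and_congr_right fun _ => forall₂_congr fun i hi => ?_
      rw [gap_graft, transfer_graft, if_pos (by omega), if_pos (by omega)]
    · intro z z'
      simp only [transfer_graft, if_pos (Nat.lt_succ_self j)]
    · rintro z ⟨_, hz, _⟩
      exact hz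
    · intro z hz hne
      -- without ties, the next packet to arrive is the successor of the delivered one
      have hnext : cycleNext true z = cyclePacket true z + 1 := by
        have hs := (hz.cyclePacket_true_eq_iff.1 rfl).1
        have hs' := lt_of_le_of_ne hs (hne _)
        rw [cycleNext, hz.nextPacket_eq_iff, arrival_succ]
        refine ⟨by unfold cycleLength; linarith, fun m hm => ?_⟩
        have := arrival_mono hz.gap_pos (Nat.lt_succ_iff.1 hm)
        have := hz.transfer_nonneg (cyclePacket true z)
        unfold cycleLength
        linarith
      rw [hnext, Nat.add_right_cancel_iff]
      refine ⟨?_, fun hp => ?_⟩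
      · constructor
        · rintro ⟨hD, hp⟩
          have hpj := hz.cyclePacket_true_eq_iff.1 hp
          simp only [cycleData, cycleLength, hp] at hD
          exact ⟨⟨hD, hz.transfer_nonneg j, hpj.2⟩, lt_of_le_of_ne hpj.1 (hne j)⟩
        · rintro ⟨⟨hD, _, hlt⟩, hj⟩
          have hp := hz.cyclePacket_true_eq_iff.2 ⟨hj.le, hlt⟩
          refine ⟨?_, hp⟩
          simp only [cycleData, cycleLength, hp]
          exact hD
      · rw [cycleLength, hp]
        simp [arrival]

variable {lam : ℝ} {τ : Measure ℝ} [IsProbabilityMeasure τ]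

/-- The law of the data of a cycle. -/
def cycleLaw (lam : ℝ) (τ : Measure ℝ) (b : Bool) : Measure (ℝ × ℝ) :=
  (inputLaw (expMeasure lam) τ).map (cycleData b)

lemma isProbabilityMeasure_cycleLaw (hlam : 0 < lam) (b : Bool) :
    IsProbabilityMeasure (cycleLaw lam τ b) := by
  have := isProbabilityMeasure_expMeasure hlam
  exact Measure.isProbabilityMeasure_map (measurable_cycleData b).aemeasurable

lemma isRegenerative_cycle (hlam : 0 < lam) (hτ : ∀ᵐ t ∂τ, 0 ≤ t) :
    IsRegenerative (inputLaw (expMeasure lam) τ) (cycleLaw lam τ) cycle := by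
  refine ⟨measurable_cycle, fun b => ?_⟩
  have := isProbabilityMeasure_expMeasure hlam
  have := isProbabilityMeasure_cycleLaw (τ := τ) hlam b
  set P := inputLaw (expMeasure lam) τ with hP
  refine (Measure.prod_eq fun A B hA hB => ?_).symm
  rw [Measure.map_apply (measurable_cycle b) (hA.prod hB), cycleLaw,
    Measure.map_apply (measurable_cycleData b) hA]
  have hgood : ∀ᵐ z ∂P, IsGood z ∧ ∀ j, transfer z j ≠ gap z (j + 1) :=
    (ae_isGood hlam hτ).and (ae_transfer_ne_gap hlam)
  -- split according to the first packet that arrives after the cycle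
  have hsplit : ∀ E : Set Input, MeasurableSet E →
      P E = ∑' j, P (E ∩ cycleNext b ⁻¹' {j + 1}) := by
    intro E hE
    rw [← measure_iUnion]
    · refine measure_congr ?_
      filter_upwards [hgood] with z hz
      refine propext ⟨fun hzE => ?_, fun hzE => ?_⟩
      · refine Set.mem_iUnion.2 ⟨cycleNext b z - 1, hzE, ?_⟩
        have := hz.1.cycleNext_ne_zero b
        simp only [Set.mem_preimage, Set.mem_singleton_iff]
        omega
      · exact (Set.mem_iUnion.1 hzE).choose_spec.1
    · intro i j hij
      refine Set.disjoint_left.2 fun z hi hj => hij ?_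
      have h1 : cycleNext b z = i + 1 := hi.2
      have h2 : cycleNext b z = j + 1 := hj.2
      omega
    · exact fun j => hE.inter (measurable_cycleNext b (measurableSet_singleton _))
  rw [hsplit _ (measurable_cycle b (hA.prod hB)), hsplit _ (measurable_cycleData b hA),
    ← ENNReal.tsum_mul_right]
  refine tsum_congr fun j => ?_
  obtain ⟨S, h, hS, hh, hSg, hhg, hpos, hdec⟩ := exists_cycle_decomposition b j hA
  have e1 : P (cycle b ⁻¹' A ×ˢ B ∩ cycleNext b ⁻¹' {j + 1})
      = P {z | z ∈ S ∧ h z < gap z (j + 1) ∧ shiftInput (j + 1) (h z) z ∈ B} := by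
    refine measure_congr ?_
    filter_upwards [hgood] with z hz
    obtain ⟨d1, d2⟩ := hdec z hz.1 hz.2
    refine propext ⟨fun ⟨⟨hD, hN⟩, hj⟩ => ?_, fun ⟨hzS, hlt, hN⟩ => ?_⟩
    · have hj' : cycleNext b z = j + 1 := hj
      obtain ⟨hzS, hlt⟩ := d1.1 ⟨hD, hj'⟩
      refine ⟨hzS, hlt, ?_⟩
      simp only [cycle, hj', d2 hj'] at hN
      exact hN
    · obtain ⟨hD, hj'⟩ := d1.2 ⟨hzS, hlt⟩
      refine ⟨⟨hD, ?_⟩, hj'⟩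
      simp only [cycle, hj', d2 hj']
      exact hN
  have e2 : P (cycleData b ⁻¹' A ∩ cycleNext b ⁻¹' {j + 1})
      = P {z | z ∈ S ∧ h z < gap z (j + 1)} := by
    refine measure_congr ?_
    filter_upwards [hgood] with z hz
    exact propext (hdec z hz.1 hz.2).1
  rw [e1, e2]
  exact inputLaw_shiftInput hlam (j + 1) hS hh hSg hhg hpos hB

end Regeneration

/-! ### Sample paths -/

section SamplePath

variable {z : Input}

lemma gap_cycle_zero (b : Bool) (z : Input) :
    gap (cycle b z).2 0 = arrival (gap z) (cycleNext b z) - cycleLength b z := by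
  rw [arrival_eq]
  simp only [cycle, gap, shiftInput, Sum.elim_inl, if_true]
  ring

lemma gap_cycle_succ (b : Bool) (z : Input) (i : ℕ) :
    gap (cycle b z).2 (i + 1) = gap z (cycleNext b z + (i + 1)) := by
  simp [cycle, gap, shiftInput]

lemma transfer_cycle (b : Bool) (z : Input) (i : ℕ) :
    transfer (cycle b z).2 i = transfer z (cycleNext b z + i) := by
  simp [cycle, transfer, shiftInput]

lemma arrival_cycle (b : Bool) (z : Input) (i : ℕ) :
    arrival (gap (cycle b z).2) i = arrival (gap z) (cycleNext b z + i) - cycleLength b z := by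
  induction i with
  | zero => rw [add_zero, ← gap_cycle_zero]; simp [arrival]
  | succ i ih =>
    rw [arrival_succ, ih, gap_cycle_succ, ← add_assoc, arrival_succ]
    ring

lemma IsGood.cycle (hz : IsGood z) (b : Bool) : IsGood (cycle b z).2 := by
  have hN := (hz.nextPacket_eq_iff (r := cycleLength b z) (n := cycleNext b z)).1 rfl
  refine ⟨?_, fun n => ?_, fun r => ?_, fun m => ?_⟩
  · rintro (_ | n)
    · rw [gap_cycle_zero]; linarith [hN.1]
    · rw [gap_cycle_succ]; exact hz.gap_pos _
  · rw [transfer_cycle]; exact hz.transfer_nonneg _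
  · obtain ⟨n, hn⟩ := hz.exists_arrival (r + cycleLength b z)
    refine ⟨n, ?_⟩
    have := arrival_mono hz.gap_pos (Nat.le_add_left n (cycleNext b z))
    rw [arrival_cycle]
    linarith
  · obtain ⟨j, hj, hj'⟩ := hz.exists_success (cycleNext b z + m)
    obtain ⟨i, rfl⟩ := Nat.exists_eq_add_of_le (show cycleNext b z ≤ j by omega)
    refine ⟨i, by omega, ?_⟩
    rwa [transfer_cycle, gap_cycle_succ, ← add_assoc]

lemma sInf_eq_add_sInf {p q : ℕ → Prop} {n : ℕ} (hlt : ∀ m, p m → n ≤ m)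
    (hpq : ∀ i, p (n + i) ↔ q i) (hne : ∃ i, q i) : sInf {m | p m} = n + sInf {i | q i} := by
  have hneq : {i | q i}.Nonempty := hne
  have hnep : {m | p m}.Nonempty := ⟨n + hne.choose, (hpq _).2 hne.choose_spec⟩
  refine le_antisymm (Nat.sInf_le ((hpq _).2 (Nat.sInf_mem hneq))) ?_
  have hp : p (sInf {m | p m}) := Nat.sInf_mem hnep
  obtain ⟨i, hi⟩ := Nat.exists_eq_add_of_le (hlt _ hp)
  rw [hi] at hp ⊢
  exact Nat.add_le_add_left (Nat.sInf_le ((hpq i).1 hp)) n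

lemma IsGood.nextPacket_cycle (hz : IsGood z) (b : Bool) {t : ℝ} (ht : 0 ≤ t) :
    nextPacket (gap z) (cycleLength b z + t)
      = cycleNext b z + nextPacket (gap (_root_.cycle b z).2) t := by
  have hN := (hz.nextPacket_eq_iff (r := cycleLength b z) (n := cycleNext b z)).1 rfl
  refine sInf_eq_add_sInf (fun m hm => ?_) (fun i => ?_) ((hz.cycle b).exists_arrival t)
  · by_contra! hcon
    have := hN.2 m hcon
    linarith
  · rw [arrival_cycle, lt_sub_iff_add_lt']

lemma IsGood.firstUninterrupted_cycle (hz : IsGood z) (b : Bool) (m : ℕ) :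
    firstUninterrupted (gap z) (transfer z) (cycleNext b z + m)
      = cycleNext b z + firstUninterrupted (gap (_root_.cycle b z).2)
        (transfer (_root_.cycle b z).2) m := by
  refine sInf_eq_add_sInf (fun j hj => by omega) (fun i => ?_) ((hz.cycle b).exists_success m)
  rw [transfer_cycle, gap_cycle_succ, Nat.add_le_add_iff_left, add_assoc]

lemma IsGood.deliveredPacket_cycle (hz : IsGood z) (b : Bool) {t : ℝ} (ht : 0 ≤ t) (dop : Prop)
    [Decidable dop] :
    deliveredPacket (gap z) (transfer z) dop (cycleLength b z + t)
      = cycleNext b z + deliveredPacket (gap (_root_.cycle b z).2)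
        (transfer (_root_.cycle b z).2) dop t := by
  unfold deliveredPacket
  rw [hz.nextPacket_cycle b ht]
  split_ifs
  · exact hz.firstUninterrupted_cycle b _
  · rfl

open Classical in
/-- The action that the policy `D` takes after a cycle with data `c`. -/
def policyAction (D : Set ℝ) (c : ℝ × ℝ) : Bool := decide (c.2 ∈ D)

lemma epoch_succ (D : Set ℝ) (g₀ : ℝ) (x s : ℕ → ℝ) (k : ℕ) :
    epoch D g₀ x s (k + 1) =
      let e := epoch D g₀ x s k
      let j := deliveredPacket x s (policyAction D (0, e.age) = true) e.time
      ⟨arrival x j + s j, arrival x j⟩ := by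
  classical
  simp only [epoch, policyAction, deliveredPacket, decide_eq_true_eq]

lemma IsGood.nextPacket_zero (hz : IsGood z) : nextPacket (gap z) 0 = 0 := by
  rw [hz.nextPacket_eq_iff]
  exact ⟨by simpa [arrival] using hz.gap_pos 0, by simp⟩

lemma IsGood.epoch_one (hz : IsGood z) (D : Set ℝ) (g₀ : ℝ) :
    epoch D g₀ (gap z) (transfer z) 1
      = ⟨cycleLength (policyAction D (0, g₀)) z,
          arrival (gap z) (cyclePacket (policyAction D (0, g₀)) z)⟩ := by
  have hage : (epoch D g₀ (gap z) (transfer z) 0).age = g₀ := by simp [epoch, Epoch.age]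
  have htime : (epoch D g₀ (gap z) (transfer z) 0).time = 0 := rfl
  have hj : deliveredPacket (gap z) (transfer z) (policyAction D (0, g₀) = true) 0
      = cyclePacket (policyAction D (0, g₀)) z := by
    unfold deliveredPacket cyclePacket
    rw [hz.nextPacket_zero]
  rw [epoch_succ]
  simp only [hage, htime, hj]
  rfl

lemma IsGood.epoch_time_nonneg (hz : IsGood z) (D : Set ℝ) (g₀ : ℝ) (k : ℕ) :
    0 ≤ (epoch D g₀ (gap z) (transfer z) k).time := by
  cases k with
  | zero => exact le_rfl
  | succ k =>
    rw [epoch_succ]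
    refine add_nonneg (Finset.sum_nonneg fun i _ => (hz.gap_pos i).le) (hz.transfer_nonneg _)

/-- The epochs after the first delivery are those for the input that is left then. -/
lemma IsGood.epoch_succ_eq (hz : IsGood z) (D : Set ℝ) (g₀ : ℝ) (k : ℕ) :
    epoch D g₀ (gap z) (transfer z) (k + 1) =
      let b := policyAction D (0, g₀)
      let e := epoch D (cycleData b z).2 (gap (_root_.cycle b z).2)
        (transfer (_root_.cycle b z).2) k
      ⟨cycleLength b z + e.time, cycleLength b z + e.generated⟩ := by
  induction k with
  | zero =>
    rw [hz.epoch_one]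
    simp [epoch, cycleData, cycleLength]
  | succ k ih =>
    rw [epoch_succ, ih]
    have ht := (hz.cycle (policyAction D (0, g₀))).epoch_time_nonneg D
      (cycleData (policyAction D (0, g₀)) z).2 k
    have hage : ∀ (r : ℝ) (e : Epoch), (Epoch.mk (r + e.time) (r + e.generated)).age = e.age :=
      fun r e => add_sub_add_left_eq_sub _ _ _
    dsimp only
    rw [hage, hz.deliveredPacket_cycle _ ht, epoch_succ]
    dsimp only
    rw [arrival_cycle, transfer_cycle]
    simp only [Epoch.mk.injEq]
    constructor <;> ring

/-- Cycle by cycle, the lengths and the ages at the end are the data produced by `run`. -/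
lemma IsGood.epoch_eq_run (hz : IsGood z) (D : Set ℝ) (g₀ : ℝ) (k : ℕ) :
    (epoch D g₀ (gap z) (transfer z) (k + 1)).time
      = (epoch D g₀ (gap z) (transfer z) k).time
        + (run _root_.cycle (policyAction D) k (policyAction D (0, g₀)) z).1 ∧
    (epoch D g₀ (gap z) (transfer z) (k + 1)).age
      = (run _root_.cycle (policyAction D) k (policyAction D (0, g₀)) z).2 := by
  induction k generalizing z g₀ with
  | zero =>
    rw [hz.epoch_one]
    simp [run, epoch, Epoch.age, _root_.cycle, cycleData, cycleLength]
  | succ k ih =>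
    obtain ⟨h1, h2⟩ := ih (hz.cycle (policyAction D (0, g₀)))
      (cycleData (policyAction D (0, g₀)) z).2
    rw [hz.epoch_succ_eq D g₀ (k + 1), hz.epoch_succ_eq D g₀ k]
    refine ⟨?_, ?_⟩
    · change _ + _ = _ + _ + _
      rw [h1, add_assoc]
      rfl
    · simp only [Epoch.age, add_sub_add_left_eq_sub] at h2 ⊢
      rw [h2]
      rfl

lemma IsGood.run_pos (hz : IsGood z) (D : Set ℝ) (k : ℕ) (b : Bool) :
    0 < (run _root_.cycle (policyAction D) k b z).1 ∧
      0 ≤ (run _root_.cycle (policyAction D) k b z).2 := by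
  induction k generalizing z b with
  | zero => exact ⟨hz.cycleLength_pos b, hz.transfer_nonneg _⟩
  | succ k ih => exact ih (hz.cycle b) _

end SamplePath

/-! ### From averages over cycles to averages over time -/

section Renewal

variable {D : Set ℝ} {g₀ : ℝ} {x s : ℕ → ℝ}

lemma deliveries_eq (hR : StrictMono fun k => (epoch D g₀ x s k).time) {k : ℕ} {t : ℝ}
    (h1 : (epoch D g₀ x s k).time ≤ t) (h2 : t < (epoch D g₀ x s (k + 1)).time) :
    deliveries D g₀ x s t = k := by
  have : {j | (epoch D g₀ x s j).time ≤ t} = Set.Iic k := by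
    ext j
    simp only [Set.mem_ofPred_eq, Set.mem_Iic]
    constructor
    · intro hj
      by_contra! hcon
      have := hR.monotone (Nat.succ_le_of_lt hcon)
      simp only [Nat.succ_eq_add_one] at this
      linarith
    · intro hj
      exact (hR.monotone hj).trans h1
  rw [deliveries, this, csSup_Iic]

lemma age_eq (hR : StrictMono fun k => (epoch D g₀ x s k).time) {k : ℕ} {t : ℝ}
    (h1 : (epoch D g₀ x s k).time ≤ t) (h2 : t < (epoch D g₀ x s (k + 1)).time) :
    age D g₀ x s t = t - (epoch D g₀ x s k).generated := by
  rw [age, deliveries_eq hR h1 h2]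

lemma ae_age_eq (hR : StrictMono fun k => (epoch D g₀ x s k).time) (k : ℕ) :
    ∀ᵐ u : ℝ, u ∈ Set.uIoc (epoch D g₀ x s k).time (epoch D g₀ x s (k + 1)).time →
      u - (epoch D g₀ x s k).generated = age D g₀ x s u := by
  filter_upwards [Measure.ae_ne volume (epoch D g₀ x s (k + 1)).time] with u hu hmem
  rw [Set.uIoc_of_le (hR (Nat.lt_succ_self k)).le] at hmem
  exact (age_eq hR hmem.1.le (lt_of_le_of_ne hmem.2 hu)).symm

lemma intervalIntegrable_age_cycle (hR : StrictMono fun k => (epoch D g₀ x s k).time) (k : ℕ) :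
    IntervalIntegrable (age D g₀ x s) volume (epoch D g₀ x s k).time
      (epoch D g₀ x s (k + 1)).time := by
  have : IntervalIntegrable (fun u => u - (epoch D g₀ x s k).generated) volume
      (epoch D g₀ x s k).time (epoch D g₀ x s (k + 1)).time :=
    (continuous_id.sub continuous_const).intervalIntegrable _ _
  refine this.congr_ae ?_
  rw [Filter.EventuallyEq, ae_restrict_iff' measurableSet_uIoc]
  exact ae_age_eq hR k

lemma integral_age_cycle (hR : StrictMono fun k => (epoch D g₀ x s k).time) (k : ℕ) :
    ∫ u in (epoch D g₀ x s k).time..(epoch D g₀ x s (k + 1)).time, age D g₀ x s u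
      = (epoch D g₀ x s k).age * ((epoch D g₀ x s (k + 1)).time - (epoch D g₀ x s k).time)
        + ((epoch D g₀ x s (k + 1)).time - (epoch D g₀ x s k).time) ^ 2 / 2 := by
  rw [← intervalIntegral.integral_congr_ae (ae_age_eq hR k), intervalIntegral.integral_sub
    (f := fun u => u) (g := fun _ => (epoch D g₀ x s k).generated)
    (continuous_id.intervalIntegrable _ _) (continuous_const.intervalIntegrable _ _),
    integral_id, intervalIntegral.integral_const, smul_eq_mul, Epoch.age]
  ring

/-- If the lengths of the first `K` cycles, and the areas under the age in these cycles, have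
averages that converge to `d > 0` and `v`, then the time average of the age converges to
`v / d`. -/
theorem tendsto_avgAge {d v : ℝ} (hR : StrictMono fun k => (epoch D g₀ x s k).time)
    (hage : ∀ k, 0 ≤ (epoch D g₀ x s k).age) (hd : 0 < d)
    (hlen : Tendsto (fun K : ℕ => (epoch D g₀ x s K).time / K) atTop (𝓝 d))
    (harea : Tendsto (fun K : ℕ => (∑ k ∈ Finset.range K, ((epoch D g₀ x s k).age
        * ((epoch D g₀ x s (k + 1)).time - (epoch D g₀ x s k).time)
        + ((epoch D g₀ x s (k + 1)).time - (epoch D g₀ x s k).time) ^ 2 / 2)) / (K : ℝ)) atTop (𝓝 v)) :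
    Tendsto (avgAge D g₀ x s) atTop (𝓝 (v / d)) := by
  set R : ℕ → ℝ := fun k => (epoch D g₀ x s k).time with hRdef
  set I : ℝ → ℝ := fun t => ∫ u in (0 : ℝ)..t, age D g₀ x s u with hI
  have hR0 : R 0 = 0 := rfl
  have hint : ∀ K, IntervalIntegrable (age D g₀ x s) volume 0 (R K) := fun K => by
    have := IntervalIntegrable.trans_iterate (a := R) (n := K) (f := age D g₀ x s)
      (μ := volume) fun k _ => intervalIntegrable_age_cycle hR k
    rwa [hR0] at this
  have hIR : ∀ K, I (R K) = ∑ k ∈ Finset.range K, ((epoch D g₀ x s k).age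
        * (R (k + 1) - R k) + (R (k + 1) - R k) ^ 2 / 2) := fun K => by
    have := intervalIntegral.sum_integral_adjacent_intervals (a := R) (n := K)
      (f := age D g₀ x s) (μ := volume) fun k _ => intervalIntegrable_age_cycle hR k
    rw [hR0] at this
    simp only [hI]
    rw [← this]
    exact Finset.sum_congr rfl fun k _ => integral_age_cycle hR k
  have hRtop : Tendsto R atTop atTop := by
    have := hlen.pos_mul_atTop hd tendsto_natCast_atTop_atTop
    refine this.congr' ?_
    filter_upwards [eventually_gt_atTop 0] with K hK
    have : (K : ℝ) ≠ 0 := by exact_mod_cast hK.ne'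
    field_simp
    rfl
  have hex : ∀ t, 0 ≤ t → R (deliveries D g₀ x s t) ≤ t ∧ t < R (deliveries D g₀ x s t + 1) := by
    intro t ht
    have hne : ∃ n, t < R n := (hRtop.eventually_gt_atTop t).exists
    classical
    have hn := Nat.find_spec hne
    have h0 : Nat.find hne ≠ 0 := fun h0 => by rw [h0, hR0] at hn; linarith
    obtain ⟨k, hk⟩ := Nat.exists_eq_succ_of_ne_zero h0
    have hlow : R k ≤ t := not_lt.1 (Nat.find_min hne (by omega))
    rw [hk] at hn
    rw [deliveries_eq hR hlow hn]
    exact ⟨hlow, hn⟩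
  have hnonneg : ∀ t, 0 ≤ t → 0 ≤ age D g₀ x s t := by
    intro t ht
    have h := (hex t ht).1
    have := hage (deliveries D g₀ x s t)
    simp only [Epoch.age, hRdef] at this h
    rw [age]
    linarith
  have hintt : ∀ t, 0 ≤ t → IntervalIntegrable (age D g₀ x s) volume 0 t := fun t ht =>
    (hint (deliveries D g₀ x s t + 1)).mono_set (by
      rw [Set.uIcc_of_le ht, Set.uIcc_of_le (ht.trans (hex t ht).2.le)]
      exact Set.Icc_subset_Icc_right (hex t ht).2.le)
  have hImono : ∀ a t, 0 ≤ a → a ≤ t → I a ≤ I t := by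
    intro a t ha hat
    have := intervalIntegral.integral_interval_sub_left (hintt t (ha.trans hat)) (hintt a ha)
    have h2 : 0 ≤ ∫ u in a..t, age D g₀ x s u :=
      intervalIntegral.integral_nonneg hat fun u hu => hnonneg u (ha.trans hu.1)
    simp only [hI]
    linarith
  have hcount : Tendsto (deliveries D g₀ x s) atTop atTop := by
    refine tendsto_atTop.2 fun M => ?_
    filter_upwards [eventually_ge_atTop (R M), eventually_ge_atTop 0] with t ht ht0
    have := (hex t ht0).2
    have := hR.lt_iff_lt.1 (lt_of_le_of_lt ht this)
    omega
  have hA : Tendsto (fun K : ℕ => I (R K) / K) atTop (𝓝 v) := by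
    simpa only [hIR] using harea
  have hfrac : Tendsto (fun K : ℕ => (K : ℝ) / (K + 1)) atTop (𝓝 1) :=
    tendsto_natCast_div_add_atTop 1
  have hlow : Tendsto (fun K : ℕ => I (R K) / R (K + 1)) atTop (𝓝 (v / d)) := by
    have := (hA.mul hfrac).div ((tendsto_add_atTop_iff_nat 1).2 hlen) hd.ne'
    rw [mul_one] at this
    refine this.congr' ?_
    filter_upwards [eventually_gt_atTop 0] with K hK
    have : (K : ℝ) ≠ 0 := by exact_mod_cast hK.ne'
    have h2 : ((K : ℝ) + 1) ≠ 0 := by positivity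
    simp only [Pi.div_apply]
    push_cast
    have : R (K + 1) = (epoch D g₀ x s (K + 1)).time := rfl
    rw [this]
    field_simp
  have hup : Tendsto (fun K : ℕ => I (R (K + 1)) / R K) atTop (𝓝 (v / d)) := by
    have := ((tendsto_add_atTop_iff_nat 1).2 hA).div (hfrac.mul hlen)
      (by rw [one_mul]; exact hd.ne')
    rw [one_mul] at this
    refine this.congr' ?_
    filter_upwards [eventually_gt_atTop 0] with K hK
    have : (K : ℝ) ≠ 0 := by exact_mod_cast hK.ne'
    have h2 : ((K : ℝ) + 1) ≠ 0 := by positivity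
    simp only [Pi.div_apply]
    push_cast
    have : R K = (epoch D g₀ x s K).time := rfl
    rw [this]
    field_simp
  refine tendsto_of_tendsto_of_tendsto_of_le_of_le' (hlow.comp hcount) (hup.comp hcount) ?_ ?_
  · filter_upwards [eventually_gt_atTop 0] with t ht
    obtain ⟨h1, h2⟩ := hex t ht.le
    have hRn : 0 ≤ R (deliveries D g₀ x s t) := by rw [← hR0]; exact hR.monotone (Nat.zero_le _)
    have hI0 : 0 ≤ I (R (deliveries D g₀ x s t)) := by
      have := hImono 0 _ le_rfl hRn
      simpa [hI] using this
    exact div_le_div₀ (hI0.trans (hImono _ _ hRn h1)) (hImono _ _ hRn h1) ht h2.le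
  · filter_upwards [eventually_gt_atTop 0, hcount.eventually_gt_atTop 0] with t ht hpos
    obtain ⟨h1, h2⟩ := hex t ht.le
    have hRn : 0 < R (deliveries D g₀ x s t) := by rw [← hR0]; exact hR hpos
    have hI0 : 0 ≤ I (R (deliveries D g₀ x s t + 1)) := by
      have := hImono 0 _ le_rfl (ht.le.trans h2.le)
      simpa [hI] using this
    exact div_le_div₀ hI0 (hImono _ _ ht.le h2.le) hRn h1

end Renewal

/-! ### Moments of exponential variables -/

section Moments

variable {lam : ℝ}

lemma integral_pow_expMeasure (hlam : 0 < lam) (k : ℕ) :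
    ∫ x, x ^ k ∂(expMeasure lam) = k.factorial / lam ^ k := by
  have hdens : expMeasure lam = volume.withDensity (exponentialPDF lam) := rfl
  have hmeas : Measurable (exponentialPDF lam) := (measurable_exponentialPDFReal lam).ennreal_ofReal
  rw [hdens, integral_withDensity_eq_integral_toReal_smul hmeas
    (Eventually.of_forall fun _ => ENNReal.ofReal_lt_top)]
  have h1 : ∀ᵐ x : ℝ, (exponentialPDF lam x).toReal • x ^ k
      = (Set.Ioi (0 : ℝ)).indicator
        (fun x => lam * (x ^ ((k + 1 : ℝ) - 1) * Real.exp (-(lam * x)))) x := by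
    filter_upwards [Measure.ae_ne volume (0 : ℝ)] with x hx
    rcases lt_or_gt_of_ne hx with hneg | hpos
    · rw [exponentialPDF_of_neg hneg, Set.indicator_of_notMem (by simp [hneg.le])]
      simp
    · rw [exponentialPDF_of_nonneg hpos.le, Set.indicator_of_mem (Set.mem_Ioi.2 hpos),
        ENNReal.toReal_ofReal (by positivity), add_sub_cancel_right, Real.rpow_natCast,
        smul_eq_mul]
      ring
  rw [integral_congr_ae h1, integral_indicator measurableSet_Ioi, integral_const_mul,
    Real.integral_rpow_mul_exp_neg_mul_Ioi (by positivity) hlam, Real.Gamma_nat_eq_factorial]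
  have : (1 / lam : ℝ) ^ ((k : ℝ) + 1) = (1 / lam) ^ (k + 1) := by
    rw [← Real.rpow_natCast]; push_cast; rfl
  rw [this, one_div, inv_pow, pow_succ]
  field_simp

lemma integrable_pow_expMeasure (hlam : 0 < lam) (k : ℕ) :
    Integrable (fun x => x ^ k) (expMeasure lam) := by
  refine Integrable.of_integral_ne_zero ?_
  rw [integral_pow_expMeasure hlam k]
  positivity

/-- The integral over the part of the exponential distribution above `s` is that of the shifted
function, times the probability of this part. -/
lemma integral_indicator_Ici_expMeasure {s : ℝ} (hs : 0 ≤ s) (f : ℝ → ℝ)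
    (hf : Measurable f) :
    ∫ x, (Set.Ici s).indicator f x ∂(expMeasure lam)
      = Real.exp (-lam * s) * ∫ x, f (s + x) ∂(expMeasure lam) := by
  have hres : (expMeasure lam).restrict (Set.Ici s)
      = ENNReal.ofReal (Real.exp (-lam * s)) • (expMeasure lam).map (fun x => s + x) := by
    have hIci : (expMeasure lam).restrict (Set.Ici s) = (expMeasure lam).restrict (Set.Ioi s) := by
      exact (Measure.restrict_congr_set (Ioi_ae_eq_Ici' (expMeasure_singleton s))).symm
    rw [hIci]
    ext B hB
    rw [Measure.restrict_apply hB, Measure.smul_apply, smul_eq_mul,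
      Measure.map_apply (measurable_const_add s) hB,
      ← expMeasure_lt_sub_mem hs (measurable_const_add s hB)]
    congr 1
    ext y
    simp [and_comm]
  rw [integral_indicator measurableSet_Ici, hres, integral_smul_measure,
    integral_map (measurable_const_add s).aemeasurable hf.aestronglyMeasurable,
    ENNReal.toReal_ofReal (Real.exp_pos _).le, smul_eq_mul]

variable {τ : Measure ℝ} [IsProbabilityMeasure τ]

/-- The expectation of a function of a transfer time and of the following gap, on the event that
the transfer is completed. -/
lemma integral_indicator_le_prod (hlam : 0 < lam) (hτ : ∀ᵐ t ∂τ, 0 ≤ t) {f : ℝ × ℝ → ℝ}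
    (hf : Measurable f) (hint : Integrable f (τ.prod (expMeasure lam))) :
    ∫ y, {y : ℝ × ℝ | y.1 ≤ y.2}.indicator f y ∂(τ.prod (expMeasure lam))
      = ∫ t, Real.exp (-lam * t) * ∫ x, f (t, t + x) ∂(expMeasure lam) ∂τ := by
  have := isProbabilityMeasure_expMeasure hlam
  have hm : MeasurableSet {y : ℝ × ℝ | y.1 ≤ y.2} := measurableSet_le measurable_fst measurable_snd
  rw [integral_prod _ (hint.indicator hm)]
  refine integral_congr_ae ?_
  filter_upwards [hτ] with t ht
  rw [← integral_indicator_Ici_expMeasure ht (fun x => f (t, x))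
    (hf.comp measurable_prodMk_left)]
  rfl

lemma integral_comp_of_measurePreserving {X Y : Type*} [MeasurableSpace X] [MeasurableSpace Y]
    {μ : Measure X} {ν : Measure Y} {f : X → Y} (hf : MeasurePreserving f μ ν) {g : Y → ℝ}
    (hg : Measurable g) : ∫ x, g (f x) ∂μ = ∫ y, g y ∂ν := by
  rw [← hf.map_eq, integral_map hf.aemeasurable hg.aestronglyMeasurable]

end Moments

/-! ### A DOP cycle as a sequence of independent attempts -/

section Attempts

/-- The event that a transfer is completed before the next arrival, for the pair of the transfer
time and the gap that follows. -/
def completed : Set (ℝ × ℝ) := {y | y.1 ≤ y.2}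

lemma measurableSet_completed : MeasurableSet completed :=
  measurableSet_le measurable_fst measurable_snd

/-- The part of a DOP cycle after the first arrival. -/
def excess (z : Input) : ℝ := cycleLength true z - gap z 0

lemma measurable_excess : Measurable excess := (measurable_cycleLength true).sub (measurable_gap 0)

lemma IsGood.excess_nonneg {z : Input} (hz : IsGood z) : 0 ≤ excess z := by
  have h1 := arrival_mono hz.gap_pos (Nat.zero_le (cyclePacket true z))
  have h2 : arrival (gap z) 0 = gap z 0 := by simp [arrival]
  have := hz.transfer_nonneg (cyclePacket true z)
  unfold excess cycleLength
  linarith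

lemma arrival_graft_succ (z z' : Input) (j : ℕ) :
    arrival (gap (graft 2 1 (z, z'))) (j + 1)
      = gap z 0 + gap z 1 + (arrival (gap z') j - gap z' 0) := by
  induction j with
  | zero => simp [arrival, Finset.sum_range_succ, gap_graft]
  | succ j ih =>
    rw [arrival_succ, ih, arrival_succ, gap_graft, if_neg (by omega),
      show j + 1 + 1 - 1 = j + 1 by omega]
    ring

lemma IsGood.cyclePacket_graft {z' : Input} (hz' : IsGood z') (z : Input) :
    cyclePacket true (graft 2 1 (z, z'))
      = if transfer z 0 ≤ gap z 1 then 0 else 1 + cyclePacket true z' := by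
  have hdef : ∀ z, cyclePacket true z = sInf {j | 0 ≤ j ∧ transfer z j ≤ gap z (j + 1)} :=
    fun _ => rfl
  split_ifs with h
  · rw [hdef]
    refine Nat.le_zero.1 (Nat.sInf_le ⟨le_rfl, ?_⟩)
    simpa [gap_graft, transfer_graft] using h
  · rw [hdef, hdef]
    refine sInf_eq_add_sInf (fun m hm => ?_) (fun i => ?_) (hz'.exists_success 0)
    · by_contra! hcon
      obtain rfl : m = 0 := by omega
      exact h (by simpa [gap_graft, transfer_graft] using hm.2)
    · rw [gap_graft, transfer_graft, if_neg (by omega), if_neg (by omega),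
        show 1 + i - 1 = i by omega, show 1 + i + 1 - 1 = i + 1 by omega]
      simp

lemma IsGood.cycleAge_graft {z' : Input} (hz' : IsGood z') (z : Input) :
    transfer (graft 2 1 (z, z')) (cyclePacket true (graft 2 1 (z, z')))
      = completed.indicator Prod.fst (transfer z 0, gap z 1)
        + completedᶜ.indicator 1 (transfer z 0, gap z 1) * transfer z' (cyclePacket true z') := by
  rw [hz'.cyclePacket_graft]
  by_cases h : transfer z 0 ≤ gap z 1
  · simp [h, completed, transfer_graft]
  · simp [h, completed, transfer_graft]

/-- After a failed attempt, the cycle goes on as if it started with the next packet. -/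
lemma IsGood.excess_graft {z' : Input} (hz' : IsGood z') (z : Input) :
    excess (graft 2 1 (z, z'))
      = completed.indicator Prod.fst (transfer z 0, gap z 1)
        + completedᶜ.indicator Prod.snd (transfer z 0, gap z 1)
        + completedᶜ.indicator 1 (transfer z 0, gap z 1) * excess z' := by
  have h0 : gap (graft 2 1 (z, z')) 0 = gap z 0 := by simp [gap_graft]
  rw [excess, cycleLength, hz'.cycleAge_graft, hz'.cyclePacket_graft, h0]
  by_cases h : transfer z 0 ≤ gap z 1
  · simp [h, completed, arrival, h0]
  · rw [if_neg h, add_comm 1, arrival_graft_succ]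
    simp [h, completed, excess, cycleLength]
    ring

variable {lam : ℝ} {τ : Measure ℝ} [IsProbabilityMeasure τ]

/-- The probability that an attempt succeeds. -/
def successProb (lam : ℝ) (τ : Measure ℝ) : ℝ := ∫ t, Real.exp (-lam * t) ∂τ

lemma integrable_exp_mul {τ : Measure ℝ} (hlam : 0 < lam) (hτ : ∀ᵐ t ∂τ, 0 ≤ t) {g : ℝ → ℝ}
    (hg : Integrable g τ) : Integrable (fun t => Real.exp (-lam * t) * g t) τ := by
  refine hg.bdd_mul (c := 1) (by fun_prop) ?_
  filter_upwards [hτ] with t ht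
  rw [Real.norm_eq_abs, abs_of_pos (Real.exp_pos _), Real.exp_le_one_iff]
  nlinarith

lemma integrable_exp (hlam : 0 < lam) (hτ : ∀ᵐ t ∂τ, 0 ≤ t) :
    Integrable (fun t => Real.exp (-lam * t)) τ := by
  simpa using integrable_exp_mul hlam hτ (integrable_const (1 : ℝ))

lemma successProb_pos (hlam : 0 < lam) (hτ : ∀ᵐ t ∂τ, 0 ≤ t) : 0 < successProb lam τ :=
  integral_exp_pos (integrable_exp hlam hτ)

lemma integral_completed_one (hlam : 0 < lam) (hτ : ∀ᵐ t ∂τ, 0 ≤ t) :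
    ∫ y, completed.indicator (fun _ => (1 : ℝ)) y ∂(τ.prod (expMeasure lam)) = successProb lam τ := by
  have := isProbabilityMeasure_expMeasure hlam
  rw [completed, integral_indicator_le_prod hlam hτ measurable_const (integrable_const _)]
  simp [successProb]

lemma integral_completed_fst_pow (hlam : 0 < lam) (hτ : ∀ᵐ t ∂τ, 0 ≤ t) (k : ℕ)
    (hint : Integrable (fun t => t ^ k) τ) :
    ∫ y, completed.indicator (fun y => y.1 ^ k) y ∂(τ.prod (expMeasure lam))
      = ∫ t, Real.exp (-lam * t) * t ^ k ∂τ := by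
  have := isProbabilityMeasure_expMeasure hlam
  rw [completed, integral_indicator_le_prod hlam hτ (measurable_fst.pow_const k) (hint.comp_fst _)]
  simp

lemma integral_completed_snd (hlam : 0 < lam) (hτ : ∀ᵐ t ∂τ, 0 ≤ t)
    (hint : Integrable (fun t => t) τ) :
    ∫ y, completed.indicator Prod.snd y ∂(τ.prod (expMeasure lam))
      = ∫ t, Real.exp (-lam * t) * t ∂τ + successProb lam τ / lam := by
  have := isProbabilityMeasure_expMeasure hlam
  have i1 : Integrable (fun x => x) (expMeasure lam) := by
    simpa using integrable_pow_expMeasure hlam 1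
  have e1 : ∫ x, x ∂(expMeasure lam) = 1 / lam := by simpa using integral_pow_expMeasure hlam 1
  rw [completed, integral_indicator_le_prod hlam hτ measurable_snd (i1.comp_snd _)]
  have : ∀ t : ℝ, ∫ x, (t + x) ∂(expMeasure lam) = t + 1 / lam := fun t => by
    rw [integral_add (integrable_const _) i1, e1]; simp
  simp only [this, mul_add]
  rw [integral_add (integrable_exp_mul hlam hτ hint) ((integrable_exp hlam hτ).mul_const _),
    integral_mul_const, successProb, mul_one_div]

lemma integral_completed_snd_sq (hlam : 0 < lam) (hτ : ∀ᵐ t ∂τ, 0 ≤ t)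
    (hint : Integrable (fun t => t) τ) (hint2 : Integrable (fun t => t ^ 2) τ) :
    ∫ y, completed.indicator (fun y => y.2 ^ 2) y ∂(τ.prod (expMeasure lam))
      = ∫ t, Real.exp (-lam * t) * t ^ 2 ∂τ + (∫ t, Real.exp (-lam * t) * t ∂τ) * (2 / lam)
        + successProb lam τ * (2 / lam ^ 2) := by
  have := isProbabilityMeasure_expMeasure hlam
  have i1 : Integrable (fun x => x) (expMeasure lam) := by
    simpa using integrable_pow_expMeasure hlam 1
  have e1 : ∫ x, x ∂(expMeasure lam) = 1 / lam := by simpa using integral_pow_expMeasure hlam 1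
  have i2 : Integrable (fun x => x ^ 2) (expMeasure lam) := integrable_pow_expMeasure hlam 2
  have e2 : ∫ x, x ^ 2 ∂(expMeasure lam) = 2 / lam ^ 2 := by
    simpa using integral_pow_expMeasure hlam 2
  rw [completed, integral_indicator_le_prod hlam hτ (measurable_snd.pow_const 2) (i2.comp_snd _)]
  have : ∀ t : ℝ, ∫ x, (t + x) ^ 2 ∂(expMeasure lam)
      = t ^ 2 + t * (2 / lam) + 2 / lam ^ 2 := fun t => by
    have : ∀ x : ℝ, (t + x) ^ 2 = t ^ 2 + 2 * t * x + x ^ 2 := fun x => by ring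
    simp only [this]
    have i3 : Integrable (fun x => t ^ 2 + 2 * t * x) (expMeasure lam) :=
      (integrable_const _).add (i1.const_mul _)
    rw [integral_add i3 i2,
      integral_add (integrable_const _) (i1.const_mul _), integral_const_mul, e1, e2]
    simp
    ring
  simp only [this, mul_add, ← mul_assoc]
  have i3 : Integrable (fun t => Real.exp (-lam * t) * t ^ 2 + Real.exp (-lam * t) * t * (2 / lam))
      τ := (integrable_exp_mul hlam hτ hint2).add ((integrable_exp_mul hlam hτ hint).mul_const _)
  rw [integral_add i3 ((integrable_exp hlam hτ).mul_const _),
    integral_add (integrable_exp_mul hlam hτ hint2)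
      ((integrable_exp_mul hlam hτ hint).mul_const _),
    integral_mul_const, integral_mul_const, successProb]

end Attempts

/-! ### Moments of the cycles -/

section CycleMoments

lemma integral_add_mul_prod {X Y : Type*} [MeasurableSpace X] [MeasurableSpace Y] {μ : Measure X}
    {ν : Measure Y} [IsProbabilityMeasure μ] [IsProbabilityMeasure ν] {a c c' : X → ℝ}
    {g g' : Y → ℝ} (ha : Integrable a μ) (hc : Integrable c μ) (hg : Integrable g ν)
    (hc' : Integrable c' μ) (hg' : Integrable g' ν) :
    Integrable (fun y => a y.1 + c y.1 * g y.2 + c' y.1 * g' y.2) (μ.prod ν) ∧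
    ∫ y, (a y.1 + c y.1 * g y.2 + c' y.1 * g' y.2) ∂(μ.prod ν)
      = ∫ x, a x ∂μ + (∫ x, c x ∂μ) * ∫ y, g y ∂ν + (∫ x, c' x ∂μ) * ∫ y, g' y ∂ν := by
  have i1 : Integrable (fun y : X × Y => a y.1) (μ.prod ν) := ha.comp_fst _
  have i2 : Integrable (fun y : X × Y => c y.1 * g y.2) (μ.prod ν) := hc.mul_prod hg
  have i3 : Integrable (fun y : X × Y => c' y.1 * g' y.2) (μ.prod ν) := hc'.mul_prod hg'
  have i4 : Integrable (fun y : X × Y => a y.1 + c y.1 * g y.2) (μ.prod ν) := i1.add i2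
  refine ⟨i4.add i3, ?_⟩
  have e1 : ∫ y : X × Y, a y.1 ∂(μ.prod ν) = ∫ x, a x ∂μ := by
    have := integral_prod_mul (μ := μ) (ν := ν) a (fun _ => (1 : ℝ))
    simpa using this
  rw [integral_add i4 i3, integral_add i1 i2, integral_prod_mul, integral_prod_mul, e1]

variable {lam : ℝ} {τ : Measure ℝ} [IsProbabilityMeasure τ]

lemma integral_comp_pair (hlam : 0 < lam) {f : ℝ × ℝ → ℝ} (hf : Measurable f) :
    ∫ z, f (transfer z 0, gap z 1) ∂(inputLaw (expMeasure lam) τ)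
      = ∫ y, f y ∂(τ.prod (expMeasure lam)) := by
  have := isProbabilityMeasure_expMeasure hlam
  exact integral_comp_of_measurePreserving (measurePreserving_transfer_gap 0 1) hf

lemma integrable_comp_pair (hlam : 0 < lam) {f : ℝ × ℝ → ℝ}
    (hf : Integrable f (τ.prod (expMeasure lam))) :
    Integrable (fun z => f (transfer z 0, gap z 1)) (inputLaw (expMeasure lam) τ) := by
  have := isProbabilityMeasure_expMeasure hlam
  exact (measurePreserving_transfer_gap 0 1).integrable_comp_of_integrable hf

lemma integral_eq_integral_graft (hlam : 0 < lam) {f : Input → ℝ} (hf : Measurable f) :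
    ∫ z, f z ∂(inputLaw (expMeasure lam) τ) = ∫ y, f (graft 2 1 y)
      ∂((inputLaw (expMeasure lam) τ).prod (inputLaw (expMeasure lam) τ)) := by
  have := isProbabilityMeasure_expMeasure hlam
  exact (integral_comp_of_measurePreserving (measurePreserving_graft one_le_two) hf).symm

lemma integrable_gap (hlam : 0 < lam) (n : ℕ) :
    Integrable (fun z => gap z n) (inputLaw (expMeasure lam) τ) := by
  have := isProbabilityMeasure_expMeasure hlam
  have h : Integrable (fun x => x) (expMeasure lam) := by
    simpa using integrable_pow_expMeasure hlam 1
  exact (measurePreserving_gap n).integrable_comp_of_integrable h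

lemma integrable_gap_sq (hlam : 0 < lam) (n : ℕ) :
    Integrable (fun z => gap z n ^ 2) (inputLaw (expMeasure lam) τ) := by
  have := isProbabilityMeasure_expMeasure hlam
  exact (measurePreserving_gap n).integrable_comp_of_integrable (integrable_pow_expMeasure hlam 2)

lemma integral_gap (hlam : 0 < lam) (n : ℕ) :
    ∫ z, gap z n ∂(inputLaw (expMeasure lam) τ) = 1 / lam := by
  have := isProbabilityMeasure_expMeasure hlam
  rw [integral_comp_of_measurePreserving (measurePreserving_gap n) (g := fun x => x)
    measurable_id]
  simpa using integral_pow_expMeasure hlam 1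

lemma integral_gap_sq (hlam : 0 < lam) (n : ℕ) :
    ∫ z, gap z n ^ 2 ∂(inputLaw (expMeasure lam) τ) = 2 / lam ^ 2 := by
  have := isProbabilityMeasure_expMeasure hlam
  rw [integral_comp_of_measurePreserving (measurePreserving_gap n) (g := fun x => x ^ 2)
    (measurable_id.pow_const 2)]
  simpa using integral_pow_expMeasure hlam 2

/-- The indicator of a failed attempt with the first packet. -/
def failed (z : Input) : ℝ := completedᶜ.indicator 1 (transfer z 0, gap z 1)

lemma integrable_failed (hlam : 0 < lam) :
    Integrable failed (inputLaw (expMeasure lam) τ) := by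
  have := isProbabilityMeasure_expMeasure hlam
  exact integrable_comp_pair hlam ((integrable_const (1 : ℝ)).indicator
    measurableSet_completed.compl)

lemma integral_failed (hlam : 0 < lam) (hτ : ∀ᵐ t ∂τ, 0 ≤ t) :
    ∫ z, failed z ∂(inputLaw (expMeasure lam) τ) = 1 - successProb lam τ := by
  have := isProbabilityMeasure_expMeasure hlam
  have h1 : ∀ z, failed z = completedᶜ.indicator (fun _ => (1 : ℝ)) (transfer z 0, gap z 1) :=
    fun _ => rfl
  simp only [h1]
  rw [integral_comp_pair hlam (measurable_const.indicator measurableSet_completed.compl),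
    ← integral_completed_one hlam hτ, integral_indicator measurableSet_completed.compl,
    integral_indicator measurableSet_completed,
    setIntegral_compl measurableSet_completed (integrable_const (1 : ℝ))]
  simp

lemma failed_nonneg (z : Input) : 0 ≤ failed z :=
  Set.indicator_nonneg (fun _ _ => zero_le_one) _

lemma failed_le_one (z : Input) : failed z ≤ 1 :=
  Set.indicator_le_self' (f := (1 : ℝ × ℝ → ℝ)) (fun _ _ => zero_le_one) _

lemma IsGood.excess_graft_le {z z' : Input} (hz : IsGood z) (hz' : IsGood z') :
    excess (graft 2 1 (z, z')) ≤ gap z 1 + failed z * excess z' := by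
  rw [hz'.excess_graft, failed]
  have := hz.gap_pos 1
  by_cases h : transfer z 0 ≤ gap z 1
  · simp [h, completed]
  · simp [h, completed]

lemma IsGood.graft {z z' : Input} (hz : IsGood z) (hz' : IsGood z') : IsGood (graft 2 1 (z, z')) := by
  refine ⟨fun n => ?_, fun n => ?_, fun r => ?_, fun m => ?_⟩
  · rw [gap_graft]; split_ifs; exacts [hz.gap_pos n, hz'.gap_pos _]
  · rw [transfer_graft]; split_ifs; exacts [hz.transfer_nonneg n, hz'.transfer_nonneg _]
  · obtain ⟨n, hn⟩ := hz'.exists_arrival (r + gap z' 0)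
    refine ⟨n + 1, ?_⟩
    rw [arrival_graft_succ]
    linarith [hz.gap_pos 0, hz.gap_pos 1]
  · obtain ⟨j, hj, hj'⟩ := hz'.exists_success m
    refine ⟨j + 1, by omega, ?_⟩
    rw [gap_graft, transfer_graft, if_neg (by omega), if_neg (by omega)]
    exact hj'

lemma ae_prod_isGood (hlam : 0 < lam) (hτ : ∀ᵐ t ∂τ, 0 ≤ t) :
    ∀ᵐ y ∂((inputLaw (expMeasure lam) τ).prod (inputLaw (expMeasure lam) τ)),
      IsGood y.1 ∧ IsGood y.2 := by
  have := isProbabilityMeasure_expMeasure hlam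
  exact (Measure.quasiMeasurePreserving_fst.ae (ae_isGood hlam hτ)).and
    (Measure.quasiMeasurePreserving_snd.ae (ae_isGood hlam hτ))

lemma min_excess_bounds {z : Input} (hz : IsGood z) {M : ℝ} (hM : 0 ≤ M) :
    0 ≤ min (excess z) M ∧ min (excess z) M ≤ M :=
  ⟨le_min hz.excess_nonneg hM, min_le_right _ _⟩

lemma integrable_min_excess_pow (hlam : 0 < lam) (hτ : ∀ᵐ t ∂τ, 0 ≤ t) {M : ℝ} (hM : 0 ≤ M)
    (k : ℕ) : Integrable (fun z => min (excess z) M ^ k) (inputLaw (expMeasure lam) τ) := by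
  have := isProbabilityMeasure_expMeasure hlam
  refine Integrable.of_bound (C := M ^ k)
    ((measurable_excess.min measurable_const).pow_const k).aestronglyMeasurable ?_
  filter_upwards [ae_isGood hlam hτ] with z hz
  obtain ⟨h1, h2⟩ := min_excess_bounds hz hM
  rw [Real.norm_eq_abs, abs_of_nonneg (pow_nonneg h1 k)]
  exact pow_le_pow_left₀ h1 h2 k

lemma min_excess_graft_le {z z' : Input} (hz : IsGood z) (hz' : IsGood z') (M : ℝ) :
    min (excess (graft 2 1 (z, z'))) M ≤ gap z 1 + failed z * min (excess z') M := by
  have h1 := hz.excess_graft_le hz'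
  have h2 := hz.gap_pos 1
  have h3 := failed_nonneg z
  have h4 := failed_le_one z
  rcases le_total (excess z') M with h | h
  · rw [min_eq_left h]
    exact (min_le_left _ _).trans h1
  · rw [min_eq_right h]
    by_cases hf : transfer z 0 ≤ gap z 1
    · have : failed z = 0 := by simp [failed, completed, hf]
      rw [this] at h1 ⊢
      exact (min_le_left _ _).trans (by linarith)
    · have : failed z = 1 := by simp [failed, completed, hf]
      rw [this]
      exact (min_le_right _ _).trans (by linarith)

/-- The first moment of the excess is bounded before it is known to be finite: a finite truncation
allows the terms of the recursion for the first attempt to be moved across the inequality. -/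
lemma integral_min_excess_le (hlam : 0 < lam) (hτ : ∀ᵐ t ∂τ, 0 ≤ t) {M : ℝ} (hM : 0 ≤ M) :
    successProb lam τ * ∫ z, min (excess z) M ∂(inputLaw (expMeasure lam) τ) ≤ 1 / lam := by
  have := isProbabilityMeasure_expMeasure hlam
  have i1 : Integrable (fun z => min (excess z) M) (inputLaw (expMeasure lam) τ) := by
    simpa using integrable_min_excess_pow hlam hτ hM 1
  have hmeas : Measurable fun z => min (excess z) M := measurable_excess.min measurable_const
  obtain ⟨j1, j2⟩ := integral_add_mul_prod (integrable_gap (τ := τ) hlam 1)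
    (integrable_failed (τ := τ) hlam) i1
    (integrable_const (0 : ℝ)) (integrable_const (0 : ℝ)) (μ := inputLaw (expMeasure lam) τ)
    (ν := inputLaw (expMeasure lam) τ)
  rw [integral_gap hlam, integral_failed hlam hτ] at j2
  have key : ∫ z, min (excess z) M ∂(inputLaw (expMeasure lam) τ)
      ≤ 1 / lam + (1 - successProb lam τ) * ∫ z, min (excess z) M ∂(inputLaw (expMeasure lam) τ) := by
    conv_lhs => rw [integral_eq_integral_graft hlam hmeas]
    simp only [integral_zero, mul_zero, add_zero] at j1 j2
    rw [← j2]
    refine integral_mono_ae ((measurePreserving_graft one_le_two).integrable_comp_of_integrable i1)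
      j1 ?_
    filter_upwards [ae_prod_isGood hlam hτ] with y hy
    exact min_excess_graft_le hy.1 hy.2 M
  linarith

lemma integral_min_excess_sq_le (hlam : 0 < lam) (hτ : ∀ᵐ t ∂τ, 0 ≤ t) {M : ℝ} (hM : 0 ≤ M) :
    successProb lam τ * ∫ z, min (excess z) M ^ 2 ∂(inputLaw (expMeasure lam) τ)
      ≤ 2 / lam ^ 2 + 2 / lam * (1 / (lam * successProb lam τ)) := by
  have := isProbabilityMeasure_expMeasure hlam
  have hγ := successProb_pos hlam hτ
  have i1 : Integrable (fun z => min (excess z) M) (inputLaw (expMeasure lam) τ) := by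
    simpa using integrable_min_excess_pow hlam hτ hM 1
  have i2 := integrable_min_excess_pow hlam hτ hM 2
  have hmeas : Measurable fun z => min (excess z) M ^ 2 :=
    (measurable_excess.min measurable_const).pow_const 2
  obtain ⟨j1, j2⟩ := integral_add_mul_prod (integrable_gap_sq (τ := τ) hlam 1)
    ((integrable_gap (τ := τ) hlam 1).const_mul 2) i1
    (integrable_failed (τ := τ) hlam) i2 (μ := inputLaw (expMeasure lam) τ)
    (ν := inputLaw (expMeasure lam) τ)
  rw [integral_gap_sq hlam, integral_failed hlam hτ, integral_const_mul, integral_gap hlam] at j2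
  have hle := integral_min_excess_le hlam hτ hM
  have hle' : ∫ z, min (excess z) M ∂(inputLaw (expMeasure lam) τ)
      ≤ 1 / (lam * successProb lam τ) := by
    rw [le_div_iff₀ (by positivity)]
    rw [le_div_iff₀ hlam] at hle
    linarith
  have key : ∫ z, min (excess z) M ^ 2 ∂(inputLaw (expMeasure lam) τ)
      ≤ 2 / lam ^ 2 + 2 * (1 / lam) * ∫ z, min (excess z) M ∂(inputLaw (expMeasure lam) τ)
        + (1 - successProb lam τ) * ∫ z, min (excess z) M ^ 2 ∂(inputLaw (expMeasure lam) τ) := by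
    conv_lhs => rw [integral_eq_integral_graft hlam hmeas]
    rw [← j2]
    refine integral_mono_ae ((measurePreserving_graft one_le_two).integrable_comp_of_integrable i2)
      j1 ?_
    filter_upwards [ae_prod_isGood hlam hτ] with y hy
    have h1 := min_excess_graft_le hy.1 hy.2 M
    have h0 := (min_excess_bounds (hy.1.graft hy.2) hM).1
    have h2 := failed_nonneg y.1
    have h3 := failed_le_one y.1
    have h4 := hy.1.gap_pos 1
    have h5 := (min_excess_bounds hy.2 hM).1
    have h6 : min (excess (graft 2 1 y)) M ^ 2
        ≤ (gap y.1 1 + failed y.1 * min (excess y.2) M) ^ 2 := pow_le_pow_left₀ h0 h1 2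
    have h7 : failed y.1 ^ 2 ≤ failed y.1 := by nlinarith
    have h8 : failed y.1 ^ 2 * min (excess y.2) M ^ 2 ≤ failed y.1 * min (excess y.2) M ^ 2 :=
      mul_le_mul_of_nonneg_right h7 (sq_nonneg _)
    have h9 : gap y.1 1 * (failed y.1 * min (excess y.2) M) ≤ gap y.1 1 * min (excess y.2) M :=
      mul_le_mul_of_nonneg_left (mul_le_of_le_one_left h5 h3) h4.le
    nlinarith
  have : 2 * (1 / lam) * ∫ z, min (excess z) M ∂(inputLaw (expMeasure lam) τ)
      ≤ 2 / lam * (1 / (lam * successProb lam τ)) := by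
    rw [mul_one_div]
    exact mul_le_mul_of_nonneg_left hle' (by positivity)
  linarith

/-- A DOP cycle has a finite second moment, by a bound for the truncated excess that does not depend
on the truncation. -/
lemma integrable_excess_sq (hlam : 0 < lam) (hτ : ∀ᵐ t ∂τ, 0 ≤ t) :
    Integrable (fun z => excess z ^ 2) (inputLaw (expMeasure lam) τ) := by
  have := isProbabilityMeasure_expMeasure hlam
  have hγ := successProb_pos hlam hτ
  set K : ℝ := (2 / lam ^ 2 + 2 / lam * (1 / (lam * successProb lam τ))) / successProb lam τ
  refine ⟨(measurable_excess.pow_const 2).aestronglyMeasurable, ?_⟩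
  have hlim : ∀ z, Tendsto (fun n : ℕ => min (excess z) n ^ 2) atTop (𝓝 (excess z ^ 2)) := by
    intro z
    refine tendsto_const_nhds.congr' ?_
    obtain ⟨n₀, hn₀⟩ := exists_nat_ge (excess z)
    filter_upwards [eventually_ge_atTop n₀] with n hn
    rw [min_eq_left (hn₀.trans (by exact_mod_cast hn))]
  have hle : ∫⁻ z, ‖excess z ^ 2‖ₑ ∂(inputLaw (expMeasure lam) τ) ≤ ENNReal.ofReal K := by
    calc ∫⁻ z, ‖excess z ^ 2‖ₑ ∂(inputLaw (expMeasure lam) τ)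
        = ∫⁻ z, liminf (fun n : ℕ => ‖min (excess z) n ^ 2‖ₑ) atTop
            ∂(inputLaw (expMeasure lam) τ) :=
          lintegral_congr fun z => ((hlim z).enorm.liminf_eq).symm
      _ ≤ liminf (fun n : ℕ => ∫⁻ z, ‖min (excess z) n ^ 2‖ₑ ∂(inputLaw (expMeasure lam) τ)) atTop :=
          lintegral_liminf_le fun n =>
            ((measurable_excess.min measurable_const).pow_const 2).enorm
      _ ≤ ENNReal.ofReal K := by
          refine liminf_le_of_le (by isBoundedDefault) fun b hb => ?_
          obtain ⟨n, hn⟩ := hb.exists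
          refine hn.trans ?_
          rw [← ofReal_integral_norm_eq_lintegral_enorm
            (integrable_min_excess_pow hlam hτ (Nat.cast_nonneg n) 2)]
          refine ENNReal.ofReal_le_ofReal ?_
          simp only [norm_pow, Real.norm_eq_abs, sq_abs]
          rw [le_div_iff₀ hγ, mul_comm]
          exact integral_min_excess_sq_le hlam hτ (Nat.cast_nonneg n)
  exact hle.trans_lt ENNReal.ofReal_lt_top

lemma integrable_excess (hlam : 0 < lam) (hτ : ∀ᵐ t ∂τ, 0 ≤ t) :
    Integrable excess (inputLaw (expMeasure lam) τ) := by
  have := isProbabilityMeasure_expMeasure hlam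
  exact ((memLp_two_iff_integrable_sq measurable_excess.aestronglyMeasurable).2
    (integrable_excess_sq hlam hτ)).integrable one_le_two

lemma integral_compl_completed {τ : Measure ℝ} (hlam : 0 < lam) {f : ℝ × ℝ → ℝ}
    (hint : Integrable f (τ.prod (expMeasure lam))) :
    ∫ y, completedᶜ.indicator f y ∂(τ.prod (expMeasure lam))
      = ∫ y, f y ∂(τ.prod (expMeasure lam))
        - ∫ y, completed.indicator f y ∂(τ.prod (expMeasure lam)) := by
  have := isProbabilityMeasure_expMeasure hlam
  rw [integral_indicator measurableSet_completed.compl, integral_indicator measurableSet_completed,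
    setIntegral_compl measurableSet_completed hint]

lemma integrable_fst {τ : Measure ℝ} (hlam : 0 < lam) {f : ℝ → ℝ} (hint : Integrable f τ) :
    Integrable (fun y => f y.1) (τ.prod (expMeasure lam)) := by
  have := isProbabilityMeasure_expMeasure hlam
  exact hint.comp_fst _

lemma integrable_snd_pow (hlam : 0 < lam) (k : ℕ) :
    Integrable (fun y : ℝ × ℝ => y.2 ^ k) (τ.prod (expMeasure lam)) := by
  have := isProbabilityMeasure_expMeasure hlam
  exact (integrable_pow_expMeasure hlam k).comp_snd _

lemma integral_snd_pow (hlam : 0 < lam) (k : ℕ) :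
    ∫ y : ℝ × ℝ, y.2 ^ k ∂(τ.prod (expMeasure lam)) = k.factorial / lam ^ k := by
  have := isProbabilityMeasure_expMeasure hlam
  have h := integral_prod_mul (μ := τ) (ν := expMeasure lam) (fun _ => (1 : ℝ)) fun x => x ^ k
  simp only [one_mul, integral_const, probReal_univ, smul_eq_mul] at h
  rw [h, integral_pow_expMeasure hlam]

/-- The mean of the age at the end of a DOP cycle is `E[T e^{-λT}] / γ`. -/
lemma integral_age_dop (hlam : 0 < lam) (hτ : ∀ᵐ t ∂τ, 0 ≤ t) (hint : Integrable (fun t => t) τ) :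
    Integrable (fun z => transfer z (cyclePacket true z)) (inputLaw (expMeasure lam) τ) ∧
    successProb lam τ * ∫ z, transfer z (cyclePacket true z) ∂(inputLaw (expMeasure lam) τ)
      = ∫ t, Real.exp (-lam * t) * t ∂τ := by
  have := isProbabilityMeasure_expMeasure hlam
  have i1 : Integrable (fun z => transfer z (cyclePacket true z))
      (inputLaw (expMeasure lam) τ) := by
    refine (integrable_excess hlam hτ).mono' (measurable_cycleAge true).aestronglyMeasurable ?_
    filter_upwards [ae_isGood hlam hτ] with z hz
    have h1 := arrival_mono hz.gap_pos (Nat.zero_le (cyclePacket true z))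
    have h2 : arrival (gap z) 0 = gap z 0 := by simp [arrival]
    rw [Real.norm_eq_abs, abs_of_nonneg (hz.transfer_nonneg _), excess, cycleLength]
    linarith
  refine ⟨i1, ?_⟩
  have hf : Integrable (completed.indicator Prod.fst) (τ.prod (expMeasure lam)) :=
    (integrable_fst hlam hint).indicator measurableSet_completed
  obtain ⟨j1, j2⟩ := integral_add_mul_prod (integrable_comp_pair hlam hf)
    (integrable_failed (τ := τ) hlam) i1
    (integrable_const (0 : ℝ)) (integrable_const (0 : ℝ)) (μ := inputLaw (expMeasure lam) τ)
    (ν := inputLaw (expMeasure lam) τ)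
  have hβ := integral_completed_fst_pow hlam hτ 1 (by simpa using hint)
  simp only [pow_one] at hβ
  rw [integral_comp_pair hlam (measurable_fst.indicator measurableSet_completed),
    integral_failed hlam hτ] at j2
  have key : ∫ z, transfer z (cyclePacket true z) ∂(inputLaw (expMeasure lam) τ)
      = ∫ t, Real.exp (-lam * t) * t ∂τ + (1 - successProb lam τ)
        * ∫ z, transfer z (cyclePacket true z) ∂(inputLaw (expMeasure lam) τ) := by
    conv_lhs => rw [integral_eq_integral_graft hlam (measurable_cycleAge true)]
    simp only [integral_zero, mul_zero, add_zero] at j2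
    rw [← hβ]
    refine Eq.trans (integral_congr_ae ?_) j2
    filter_upwards [ae_prod_isGood hlam hτ] with y hy
    exact hy.2.cycleAge_graft y.1
  linarith

/-- Wald's identity: the excess is a sum of gaps and a last transfer time over attempts of which a
fraction `γ` succeeds. -/
lemma integral_excess (hlam : 0 < lam) (hτ : ∀ᵐ t ∂τ, 0 ≤ t) (hint : Integrable (fun t => t) τ) :
    successProb lam τ * ∫ z, excess z ∂(inputLaw (expMeasure lam) τ)
      = (1 - successProb lam τ) / lam := by
  have := isProbabilityMeasure_expMeasure hlam
  have i1 := integrable_excess hlam hτ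
  have hf : Integrable (completed.indicator Prod.fst) (τ.prod (expMeasure lam)) :=
    (integrable_fst hlam hint).indicator measurableSet_completed
  have hs : Integrable (Prod.snd : ℝ × ℝ → ℝ) (τ.prod (expMeasure lam)) := by
    simpa using integrable_snd_pow (τ := τ) hlam 1
  have hs' : Integrable (completedᶜ.indicator Prod.snd) (τ.prod (expMeasure lam)) :=
    hs.indicator measurableSet_completed.compl
  obtain ⟨j1, j2⟩ := integral_add_mul_prod
    ((integrable_comp_pair hlam hf).add (integrable_comp_pair hlam hs'))
    (integrable_failed (τ := τ) hlam) i1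
    (integrable_const (0 : ℝ)) (integrable_const (0 : ℝ)) (μ := inputLaw (expMeasure lam) τ)
    (ν := inputLaw (expMeasure lam) τ)
  have hβ := integral_completed_fst_pow hlam hτ 1 (by simpa using hint)
  simp only [pow_one] at hβ
  have hm : ∫ y : ℝ × ℝ, y.2 ∂(τ.prod (expMeasure lam)) = 1 / lam := by
    simpa using integral_snd_pow (τ := τ) hlam 1
  have hβ' := integral_compl_completed hlam hs
  rw [integral_completed_snd hlam hτ hint, hm] at hβ'
  rw [integral_add' (integrable_comp_pair hlam hf) (integrable_comp_pair hlam hs'),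
    integral_comp_pair hlam (measurable_fst.indicator measurableSet_completed),
    integral_comp_pair hlam (measurable_snd.indicator measurableSet_completed.compl),
    integral_failed hlam hτ, hβ', hβ] at j2
  have key : ∫ z, excess z ∂(inputLaw (expMeasure lam) τ)
      = ∫ t, Real.exp (-lam * t) * t ∂τ
        + (1 / lam - (∫ t, Real.exp (-lam * t) * t ∂τ + successProb lam τ / lam))
        + (1 - successProb lam τ) * ∫ z, excess z ∂(inputLaw (expMeasure lam) τ) := by
    conv_lhs => rw [integral_eq_integral_graft hlam measurable_excess]
    simp only [integral_zero, mul_zero, add_zero] at j2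
    refine Eq.trans (integral_congr_ae ?_) j2
    filter_upwards [ae_prod_isGood hlam hτ] with y hy
    exact hy.2.excess_graft y.1
  rw [sub_div]
  linarith

/-- The square of the recursion in `IsGood.excess_graft`. The second moment of the transfer time
cancels between successful and failed attempts. -/
lemma integral_excess_sq (hlam : 0 < lam) (hτ : ∀ᵐ t ∂τ, 0 ≤ t) (hint : Integrable (fun t => t) τ)
    (hint2 : Integrable (fun t => t ^ 2) τ) :
    successProb lam τ * ∫ z, excess z ^ 2 ∂(inputLaw (expMeasure lam) τ)
      = 2 / lam ^ 2 - (∫ t, Real.exp (-lam * t) * t ∂τ) * (2 / lam)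
        - successProb lam τ * (2 / lam ^ 2)
        + 2 * (1 / lam - (∫ t, Real.exp (-lam * t) * t ∂τ + successProb lam τ / lam))
          * ∫ z, excess z ∂(inputLaw (expMeasure lam) τ) := by
  have := isProbabilityMeasure_expMeasure hlam
  have i1 := integrable_excess hlam hτ
  have i2 := integrable_excess_sq hlam hτ
  have hs : Integrable (Prod.snd : ℝ × ℝ → ℝ) (τ.prod (expMeasure lam)) := by
    simpa using integrable_snd_pow (τ := τ) hlam 1
  have hs' : Integrable (completedᶜ.indicator Prod.snd) (τ.prod (expMeasure lam)) :=
    hs.indicator measurableSet_completed.compl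
  have hs2 := integrable_snd_pow (τ := τ) hlam 2
  have hs2' : Integrable (completedᶜ.indicator fun y => y.2 ^ 2) (τ.prod (expMeasure lam)) :=
    hs2.indicator measurableSet_completed.compl
  have hf2 : Integrable (completed.indicator fun y => y.1 ^ 2) (τ.prod (expMeasure lam)) :=
    (integrable_fst hlam hint2).indicator measurableSet_completed
  obtain ⟨j1, j2⟩ := integral_add_mul_prod
    ((integrable_comp_pair hlam hf2).add (integrable_comp_pair hlam hs2'))
    ((integrable_comp_pair hlam hs').const_mul 2) i1
    (integrable_failed (τ := τ) hlam) i2 (μ := inputLaw (expMeasure lam) τ)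
    (ν := inputLaw (expMeasure lam) τ)
  have hβ := integral_completed_fst_pow hlam hτ 2 hint2
  have hm : ∫ y : ℝ × ℝ, y.2 ∂(τ.prod (expMeasure lam)) = 1 / lam := by
    simpa using integral_snd_pow (τ := τ) hlam 1
  have hm2 : ∫ y : ℝ × ℝ, y.2 ^ 2 ∂(τ.prod (expMeasure lam)) = 2 / lam ^ 2 := by
    simpa using integral_snd_pow (τ := τ) hlam 2
  have hβ' := integral_compl_completed hlam hs
  rw [integral_completed_snd hlam hτ hint, hm] at hβ'
  have hβ2 := integral_compl_completed hlam hs2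
  rw [integral_completed_snd_sq hlam hτ hint hint2, hm2] at hβ2
  rw [integral_add' (integrable_comp_pair hlam hf2) (integrable_comp_pair hlam hs2'),
    integral_comp_pair hlam ((measurable_fst.pow_const 2).indicator measurableSet_completed),
    integral_comp_pair hlam ((measurable_snd.pow_const 2).indicator measurableSet_completed.compl),
    integral_const_mul,
    integral_comp_pair hlam (measurable_snd.indicator measurableSet_completed.compl),
    integral_failed hlam hτ, hβ', hβ, hβ2] at j2
  have hae : ∀ᵐ y ∂((inputLaw (expMeasure lam) τ).prod (inputLaw (expMeasure lam) τ)),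
      excess (graft 2 1 y) ^ 2
        = completed.indicator (fun y => y.1 ^ 2) (transfer y.1 0, gap y.1 1)
          + completedᶜ.indicator (fun y => y.2 ^ 2) (transfer y.1 0, gap y.1 1)
          + 2 * completedᶜ.indicator Prod.snd (transfer y.1 0, gap y.1 1) * excess y.2
          + failed y.1 * excess y.2 ^ 2 := by
    filter_upwards [ae_prod_isGood hlam hτ] with y hy
    have hy' := hy.2.excess_graft y.1
    simp only [Prod.mk.eta] at hy'
    rw [hy']
    by_cases h : transfer y.1 0 ≤ gap y.1 1
    · simp [h, completed, failed]
    · simp [h, completed, failed]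
      ring
  have key := (integral_eq_integral_graft hlam (measurable_excess.pow_const 2)).trans
    ((integral_congr_ae hae).trans j2)
  linarith

lemma excess_update (z : Input) (y : ℝ) :
    excess (Function.update z (Sum.inl 0) y) = excess z := by
  have ht : ∀ n, transfer (Function.update z (Sum.inl 0) y) n = transfer z n := fun n => by
    simp [transfer]
  have hg : ∀ n, gap (Function.update z (Sum.inl 0) y) (n + 1) = gap z (n + 1) := fun n => by
    simp [gap]
  have hp : cyclePacket true (Function.update z (Sum.inl 0) y) = cyclePacket true z := by
    simp only [cyclePacket, firstUninterrupted, ht, hg]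
  simp only [excess, cycleLength, hp, arrival, ht, Finset.sum_range_succ', hg]
  ring

/-- The two first moments of the length of a DOP cycle: the waiting time for the first arrival is
independent of the rest of the cycle. -/
lemma integral_cycleLength_dop (hlam : 0 < lam) (hτ : ∀ᵐ t ∂τ, 0 ≤ t) :
    Integrable (fun z => cycleLength true z ^ 2) (inputLaw (expMeasure lam) τ) ∧
    ∫ z, cycleLength true z ∂(inputLaw (expMeasure lam) τ)
      = 1 / lam + ∫ z, excess z ∂(inputLaw (expMeasure lam) τ) ∧
    ∫ z, cycleLength true z ^ 2 ∂(inputLaw (expMeasure lam) τ)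
      = 2 / lam ^ 2 + 2 * (1 / lam) * ∫ z, excess z ∂(inputLaw (expMeasure lam) τ)
        + ∫ z, excess z ^ 2 ∂(inputLaw (expMeasure lam) τ) := by
  have := isProbabilityMeasure_expMeasure hlam
  have i1 := integrable_excess hlam hτ
  have i2 := integrable_excess_sq hlam hτ
  have hL : ∀ z, cycleLength true z = gap z 0 + excess z := fun z => by rw [excess]; ring
  have g1 := integrable_gap (τ := τ) hlam 0
  have g2 := integrable_gap_sq (τ := τ) hlam 0
  have hprod := (g1.mul_prod i1).swap
  have hup := measurePreserving_update_gap (ε := expMeasure lam) (τ := τ)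
  have hm : Measurable fun z => gap z 0 * excess z := (measurable_gap 0).mul measurable_excess
  have hcomp : ∀ y : Input × Input, gap (Function.update y.1 (Sum.inl 0) (gap y.2 0)) 0
      * excess (Function.update y.1 (Sum.inl 0) (gap y.2 0)) = gap y.2 0 * excess y.1 := by
    intro y
    rw [excess_update]
    simp [gap]
  have i3 : Integrable (fun z => gap z 0 * excess z) (inputLaw (expMeasure lam) τ) := by
    rw [← hup.integrable_comp hm.aestronglyMeasurable]
    refine hprod.congr (Eventually.of_forall fun y => ?_)
    exact (hcomp y).symm
  have e3 : ∫ z, gap z 0 * excess z ∂(inputLaw (expMeasure lam) τ)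
      = 1 / lam * ∫ z, excess z ∂(inputLaw (expMeasure lam) τ) := by
    rw [← integral_comp_of_measurePreserving hup hm]
    simp only [hcomp]
    have := integral_prod_mul (μ := inputLaw (expMeasure lam) τ) (ν := inputLaw (expMeasure lam) τ)
      (fun z => excess z) fun z => gap z 0
    simp only [mul_comm (gap _ 0)]
    rw [this, integral_gap hlam, mul_comm]
  have hsq : ∀ z, cycleLength true z ^ 2 = gap z 0 ^ 2 + 2 * (gap z 0 * excess z) + excess z ^ 2 :=
    fun z => by rw [hL]; ring
  have i4 : Integrable (fun z => gap z 0 ^ 2 + 2 * (gap z 0 * excess z))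
      (inputLaw (expMeasure lam) τ) := g2.add (i3.const_mul 2)
  refine ⟨?_, ?_, ?_⟩
  · simp only [hsq]
    exact i4.add i2
  · simp only [hL]
    rw [integral_add g1 i1, integral_gap hlam]
  · simp only [hsq]
    rw [integral_add i4 i2, integral_add g2 (i3.const_mul 2), integral_const_mul, e3,
      integral_gap_sq hlam]
    ring

lemma integral_cycleLength_dnp (hlam : 0 < lam) (hint : Integrable (fun t => t) τ)
    (hint2 : Integrable (fun t => t ^ 2) τ) :
    Integrable (fun z => cycleLength false z ^ 2) (inputLaw (expMeasure lam) τ) ∧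
    ∫ z, cycleLength false z ∂(inputLaw (expMeasure lam) τ) = 1 / lam + ∫ t, t ∂τ ∧
    ∫ z, cycleLength false z ^ 2 ∂(inputLaw (expMeasure lam) τ)
      = 2 / lam ^ 2 + 2 * (1 / lam) * ∫ t, t ∂τ + ∫ t, t ^ 2 ∂τ := by
  have := isProbabilityMeasure_expMeasure hlam
  have hL : ∀ z, cycleLength false z = gap z 0 + transfer z 0 := fun z => by
    simp [cycleLength, cyclePacket, arrival]
  have g1 := integrable_gap (τ := τ) hlam 0
  have g2 := integrable_gap_sq (τ := τ) hlam 0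
  have hmp := measurePreserving_transfer (ε := expMeasure lam) (τ := τ) 0
  have t1 : Integrable (fun z => transfer z 0) (inputLaw (expMeasure lam) τ) :=
    hmp.integrable_comp_of_integrable hint
  have t2 : Integrable (fun z => transfer z 0 ^ 2) (inputLaw (expMeasure lam) τ) :=
    hmp.integrable_comp_of_integrable hint2
  have e1 := integral_comp_of_measurePreserving hmp (g := fun t => t) measurable_id
  have e2 := integral_comp_of_measurePreserving hmp (g := fun t => t ^ 2)
    (measurable_id.pow_const 2)
  have hmp2 := measurePreserving_gap_transfer (ε := expMeasure lam) (τ := τ) 0 0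
  have x1 : Integrable (fun x => x) (expMeasure lam) := by
    simpa using integrable_pow_expMeasure hlam 1
  have x2 : ∫ x, x ∂(expMeasure lam) = 1 / lam := by simpa using integral_pow_expMeasure hlam 1
  have i3 : Integrable (fun z => gap z 0 * transfer z 0) (inputLaw (expMeasure lam) τ) :=
    hmp2.integrable_comp_of_integrable (x1.mul_prod hint)
  have e3 : ∫ z, gap z 0 * transfer z 0 ∂(inputLaw (expMeasure lam) τ) = 1 / lam * ∫ t, t ∂τ := by
    rw [integral_comp_of_measurePreserving hmp2 (g := fun y => y.1 * y.2)
      (measurable_fst.mul measurable_snd), ← x2]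
    exact integral_prod_mul (fun x => x) fun t => t
  have hsq : ∀ z, cycleLength false z ^ 2
      = gap z 0 ^ 2 + 2 * (gap z 0 * transfer z 0) + transfer z 0 ^ 2 :=
    fun z => by rw [hL]; ring
  have i4 : Integrable (fun z => gap z 0 ^ 2 + 2 * (gap z 0 * transfer z 0))
      (inputLaw (expMeasure lam) τ) := g2.add (i3.const_mul 2)
  refine ⟨?_, ?_, ?_⟩
  · simp only [hsq]
    exact i4.add t2
  · simp only [hL]
    rw [integral_add g1 t1, integral_gap hlam, e1]
  · simp only [hsq]
    rw [integral_add i4 t2, integral_add g2 (i3.const_mul 2), integral_const_mul, e3,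
      integral_gap_sq hlam, e2]
    ring

end CycleMoments

/-! ### The average age as a function of the policy -/

section AverageAge

variable {Q : Bool → Measure (ℝ × ℝ)} {lab : ℝ × ℝ → Bool}

/-- The area under the age in a cycle with data `y.2` that follows a cycle with data `y.1`: the age
starts from the second component of `y.1` and grows at unit rate. -/
def ageArea (y : (ℝ × ℝ) × (ℝ × ℝ)) : ℝ := y.1.2 * y.2.1 + y.2.1 ^ 2 / 2

lemma measurable_ageArea : Measurable ageArea := by
  unfold ageArea
  fun_prop

/-- The ratio of the mean area under the age in a cycle to the mean length of a cycle, in the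
stationary regime. -/
def averageAge (Q : Bool → Measure (ℝ × ℝ)) (lab : ℝ × ℝ → Bool) : ℝ :=
  stationaryMean (pairLaw Q lab) (fun c => lab c.2) ageArea / stationaryMean Q lab Prod.fst

lemma integral_ageArea [∀ b, IsProbabilityMeasure (Q b)] (hlab : Measurable lab)
    (h1 : ∀ b, Integrable (fun c => c.1) (Q b)) (h2 : ∀ b, Integrable (fun c => c.1 ^ 2) (Q b))
    (h3 : ∀ b, Integrable (fun c => c.2) (Q b)) (b : Bool) :
    Integrable ageArea (pairLaw Q lab b) ∧
    ∫ y, ageArea y ∂(pairLaw Q lab b)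
      = (∫ c in lab ⁻¹' {true}, c.2 ∂(Q b)) * ∫ c, c.1 ∂(Q true)
        + (∫ c in lab ⁻¹' {false}, c.2 ∂(Q b)) * ∫ c, c.1 ∂(Q false)
        + (Q b).real (lab ⁻¹' {true}) * ((∫ c, c.1 ^ 2 ∂(Q true)) / 2)
        + (1 - (Q b).real (lab ⁻¹' {true})) * ((∫ c, c.1 ^ 2 ∂(Q false)) / 2) := by
  have part : ∀ a : Bool,
      Integrable ageArea (((Q b).restrict (lab ⁻¹' {a})).prod (Q a)) ∧
      ∫ y, ageArea y ∂(((Q b).restrict (lab ⁻¹' {a})).prod (Q a))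
        = (∫ c in lab ⁻¹' {a}, c.2 ∂(Q b)) * ∫ c, c.1 ∂(Q a)
          + (Q b).real (lab ⁻¹' {a}) * ((∫ c, c.1 ^ 2 ∂(Q a)) / 2) := by
    intro a
    have i1 : Integrable (fun y : (ℝ × ℝ) × (ℝ × ℝ) => y.1.2 * y.2.1)
        (((Q b).restrict (lab ⁻¹' {a})).prod (Q a)) := ((h3 b).restrict).mul_prod (h1 a)
    have i2 : Integrable (fun y : (ℝ × ℝ) × (ℝ × ℝ) => (1 : ℝ) * (y.2.1 ^ 2 / 2))
        (((Q b).restrict (lab ⁻¹' {a})).prod (Q a)) :=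
      (integrable_const (μ := (Q b).restrict (lab ⁻¹' {a})) (1 : ℝ)).mul_prod ((h2 a).div_const 2)
    have e : ageArea = fun y => y.1.2 * y.2.1 + (1 : ℝ) * (y.2.1 ^ 2 / 2) := by
      funext y
      rw [ageArea, one_mul]
    rw [e]
    refine ⟨i1.add i2, ?_⟩
    rw [integral_add i1 i2,
      integral_prod_mul (μ := (Q b).restrict (lab ⁻¹' {a})) (ν := Q a)
        (fun c : ℝ × ℝ => c.2) (fun c : ℝ × ℝ => c.1),
      integral_prod_mul (μ := (Q b).restrict (lab ⁻¹' {a})) (ν := Q a)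
        (fun _ : ℝ × ℝ => (1 : ℝ)) (fun c : ℝ × ℝ => c.1 ^ 2 / 2), integral_div]
    simp
  have hf : (Q b).real (lab ⁻¹' {false}) = 1 - (Q b).real (lab ⁻¹' {true}) := by
    have : lab ⁻¹' {false} = (lab ⁻¹' {true})ᶜ := by ext c; simp
    rw [this, probReal_compl_eq_one_sub (hlab (measurableSet_singleton _))]
  refine ⟨(part true).1.add_measure (part false).1, ?_⟩
  rw [pairLaw, integral_add_measure (part true).1 (part false).1, (part true).2, (part false).2, hf]
  ring

lemma setIntegral_lab_add (hlab : Measurable lab) {ρ : Measure (ℝ × ℝ)} {g : ℝ × ℝ → ℝ}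
    (hg : Integrable g ρ) :
    ∫ c in lab ⁻¹' {true}, g c ∂ρ + ∫ c in lab ⁻¹' {false}, g c ∂ρ = ∫ c, g c ∂ρ := by
  rw [← integral_add_measure hg.restrict hg.restrict, restrict_lab_add ρ hlab]

/-- The average age in terms of the stationary probability `p` of DOP. The final age
of a cycle contributes to the area of the next cycle in proportion to the mean length of the latter,
which is that of a DOP cycle up to a correction for the cases in which DNP comes next. -/
lemma averageAge_eq [∀ b, IsProbabilityMeasure (Q b)] (hlab : Measurable lab)
    (hq : |(Q true).real (lab ⁻¹' {true}) - (Q false).real (lab ⁻¹' {true})| < 1)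
    (h1 : ∀ b, Integrable (fun c => c.1) (Q b)) (h2 : ∀ b, Integrable (fun c => c.1 ^ 2) (Q b))
    (h3 : ∀ b, Integrable (fun c => c.2) (Q b)) {p : ℝ}
    (hp : p = stationaryProb fun b => (Q b).real (lab ⁻¹' {true})) :
    averageAge Q lab
      = ((p * ∫ c, c.2 ∂(Q true) + (1 - p) * ∫ c, c.2 ∂(Q false)) * ∫ c, c.1 ∂(Q true)
          + (p * ∫ c in lab ⁻¹' {false}, c.2 ∂(Q true)
            + (1 - p) * ∫ c in lab ⁻¹' {false}, c.2 ∂(Q false))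
            * (∫ c, c.1 ∂(Q false) - ∫ c, c.1 ∂(Q true))
          + p * ((∫ c, c.1 ^ 2 ∂(Q true)) / 2) + (1 - p) * ((∫ c, c.1 ^ 2 ∂(Q false)) / 2))
        / (p * ∫ c, c.1 ∂(Q true) + (1 - p) * ∫ c, c.1 ∂(Q false)) := by
  have hbal : p * (Q true).real (lab ⁻¹' {true}) + (1 - p) * (Q false).real (lab ⁻¹' {true})
      = p := by
    have hne : 1 - ((Q true).real (lab ⁻¹' {true}) - (Q false).real (lab ⁻¹' {true})) ≠ 0 := by
      linarith [(abs_lt.1 hq).2]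
    rw [hp, stationaryProb]
    field_simp
    ring
  unfold averageAge stationaryMean
  rw [stationaryProb_pairLaw hlab (abs_lt.1 hq).1, ← hp, (integral_ageArea hlab h1 h2 h3 true).2,
    (integral_ageArea hlab h1 h2 h3 false).2, ← setIntegral_lab_add hlab (h3 true),
    ← setIntegral_lab_add hlab (h3 false)]
  congr 1
  linear_combination ((∫ c, c.1 ^ 2 ∂(Q true)) / 2 - (∫ c, c.1 ^ 2 ∂(Q false)) / 2) * hbal

lemma stationaryProb_mem_Icc {q : Bool → ℝ} (h0 : 0 ≤ q false) (h1 : q true ≤ 1)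
    (hq : q true - q false < 1) : stationaryProb q ∈ Set.Icc 0 1 := by
  have : 0 < 1 - (q true - q false) := by linarith
  refine ⟨div_nonneg h0 this.le, ?_⟩
  rw [stationaryProb, div_le_one this]
  linarith

/-- Suppose that `∫ c.2 ∂(Q true) * d + (∫ c.1 ^ 2 ∂(Q true)) / 2 = d ^ 2` for the mean length `d` of
a DOP cycle, so that DOP on its own has average age `d`, and that a DNP cycle that starts with age `0` and is
followed by a DOP cycle has, with the area that its final age adds there, an average age of at least
`d`. Then no policy has an average age below `d`. -/
lemma le_averageAge [∀ b, IsProbabilityMeasure (Q b)] (hlab : Measurable lab)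
    (hq : |(Q true).real (lab ⁻¹' {true}) - (Q false).real (lab ⁻¹' {true})| < 1)
    (h1 : ∀ b, Integrable (fun c => c.1) (Q b)) (h2 : ∀ b, Integrable (fun c => c.1 ^ 2) (Q b))
    (h3 : ∀ b, Integrable (fun c => c.2) (Q b)) (hpos : ∀ b, ∀ᵐ c ∂(Q b), 0 ≤ c.2)
    (hd : 0 < ∫ c, c.1 ∂(Q true)) (hle : ∫ c, c.1 ∂(Q true) ≤ ∫ c, c.1 ∂(Q false))
    (hdop : (∫ c, c.2 ∂(Q true)) * ∫ c, c.1 ∂(Q true) + (∫ c, c.1 ^ 2 ∂(Q true)) / 2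
      = (∫ c, c.1 ∂(Q true)) ^ 2)
    (hdnp : (∫ c, c.1 ∂(Q true)) * ∫ c, c.1 ∂(Q false)
      ≤ (∫ c, c.2 ∂(Q false)) * ∫ c, c.1 ∂(Q true) + (∫ c, c.1 ^ 2 ∂(Q false)) / 2) :
    ∫ c, c.1 ∂(Q true) ≤ averageAge Q lab := by
  obtain ⟨hp0, hp1⟩ := stationaryProb_mem_Icc (q := fun b => (Q b).real (lab ⁻¹' {true}))
    measureReal_nonneg measureReal_le_one (abs_lt.1 hq).2
  rw [averageAge_eq hlab hq h1 h2 h3 rfl]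
  set p := stationaryProb fun b => (Q b).real (lab ⁻¹' {true})
  have hu : ∀ b, 0 ≤ ∫ c in lab ⁻¹' {false}, c.2 ∂(Q b) := fun b =>
    integral_nonneg_of_ae (ae_restrict_of_ae (hpos b))
  have hp1' : 0 ≤ 1 - p := by linarith
  have hden : 0 < p * ∫ c, c.1 ∂(Q true) + (1 - p) * ∫ c, c.1 ∂(Q false) := by
    nlinarith [mul_le_mul_of_nonneg_left hle hp1']
  rw [le_div_iff₀ hden]
  have k1 := mul_nonneg (add_nonneg (mul_nonneg hp0 (hu true)) (mul_nonneg hp1' (hu false)))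
    (sub_nonneg.2 hle)
  have k2 := mul_le_mul_of_nonneg_left hdnp hp1'
  linear_combination k1 + k2 - p * hdop

lemma policyAction_preimage_true (D : Set ℝ) :
    policyAction D ⁻¹' {true} = Prod.snd ⁻¹' D := by
  ext c
  simp [policyAction]

lemma measurable_policyAction {D : Set ℝ} (hD : MeasurableSet D) : Measurable (policyAction D) := by
  refine measurable_to_bool ?_
  rw [policyAction_preimage_true]
  exact measurable_snd hD

lemma measurableSet_thresholdPolicy (θ : ℝ≥0∞) : MeasurableSet (thresholdPolicy θ) :=
  measurableSet_lt ENNReal.measurable_ofReal measurable_const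

lemma tendsto_setIntegral_thresholdPolicy {ρ : Measure (ℝ × ℝ)} {g : ℝ × ℝ → ℝ}
    (hg : Integrable g ρ) :
    Tendsto (fun θ : ℝ≥0 => ∫ c in policyAction (thresholdPolicy θ) ⁻¹' {false}, g c ∂ρ) atTop
      (𝓝 0) := by
  have hmeas : ∀ θ : ℝ≥0, MeasurableSet (policyAction (thresholdPolicy θ) ⁻¹' {false}) := fun θ =>
    measurable_policyAction (measurableSet_thresholdPolicy θ) (measurableSet_singleton _)
  simp_rw [← integral_indicator (hmeas _)]
  rw [← integral_zero (ℝ × ℝ) ℝ (μ := ρ)]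
  refine tendsto_integral_filter_of_dominated_convergence (fun c => ‖g c‖)
    (Eventually.of_forall fun θ => (hg.indicator (hmeas θ)).aestronglyMeasurable)
    (Eventually.of_forall fun θ => Eventually.of_forall fun c => norm_indicator_le_norm_self _ _)
    hg.norm (Eventually.of_forall fun c => ?_)
  refine tendsto_const_nhds.congr' ?_
  filter_upwards [eventually_gt_atTop c.2.toNNReal] with θ hθ
  rw [Set.indicator_of_notMem]
  have : ENNReal.ofReal c.2 < θ := ENNReal.coe_lt_coe.2 hθ
  simpa [policyAction, thresholdPolicy] using this

/-- As the threshold grows, the average age approaches that of DOP on its own. -/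
lemma tendsto_averageAge_thresholdPolicy [∀ b, IsProbabilityMeasure (Q b)]
    (hq : ∀ θ : ℝ≥0, |(Q true).real (policyAction (thresholdPolicy θ) ⁻¹' {true})
      - (Q false).real (policyAction (thresholdPolicy θ) ⁻¹' {true})| < 1)
    (h1 : ∀ b, Integrable (fun c => c.1) (Q b)) (h2 : ∀ b, Integrable (fun c => c.1 ^ 2) (Q b))
    (h3 : ∀ b, Integrable (fun c => c.2) (Q b)) (hd : 0 < ∫ c, c.1 ∂(Q true)) :
    Tendsto (fun θ : ℝ≥0 => averageAge Q (policyAction (thresholdPolicy θ))) atTop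
      (𝓝 (((∫ c, c.2 ∂(Q true)) * ∫ c, c.1 ∂(Q true) + (∫ c, c.1 ^ 2 ∂(Q true)) / 2)
        / ∫ c, c.1 ∂(Q true))) := by
  have hlab := fun θ : ℝ≥0 => measurable_policyAction (measurableSet_thresholdPolicy θ)
  have hprob : ∀ b, Tendsto (fun θ : ℝ≥0 => (Q b).real (policyAction (thresholdPolicy θ) ⁻¹' {true}))
      atTop (𝓝 1) := by
    intro b
    have := (tendsto_setIntegral_thresholdPolicy (integrable_const (μ := Q b) (1 : ℝ))).const_sub 1
    rw [sub_zero] at this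
    refine this.congr fun θ => ?_
    have h := setIntegral_lab_add (hlab θ) (integrable_const (μ := Q b) (1 : ℝ))
    simp only [integral_const, smul_eq_mul, mul_one, probReal_univ, measureReal_restrict_apply_univ]
      at h ⊢
    linarith
  have hp : Tendsto (fun θ : ℝ≥0 => stationaryProb fun b =>
      (Q b).real (policyAction (thresholdPolicy θ) ⁻¹' {true})) atTop (𝓝 1) := by
    have := (hprob false).div (((hprob true).sub (hprob false)).const_sub 1) (by norm_num)
    rw [sub_self, sub_zero, div_one] at this
    exact this
  have hp' := hp.const_sub 1
  rw [sub_self] at hp'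
  have hu := fun b => tendsto_setIntegral_thresholdPolicy (h3 b)
  have hnum := (((((hp.mul_const (∫ c, c.2 ∂(Q true))).add
    (hp'.mul_const (∫ c, c.2 ∂(Q false)))).mul_const (∫ c, c.1 ∂(Q true))).add
    (((hp.mul (hu true)).add (hp'.mul (hu false))).mul_const
      (∫ c, c.1 ∂(Q false) - ∫ c, c.1 ∂(Q true)))).add
    (hp.mul_const ((∫ c, c.1 ^ 2 ∂(Q true)) / 2))).add
    (hp'.mul_const ((∫ c, c.1 ^ 2 ∂(Q false)) / 2))
  have hden := (hp.mul_const (∫ c, c.1 ∂(Q true))).add (hp'.mul_const (∫ c, c.1 ∂(Q false)))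
  have := hnum.div hden (by simpa using hd.ne')
  simp only [one_mul, zero_mul, mul_zero, add_zero] at this
  refine this.congr fun θ => ?_
  rw [averageAge_eq (hlab θ) (hq θ) h1 h2 h3 rfl]
  rfl

lemma averageAge_alwaysDOP [∀ b, IsProbabilityMeasure (Q b)]
    (h1 : ∀ b, Integrable (fun c => c.1) (Q b)) (h2 : ∀ b, Integrable (fun c => c.1 ^ 2) (Q b))
    (h3 : ∀ b, Integrable (fun c => c.2) (Q b)) :
    averageAge Q (policyAction alwaysDOP)
      = ((∫ c, c.2 ∂(Q true)) * ∫ c, c.1 ∂(Q true) + (∫ c, c.1 ^ 2 ∂(Q true)) / 2)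
        / ∫ c, c.1 ∂(Q true) := by
  have ht : policyAction alwaysDOP ⁻¹' {true} = Set.univ := by
    rw [policyAction_preimage_true]
    rfl
  have hf : policyAction alwaysDOP ⁻¹' {false} = ∅ := by
    ext c
    simp [policyAction, alwaysDOP]
  rw [averageAge_eq (measurable_policyAction (D := alwaysDOP) MeasurableSet.univ) (by rw [ht]; simp) h1 h2 h3
    (p := 1) (by rw [ht]; simp [stationaryProb]), hf]
  simp

lemma thresholdPolicy_top : thresholdPolicy ⊤ = alwaysDOP := by
  ext g
  simp [thresholdPolicy, alwaysDOP]

end AverageAge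

/-! ### Almost sure convergence of the time average -/

section Convergence

variable {lam : ℝ} {τ : Measure ℝ}

lemma integral_cycleLaw (b : Bool) {f : ℝ × ℝ → ℝ} (hf : Measurable f) :
    ∫ c, f c ∂(cycleLaw lam τ b) = ∫ z, f (cycleData b z) ∂(inputLaw (expMeasure lam) τ) :=
  integral_map (measurable_cycleData b).aemeasurable hf.aestronglyMeasurable

lemma integrable_cycleLaw_iff (b : Bool) {f : ℝ × ℝ → ℝ} (hf : Measurable f) :
    Integrable f (cycleLaw lam τ b)
      ↔ Integrable (fun z => f (cycleData b z)) (inputLaw (expMeasure lam) τ) :=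
  integrable_map_measure hf.aestronglyMeasurable (measurable_cycleData b).aemeasurable

variable [IsProbabilityMeasure τ]

lemma ae_cycleLaw_nonneg (hlam : 0 < lam) (hτ : ∀ᵐ t ∂τ, 0 ≤ t) (b : Bool) :
    ∀ᵐ c ∂(cycleLaw lam τ b), 0 ≤ c.2 := by
  refine (ae_map_iff (measurable_cycleData b).aemeasurable
    (measurableSet_le measurable_const measurable_snd)).2 ?_
  filter_upwards [ae_isGood hlam hτ] with z hz
  exact hz.transfer_nonneg _

/-- The transfer time of the delivered packet under DOP is absolutely continuous with respect to the
law of the transfer times, which is the law of the former under DNP. Hence it is impossible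
that DOP is almost surely followed by DNP and DNP almost surely by DOP, and that both actions are
almost surely repeated. -/
lemma abs_sub_policyAction_lt_one (hlam : 0 < lam) {D : Set ℝ} (hD : MeasurableSet D) :
    |(cycleLaw lam τ true).real (policyAction D ⁻¹' {true})
      - (cycleLaw lam τ false).real (policyAction D ⁻¹' {true})| < 1 := by
  have := isProbabilityMeasure_expMeasure hlam
  have hpr := isProbabilityMeasure_cycleLaw (τ := τ) hlam
  have hac : ∀ A : Set ℝ, MeasurableSet A →
      (cycleLaw lam τ false).real (Prod.snd ⁻¹' A) = 0 →
      (cycleLaw lam τ true).real (Prod.snd ⁻¹' A) = 0 := by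
    intro A hA h0
    rw [measureReal_eq_zero_iff, cycleLaw, Measure.map_apply (measurable_cycleData _)
      (measurable_snd hA)] at h0 ⊢
    have hτA : τ A = 0 := by
      rw [← (measurePreserving_transfer (ε := expMeasure lam) (τ := τ) 0).measure_preimage
        hA.nullMeasurableSet]
      exact h0
    refine measure_mono_null (t := ⋃ n, (fun z => transfer z n) ⁻¹' A)
      (fun z hz => Set.mem_iUnion.2 ⟨cyclePacket true z, hz⟩) (measure_iUnion_null fun n => ?_)
    rw [(measurePreserving_transfer n).measure_preimage hA.nullMeasurableSet, hτA]
  rw [policyAction_preimage_true]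
  have hcompl : ∀ b, (cycleLaw lam τ b).real (Prod.snd ⁻¹' Dᶜ)
      = 1 - (cycleLaw lam τ b).real (Prod.snd ⁻¹' D) := fun b => by
    rw [Set.preimage_compl, probReal_compl_eq_one_sub (measurable_snd hD)]
  have k1 := hac D hD
  have k2 := hac Dᶜ hD.compl
  rw [hcompl, hcompl] at k2
  have t0 : 0 ≤ (cycleLaw lam τ true).real (Prod.snd ⁻¹' D) := measureReal_nonneg
  have f0 : 0 ≤ (cycleLaw lam τ false).real (Prod.snd ⁻¹' D) := measureReal_nonneg
  have t1 : (cycleLaw lam τ true).real (Prod.snd ⁻¹' D) ≤ 1 := measureReal_le_one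
  have f1 : (cycleLaw lam τ false).real (Prod.snd ⁻¹' D) ≤ 1 := measureReal_le_one
  rw [abs_lt]
  constructor
  · by_contra! hcon
    linarith [k2 (by linarith)]
  · by_contra! hcon
    linarith [k1 (by linarith)]

lemma integrable_cycleLaw (hlam : 0 < lam) (hτ : ∀ᵐ t ∂τ, 0 ≤ t)
    (hint : Integrable (fun t => t) τ) (hint2 : Integrable (fun t => t ^ 2) τ) (b : Bool) :
    Integrable (fun c => c.1) (cycleLaw lam τ b) ∧ Integrable (fun c => c.1 ^ 2) (cycleLaw lam τ b) ∧
      Integrable (fun c => c.2) (cycleLaw lam τ b) := by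
  have := isProbabilityMeasure_expMeasure hlam
  have hsq : Integrable (fun z => cycleLength b z ^ 2) (inputLaw (expMeasure lam) τ) := by
    cases b
    · exact (integral_cycleLength_dnp hlam hint hint2).1
    · exact (integral_cycleLength_dop hlam hτ).1
  have hL : MemLp (cycleLength b) 2 (inputLaw (expMeasure lam) τ) :=
    (memLp_two_iff_integrable_sq (measurable_cycleLength b).aestronglyMeasurable).2 hsq
  refine ⟨(integrable_cycleLaw_iff b measurable_fst).2 (hL.integrable one_le_two),
    (integrable_cycleLaw_iff b (measurable_fst.pow_const 2)).2 hsq,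
    (integrable_cycleLaw_iff b measurable_snd).2 ?_⟩
  cases b
  · exact (measurePreserving_transfer 0).integrable_comp_of_integrable hint
  · exact (integral_age_dop hlam hτ hint).1

lemma integral_fst_cycleLaw_pos (hlam : 0 < lam) (hτ : ∀ᵐ t ∂τ, 0 ≤ t)
    (hint : Integrable (fun t => t) τ) (hint2 : Integrable (fun t => t ^ 2) τ) (b : Bool) :
    0 < ∫ c, c.1 ∂(cycleLaw lam τ b) := by
  have := isProbabilityMeasure_expMeasure hlam
  have := isProbabilityMeasure_cycleLaw (τ := τ) hlam b
  have hpos : ∀ᵐ c ∂(cycleLaw lam τ b), 0 < c.1 := by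
    refine (ae_map_iff (measurable_cycleData b).aemeasurable
      (measurableSet_lt measurable_const measurable_fst)).2 ?_
    filter_upwards [ae_isGood hlam hτ] with z hz
    exact hz.cycleLength_pos b
  refine lt_of_le_of_ne (integral_nonneg_of_ae (hpos.mono fun c hc => hc.le)) fun h0 => ?_
  have := (integral_eq_zero_iff_of_nonneg_ae (hpos.mono fun c hc => hc.le)
    (integrable_cycleLaw hlam hτ hint hint2 b).1).1 h0.symm
  obtain ⟨c, hc, hc'⟩ := (hpos.and this).exists
  exact hc.ne' hc'

/-- The area under the age in the cycles, apart from the first one, is a function of the data of two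
successive cycles. -/
theorem ae_tendsto_avgAge (hlam : 0 < lam) (hτ : ∀ᵐ t ∂τ, 0 ≤ t)
    (hint : Integrable (fun t => t) τ) (hint2 : Integrable (fun t => t ^ 2) τ) {D : Set ℝ}
    (hD : MeasurableSet D) {g₀ : ℝ} (hg : 0 ≤ g₀) :
    ∀ᵐ z ∂(inputLaw (expMeasure lam) τ), Tendsto (avgAge D g₀ (gap z) (transfer z)) atTop
      (𝓝 (averageAge (cycleLaw lam τ) (policyAction D))) := by
  have := isProbabilityMeasure_expMeasure hlam
  have hpr := isProbabilityMeasure_cycleLaw (τ := τ) hlam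
  have hreg := isRegenerative_cycle hlam hτ
  have hlab := measurable_policyAction hD
  have hq := abs_sub_policyAction_lt_one (τ := τ) hlam hD
  have hI := integrable_cycleLaw hlam hτ hint hint2
  have hd : 0 < stationaryMean (cycleLaw lam τ) (policyAction D) Prod.fst := by
    obtain ⟨hp0, hp1⟩ := stationaryProb_mem_Icc
      (q := fun b => (cycleLaw lam τ b).real (policyAction D ⁻¹' {true}))
      measureReal_nonneg measureReal_le_one (abs_lt.1 hq).2
    have ht := integral_fst_cycleLaw_pos hlam hτ hint hint2 true
    have hf := integral_fst_cycleLaw_pos hlam hτ hint hint2 false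
    unfold stationaryMean
    rcases hp0.eq_or_lt with h | h
    · rw [← h]
      simpa using hf
    · exact add_pos_of_pos_of_nonneg (mul_pos h ht) (mul_nonneg (by linarith) hf.le)
  filter_upwards [ae_isGood hlam hτ,
    hreg.ae_tendsto_average hlab (abs_lt.1 hq).2 measurable_fst (fun b => (hI b).1)
      (policyAction D (0, g₀)),
    hreg.ae_tendsto_pair_average hlab hq measurable_ageArea
      (fun b => (integral_ageArea hlab (fun b => (hI b).1) (fun b => (hI b).2.1)
        (fun b => (hI b).2.2) b).1) (policyAction D (0, g₀))] with z hz hlen harea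
  have htime := fun k => (hz.epoch_eq_run D g₀ k).1
  have hsub : ∀ k, (epoch D g₀ (gap z) (transfer z) (k + 1)).time
      - (epoch D g₀ (gap z) (transfer z) k).time
      = (run cycle (policyAction D) k (policyAction D (0, g₀)) z).1 := fun k => by
    rw [htime k]
    ring
  refine tendsto_avgAge (strictMono_nat_of_lt_succ fun k => ?_) (fun k => ?_) hd ?_ ?_
  · rw [htime k]
    linarith [(hz.run_pos D k (policyAction D (0, g₀))).1]
  · cases k with
    | zero => simpa [epoch, Epoch.age] using hg
    | succ k =>
      rw [(hz.epoch_eq_run D g₀ k).2]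
      exact (hz.run_pos D k _).2
  · refine hlen.congr fun K => ?_
    congr 1
    induction K with
    | zero => rfl
    | succ K ih => rw [Finset.sum_range_succ, ih, htime K]
  · rw [← tendsto_add_atTop_iff_nat 1]
    have hfrac : Tendsto (fun K : ℕ => (K : ℝ) / (K + 1)) atTop (𝓝 1) :=
      tendsto_natCast_div_add_atTop 1
    have hfirst : Tendsto (fun K : ℕ => ((epoch D g₀ (gap z) (transfer z) 0).age
        * ((epoch D g₀ (gap z) (transfer z) (0 + 1)).time
          - (epoch D g₀ (gap z) (transfer z) 0).time)
        + ((epoch D g₀ (gap z) (transfer z) (0 + 1)).time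
          - (epoch D g₀ (gap z) (transfer z) 0).time) ^ 2 / 2) / ((K : ℝ) + 1)) atTop (𝓝 0) :=
      tendsto_const_nhds.div_atTop
        (tendsto_atTop_add_const_right _ _ tendsto_natCast_atTop_atTop)
    have := (harea.mul hfrac).add hfirst
    rw [mul_one, add_zero] at this
    refine this.congr' ?_
    filter_upwards [eventually_gt_atTop 0] with K hK
    have hK' : (K : ℝ) ≠ 0 := by exact_mod_cast hK.ne'
    have hK1 : (K : ℝ) + 1 ≠ 0 := by positivity
    rw [Finset.sum_range_succ']
    have hsum : ∀ k, (epoch D g₀ (gap z) (transfer z) (k + 1)).age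
        * ((epoch D g₀ (gap z) (transfer z) (k + 1 + 1)).time
          - (epoch D g₀ (gap z) (transfer z) (k + 1)).time)
        + ((epoch D g₀ (gap z) (transfer z) (k + 1 + 1)).time
          - (epoch D g₀ (gap z) (transfer z) (k + 1)).time) ^ 2 / 2
        = ageArea (run cycle (policyAction D) k (policyAction D (0, g₀)) z,
            run cycle (policyAction D) (k + 1) (policyAction D (0, g₀)) z) := fun k => by
      rw [hsub (k + 1), (hz.epoch_eq_run D g₀ k).2, ageArea]
    simp_rw [hsum]
    push_cast
    field_simp

/-- The mean length of a DOP cycle, and the identity that makes it the average age under DOP. -/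
lemma cycleLaw_true_moments (hlam : 0 < lam) (hτ : ∀ᵐ t ∂τ, 0 ≤ t)
    (hint : Integrable (fun t => t) τ) (hint2 : Integrable (fun t => t ^ 2) τ) :
    ∫ c, c.1 ∂(cycleLaw lam τ true) = 1 / (lam * successProb lam τ) ∧
    (∫ c, c.2 ∂(cycleLaw lam τ true)) * ∫ c, c.1 ∂(cycleLaw lam τ true)
        + (∫ c, c.1 ^ 2 ∂(cycleLaw lam τ true)) / 2
      = (∫ c, c.1 ∂(cycleLaw lam τ true)) ^ 2 := by
  have hγ := successProb_pos hlam hτ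
  have k1 := (integral_age_dop hlam hτ hint).2
  have k2 := integral_excess hlam hτ hint
  have k3 := integral_excess_sq hlam hτ hint hint2
  obtain ⟨-, k4, k5⟩ := integral_cycleLength_dop (τ := τ) hlam hτ
  rw [integral_cycleLaw true measurable_fst, integral_cycleLaw true measurable_snd,
    integral_cycleLaw true (measurable_fst.pow_const 2)]
  simp only [cycleData]
  rw [k4, k5]
  set E := ∫ z, excess z ∂(inputLaw (expMeasure lam) τ)
  set E2 := ∫ z, excess z ^ 2 ∂(inputLaw (expMeasure lam) τ)
  set A := ∫ z, transfer z (cyclePacket true z) ∂(inputLaw (expMeasure lam) τ)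
  set γ := successProb lam τ
  set β := ∫ t, Real.exp (-lam * t) * t ∂τ
  have hE : E = (1 - γ) / lam / γ := by rw [← k2]; field_simp
  have hA : A = β / γ := by rw [← k1]; field_simp
  have hE2 : E2 = (2 / lam ^ 2 - β * (2 / lam) - γ * (2 / lam ^ 2)
      + 2 * (1 / lam - (β + γ / lam)) * E) / γ := by rw [← k3]; field_simp
  rw [hE2, hE, hA]
  constructor
  · field_simp
    ring
  · field_simp
    ring

lemma cycleLaw_false_moments (hlam : 0 < lam)
    (hint : Integrable (fun t => t) τ) (hint2 : Integrable (fun t => t ^ 2) τ) :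
    ∫ c, c.1 ∂(cycleLaw lam τ false) = 1 / lam + ∫ t, t ∂τ ∧
    ∫ c, c.2 ∂(cycleLaw lam τ false) = ∫ t, t ∂τ ∧
    ∫ c, c.1 ^ 2 ∂(cycleLaw lam τ false)
      = 2 / lam ^ 2 + 2 * (1 / lam) * ∫ t, t ∂τ + ∫ t, t ^ 2 ∂τ := by
  have := isProbabilityMeasure_expMeasure hlam
  obtain ⟨-, k1, k2⟩ := integral_cycleLength_dnp hlam hint hint2
  rw [integral_cycleLaw false measurable_fst, integral_cycleLaw false measurable_snd,
    integral_cycleLaw false (measurable_fst.pow_const 2)]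
  refine ⟨k1, ?_, k2⟩
  exact integral_comp_of_measurePreserving (measurePreserving_transfer 0) measurable_id

/-- The area under the age in a DNP cycle that starts with age `0`, and the area that its transfer
time adds to a DOP cycle that follows, together have at least the mean that corresponds to the
average age `∫ c.1 ∂(cycleLaw lam τ true)` over the DNP cycle. -/
lemma mul_le_cycleLaw_false (hlam : 0 < lam)
    (hint : Integrable (fun t => t) τ) (hint2 : Integrable (fun t => t ^ 2) τ)
    (hle : ∫ c, c.1 ∂(cycleLaw lam τ true) ≤ ∫ c, c.1 ∂(cycleLaw lam τ false)) :
    (∫ c, c.1 ∂(cycleLaw lam τ true)) * ∫ c, c.1 ∂(cycleLaw lam τ false)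
      ≤ (∫ c, c.2 ∂(cycleLaw lam τ false)) * ∫ c, c.1 ∂(cycleLaw lam τ true)
        + (∫ c, c.1 ^ 2 ∂(cycleLaw lam τ false)) / 2 := by
  obtain ⟨k1, k2, k3⟩ := cycleLaw_false_moments hlam hint hint2
  rw [k1] at hle
  rw [k1, k2, k3]
  have hsq : 0 ≤ ∫ t, t ^ 2 ∂τ := integral_nonneg fun t => sq_nonneg t
  have := mul_le_mul_of_nonneg_left hle (one_div_pos.2 hlam).le
  have e : 2 / lam ^ 2 = 2 * (1 / lam * (1 / lam)) := by field_simp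
  rw [e]
  linarith

end Convergence

end

theorem theorem1 {Ω : Type*} [MeasurableSpace Ω] (μ : Measure Ω) [IsProbabilityMeasure μ]
    (lam : ℝ) (hlam : 0 < lam) (ξ T : ℕ → Ω → ℝ)
    (hξm : ∀ n, Measurable (ξ n)) (hTm : ∀ n, Measurable (T n))
    (hξ : ∀ n, μ.map (ξ n) = expMeasure lam)
    (hT : ∀ n, IdentDistrib (T n) (T 0) μ μ)
    (hind : iIndepFun (Sum.elim ξ T : ℕ ⊕ ℕ → Ω → ℝ) μ)
    (hTnonneg : ∀ᵐ ω ∂μ, 0 ≤ T 0 ω) (hTsq : MemLp (T 0) 2 μ) :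
    -- the mean cycle lengths are finite and have the stated values
    (Integrable (fun ω => dnpCycle (fun n => ξ n ω) (fun n => T n ω)) μ ∧
      ∫ ω, dnpCycle (fun n => ξ n ω) (fun n => T n ω) ∂μ = 1 / lam + ∫ ω, T 0 ω ∂μ) ∧
    (Integrable (fun ω => dopCycle (fun n => ξ n ω) (fun n => T n ω)) μ ∧
      ∫ ω, dopCycle (fun n => ξ n ω) (fun n => T n ω) ∂μ
        = 1 / (lam * ∫ ω, Real.exp (-lam * T 0 ω) ∂μ)) ∧
    μ.real {ω | T 0 ω ≤ ξ 1 ω} = ∫ ω, Real.exp (-lam * T 0 ω) ∂μ ∧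
    -- the average ages exist almost surely
    ∃ (a : ℝ≥0∞ → ℝ) (aDOP : ℝ),
      (∀ θ : ℝ≥0∞, ∀ g₀ : ℝ, 0 ≤ g₀ → ∀ᵐ ω ∂μ,
        Tendsto (avgAge (thresholdPolicy θ) g₀ (fun n => ξ n ω) (fun n => T n ω))
          atTop (𝓝 (a θ))) ∧
      (∀ g₀ : ℝ, 0 ≤ g₀ → ∀ᵐ ω ∂μ,
        Tendsto (avgAge alwaysDOP g₀ (fun n => ξ n ω) (fun n => T n ω))
          atTop (𝓝 aDOP)) ∧
      -- if the mean DNP cycle is at least the mean DOP cycle, then DOP is optimal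
      (∫ ω, dopCycle (fun n => ξ n ω) (fun n => T n ω) ∂μ
          ≤ ∫ ω, dnpCycle (fun n => ξ n ω) (fun n => T n ω) ∂μ →
        IsLeast (Set.range a) aDOP ∧
        a ⊤ = aDOP ∧
        IsGLB (Set.range fun θ : ℝ≥0 => a θ) aDOP ∧
        Tendsto (fun θ : ℝ≥0 => a θ) atTop (𝓝 aDOP) ∧
        aDOP = 1 / (lam * ∫ ω, Real.exp (-lam * T 0 ω) ∂μ)) := by
  have := isProbabilityMeasure_expMeasure hlam
  set τ : Measure ℝ := μ.map (T 0) with hτdef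
  have : IsProbabilityMeasure τ := Measure.isProbabilityMeasure_map (hTm 0).aemeasurable
  have hτ : ∀ᵐ t ∂τ, 0 ≤ t :=
    (ae_map_iff (hTm 0).aemeasurable measurableSet_Ici).2 hTnonneg
  have hint : Integrable (fun t => t) τ :=
    (integrable_map_measure aestronglyMeasurable_id (hTm 0).aemeasurable).2
      (hTsq.integrable one_le_two)
  have hint2 : Integrable (fun t => t ^ 2) τ :=
    (integrable_map_measure (by fun_prop) (hTm 0).aemeasurable).2 hTsq.integrable_sq
  -- the law of the whole input
  let Z : Ω → Input := fun ω i => (Sum.elim ξ T : ℕ ⊕ ℕ → Ω → ℝ) i ω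
  have hcoord : ∀ i, Measurable ((Sum.elim ξ T : ℕ ⊕ ℕ → Ω → ℝ) i) := by
    rintro (n | n)
    exacts [hξm n, hTm n]
  have hZ : MeasurePreserving Z μ (inputLaw (expMeasure lam) τ) := by
    refine ⟨measurable_pi_lambda _ hcoord, ?_⟩
    refine (hind.map_fun_eq_infinitePi_map hcoord).trans ?_
    rw [inputLaw]
    congr 1
    funext i
    rcases i with n | n
    exacts [hξ n, (hT n).map_eq]
  have hae : ∀ {p : Input → Prop}, (∀ᵐ z ∂(inputLaw (expMeasure lam) τ), p z) →
      ∀ᵐ ω ∂μ, p (Z ω) := fun h => hZ.quasiMeasurePreserving.ae h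
  have hI := integrable_cycleLaw hlam hτ hint hint2
  have hlen : ∀ b, Integrable (fun ω => cycleLength b (Z ω)) μ ∧
      ∫ ω, cycleLength b (Z ω) ∂μ = ∫ c, c.1 ∂(cycleLaw lam τ b) := fun b =>
    ⟨hZ.integrable_comp_of_integrable ((integrable_cycleLaw_iff b measurable_fst).1 (hI b).1),
      (integral_comp_of_measurePreserving hZ (measurable_cycleLength b)).trans
        (integral_cycleLaw b measurable_fst).symm⟩
  have hdnp : (fun ω => dnpCycle (fun n => ξ n ω) (fun n => T n ω))
      = fun ω => cycleLength false (Z ω) := by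
    funext ω
    simp [dnpCycle, cycleLength, cyclePacket, arrival, gap, transfer, Z]
  have hdop : (fun ω => dopCycle (fun n => ξ n ω) (fun n => T n ω))
      = fun ω => cycleLength true (Z ω) := rfl
  have hγ : ∫ ω, Real.exp (-lam * T 0 ω) ∂μ = successProb lam τ :=
    (integral_map (hTm 0).aemeasurable (f := fun t => Real.exp (-lam * t))
      (by fun_prop)).symm
  have hET : ∫ ω, T 0 ω ∂μ = ∫ t, t ∂τ :=
    (integral_map (hTm 0).aemeasurable aestronglyMeasurable_id).symm
  obtain ⟨hmean, harea⟩ := cycleLaw_true_moments hlam hτ hint hint2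
  have hdpos := integral_fst_cycleLaw_pos hlam hτ hint hint2 true
  have hpr := isProbabilityMeasure_cycleLaw (τ := τ) hlam
  rw [hdnp, hdop, (hlen true).2, (hlen false).2, hγ, hET]
  refine ⟨⟨(hlen false).1, (cycleLaw_false_moments hlam hint hint2).1⟩, ⟨(hlen true).1, hmean⟩, ?_,
    fun θ => averageAge (cycleLaw lam τ) (policyAction (thresholdPolicy θ)),
    averageAge (cycleLaw lam τ) (policyAction alwaysDOP), fun θ g₀ hg => ?_, fun g₀ hg => ?_,
    fun hle => ?_⟩
  · have hpair := (measurePreserving_transfer_gap (ε := expMeasure lam) (τ := τ) 0 1).comp hZ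
    have hm : MeasurableSet completed := measurableSet_le measurable_fst measurable_snd
    rw [← integral_completed_one hlam hτ, integral_indicator hm, setIntegral_const, smul_eq_mul,
      mul_one, measureReal_def, measureReal_def, ← hpair.measure_preimage hm.nullMeasurableSet]
    rfl
  · exact hae (ae_tendsto_avgAge hlam hτ hint hint2 (measurableSet_thresholdPolicy θ) hg)
  · exact hae (ae_tendsto_avgAge hlam hτ hint hint2 (D := alwaysDOP) MeasurableSet.univ hg)
  · have hDOP : averageAge (cycleLaw lam τ) (policyAction alwaysDOP)
        = ∫ c, c.1 ∂(cycleLaw lam τ true) := by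
      rw [averageAge_alwaysDOP (fun b => (hI b).1) (fun b => (hI b).2.1) (fun b => (hI b).2.2),
        harea, sq, mul_div_assoc, div_self hdpos.ne', mul_one]
    have hlow : ∀ θ, averageAge (cycleLaw lam τ) (policyAction alwaysDOP)
        ≤ averageAge (cycleLaw lam τ) (policyAction (thresholdPolicy θ)) := fun θ => by
      rw [hDOP]
      exact le_averageAge (measurable_policyAction (measurableSet_thresholdPolicy θ))
        (abs_sub_policyAction_lt_one hlam (measurableSet_thresholdPolicy θ))
        (fun b => (hI b).1) (fun b => (hI b).2.1) (fun b => (hI b).2.2)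
        (ae_cycleLaw_nonneg hlam hτ) hdpos hle harea
        (mul_le_cycleLaw_false hlam hint hint2 hle)
    have hlim : Tendsto (fun θ : ℝ≥0 =>
        averageAge (cycleLaw lam τ) (policyAction (thresholdPolicy θ))) atTop
        (𝓝 (averageAge (cycleLaw lam τ) (policyAction alwaysDOP))) := by
      rw [averageAge_alwaysDOP (fun b => (hI b).1) (fun b => (hI b).2.1) (fun b => (hI b).2.2)]
      exact tendsto_averageAge_thresholdPolicy
        (fun θ => abs_sub_policyAction_lt_one hlam (measurableSet_thresholdPolicy θ))
        (fun b => (hI b).1) (fun b => (hI b).2.1) (fun b => (hI b).2.2) hdpos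
    have htop : averageAge (cycleLaw lam τ) (policyAction (thresholdPolicy ⊤))
        = averageAge (cycleLaw lam τ) (policyAction alwaysDOP) := by
      rw [thresholdPolicy_top]
    refine ⟨⟨⟨⊤, htop⟩, ?_⟩, htop, ⟨?_, fun l hl => ?_⟩, hlim, hDOP.trans hmean⟩
    · rintro _ ⟨θ, rfl⟩
      exact hlow θ
    · rintro _ ⟨θ, rfl⟩
      exact hlow θ
    · exact ge_of_tendsto' hlim fun θ => hl ⟨θ, rfl⟩
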